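/- Let $(M,g)$ be a smooth Riemannian $n$-manifold with Levi-Civita connection $\nabla$, let $p,q\ge 0$, and let $\omega$ be a smooth $(p,q)$ double form on $M$, i.e. a smooth section of $\Lambda^pT^*M\otimes\Lambda^qT^*M$. Juxtaposition (or a dot) denotes the exterior product of double forms, $(\theta_1\otimes\theta_2)(\theta_3\otimes\theta_4)=(\theta_1\wedge\theta_3)\otimes(\theta_2\wedge\theta_4)$, and $i_{v\otimes 1}$ is the insertion of $v$ in the left factor. For a local orthonormal frame $(e_i)$ with dual frame $(e^i)$ put $$D\omega=\sum_i(e^i\otimes 1)\,\nabla_{e_i}\omega,\qquad \delta\omega=-\sum_i i_{e_i\otimes 1}\nabla_{e_i}\omega,\qquad \nabla^2_{u,v}\omega=\nabla_u\nabla_v\omega-\nabla_{\nabla_uv}\omega,\qquad \nabla^*\nabla\omega=-\sum_i\nabla^2_{e_i,e_i}\omega,$$ and let the Weitzenböck curvature term be $$\mathrm{Weit}(\omega)=\sum_{i,j}i_{e_i\otimes 1}\bigl((e^j\otimes 1)\,R_{e_ie_j}\omega\bigr),\qquad R_{uv}\omega=\nabla^2_{v,u}\omega-\nabla^2_{u,v}\omega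 .$$ Let $R$ be the Riemann curvature $(2,2)$ double form, $R(u,v;z,w)=g\bigl((\nabla^2_{v,u}-\nabla^2_{u,v})z,w\bigr)$ (so $R=\tfrac12g^2$ on the unit sphere), and $\mathrm{Ric}=\sum_i i_{e_i\otimes e_i}R$ its contraction. Let $\circ$ be the bilinear composition product, $(\theta_1\otimes\theta_2)\circ(\theta_3\otimes\theta_4)=\langle\theta_1,\theta_4\rangle\,\theta_3\otimes\theta_2$, and $\#$ the bilinear sharp product, $(\alpha_1\otimes\alpha_2)\#(\beta_1\otimes\beta_2)=[\alpha_1,\beta_1]\otimes[\alpha_2,\beta_2]$, where $[\alpha,\beta]=\alpha\cdot\beta-\beta\cdot\alpha$ is the commutator of the Clifford product on $\Lambda T_x^*M$, the associative bilinear product with unit $1$ determined by $e\cdot\alpha=e\wedge\alpha-i_e\alpha$ for covectors $e$. Then $\mathrm{Weit}(\omega)$ is the curvature term of $\Delta=D\delta+\delta D$, that is $\Delta\omega=\nabla^*\nabla\omega+\mathrm{Weit}(\omega)$, and at every point of $M$ $$\mathrm{Weit}(\omega)=\omega\circ\Bigl(\frac{g^{p-1}\,\mathrm{Ric}}{(p-1)!}-2\,\frac{g^{p-2}R}{(p-2)!}\Bigr)-\frac14\,R\#\omega,$$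 where a term $g^k/k!$ with $k<0$ is read as $0$ and $g^0=1$. -/

import Mathlib

open Bundle Manifold TensorProduct
open scoped ContDiff Nat

noncomputable section

namespace DForm

/-! ### Double forms on a Euclidean vector space -/

section Algebra

/-- The exterior algebra `Λ V*`. -/
abbrev Forms (V : Type*) [AddCommGroup V] [Module ℝ V] : Type _ :=
  ExteriorAlgebra ℝ (Module.Dual ℝ V)

/-- The algebra of double forms `Λ V* ⊗ Λ V*`. Its multiplication is the exterior product of double
forms, `(θ₁ ⊗ θ₂)(θ₃ ⊗ θ₄) = (θ₁ ∧ θ₃) ⊗ (θ₂ ∧ θ₄)`. -/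
abbrev DoubleForms (V : Type*) [AddCommGroup V] [Module ℝ V] : Type _ :=
  Forms V ⊗[ℝ] Forms V

/-- The subspace `Λ^p V* ⊗ Λ^q V*` of `(p, q)` double forms. -/
def bidegree (V : Type*) [AddCommGroup V] [Module ℝ V] (p q : ℕ) : Submodule ℝ (DoubleForms V) :=
  LinearMap.range (TensorProduct.map (⋀[ℝ]^p (Module.Dual ℝ V)).subtype
    (⋀[ℝ]^q (Module.Dual ℝ V)).subtype)

/-- Pull-back of double forms along a linear map, `(L^* η)(u, …; z, …) = η(L u, …; L z, …)`. -/
def pullback {V W : Type*} [AddCommGroup V] [Module ℝ V] [AddCommGroup W] [Module ℝ W]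
    (L : V →ₗ[ℝ] W) : DoubleForms W →ₗ[ℝ] DoubleForms V :=
  TensorProduct.map (ExteriorAlgebra.map L.dualMap).toLinearMap
    (ExteriorAlgebra.map L.dualMap).toLinearMap

/-- The insertion `i_v : Λ V* → Λ V*` of a vector, the antiderivation with `i_v α = α v`. -/
def insertVec {V : Type*} [AddCommGroup V] [Module ℝ V] (v : V) : Forms V →ₗ[ℝ] Forms V :=
  CliffordAlgebra.contractLeft (Module.Dual.eval ℝ V v)

/-- `i_{v ⊗ 1}`. -/
def insertLeft {V : Type*} [AddCommGroup V] [Module ℝ V] (v : V) :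
    DoubleForms V →ₗ[ℝ] DoubleForms V :=
  TensorProduct.map (insertVec v) LinearMap.id

/-- `i_{1 ⊗ v}`. -/
def insertRight {V : Type*} [AddCommGroup V] [Module ℝ V] (v : V) :
    DoubleForms V →ₗ[ℝ] DoubleForms V :=
  TensorProduct.map LinearMap.id (insertVec v)

variable {V : Type*} [NormedAddCommGroup V] [InnerProductSpace ℝ V]

/-- The covector `v^♭ = g(v, ·)`, as a `1`-form. -/
def flat (v : V) : Forms V := ExteriorAlgebra.ι ℝ (innerₗ V v)

/-- The `(1, 0)` double form `v^♭ ⊗ 1`. -/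
def flatLeft (v : V) : DoubleForms V := flat v ⊗ₜ[ℝ] 1

/-- The `(0, 1)` double form `1 ⊗ v^♭`. -/
def flatRight (v : V) : DoubleForms V := 1 ⊗ₜ[ℝ] flat v

variable (V) in
/-- A chosen orthonormal basis `(e_i)` of `V`. -/
def onb [FiniteDimensional ℝ V] : OrthonormalBasis (Fin (Module.finrank ℝ V)) ℝ V :=
  stdOrthonormalBasis ℝ V

variable (V) in
/-- The basis `e^I ⊗ e^J` of the space of double forms. -/
def dfBasis [FiniteDimensional ℝ V] :
    Module.Basis (Finset (Fin (Module.finrank ℝ V)) × Finset (Fin (Module.finrank ℝ V))) ℝ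
      (DoubleForms V) :=
  (onb V).toBasis.dualBasis.ExteriorAlgebra.tensorProduct
    (onb V).toBasis.dualBasis.ExteriorAlgebra

/-- The vector `α^♯` with `g(α^♯, ·) = α`. -/
def sharp [FiniteDimensional ℝ V] : Module.Dual ℝ V →ₗ[ℝ] V :=
  ∑ i, (LinearMap.applyₗ (onb V i)).smulRight (onb V i)

/-- The inner product `⟨α, β⟩ = g(α^♯, β^♯)` of covectors. -/
def dualInner [FiniteDimensional ℝ V] : LinearMap.BilinForm ℝ (Module.Dual ℝ V) :=
  (innerₗ V).compl₁₂ sharp sharp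

theorem insertVec_insertVec (v : V) : insertVec v * insertVec v = (0 : Module.End ℝ (Forms V)) :=
  LinearMap.ext fun x => CliffordAlgebra.contractLeft_contractLeft (Q := 0) _ x

/-- The interior product `ι_α : Λ V* → Λ V*` by a form, i.e. the adjoint of left multiplication by
`α`: it is linear in `α`, `ι_α = i_{α^♯}` for a covector and `ι_{α ∧ β} = ι_β ∘ ι_α`. -/
def interiorMul [FiniteDimensional ℝ V] : Forms V →ₗ[ℝ] Module.End ℝ (Forms V) :=
  (ExteriorAlgebra.lift ℝ
    ⟨(CliffordAlgebra.contractLeft (Q := (0 : QuadraticForm ℝ (Module.Dual ℝ V)))) ∘ₗ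
        Module.Dual.eval ℝ V ∘ₗ sharp,
      fun α => insertVec_insertVec (sharp α)⟩).toLinearMap ∘ₗ CliffordAlgebra.reverse

/-- The standard inner product on `Λ V*`, for which the `e^{i₁} ∧ … ∧ e^{i_k}` (`i₁ < … < i_k`) are
orthonormal: `⟨α, β⟩` is the degree zero part of `ι_α β`. -/
def formInner [FiniteDimensional ℝ V] : Forms V →ₗ[ℝ] Forms V →ₗ[ℝ] ℝ :=
  interiorMul.compr₂ (ExteriorAlgebra.algebraMapInv).toLinearMap

/-- The composition product of double forms,
`(θ₁ ⊗ θ₂) ∘ (θ₃ ⊗ θ₄) = ⟨θ₁, θ₄⟩ θ₃ ⊗ θ₂`. -/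
def comp [FiniteDimensional ℝ V] : DoubleForms V →ₗ[ℝ] DoubleForms V →ₗ[ℝ] DoubleForms V :=
  TensorProduct.lift <| LinearMap.mk₂ ℝ
    (fun θ₁ θ₂ => (TensorProduct.mk ℝ (Forms V) (Forms V)).flip θ₂ ∘ₗ
      (TensorProduct.rid ℝ (Forms V)).toLinearMap ∘ₗ LinearMap.lTensor (Forms V) (formInner θ₁))
    (by intros; simp [LinearMap.comp_add])
    (by intros; simp [LinearMap.comp_smul])
    (by intros; simp [LinearMap.add_comp])
    (by intros; simp [LinearMap.smul_comp])

variable (V) in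
/-- The quadratic form `α ↦ -|α|²` on `V*`. -/
def cliffordForm [FiniteDimensional ℝ V] : QuadraticForm ℝ (Module.Dual ℝ V) :=
  -(dualInner (V := V)).toQuadraticMap

/-- The Clifford product on `Λ V*`: the associative bilinear product with unit `1` such that
`e . α = e ∧ α - i_e α` for a covector `e`. -/
def cliffordMul [FiniteDimensional ℝ V] : Forms V →ₗ[ℝ] Forms V →ₗ[ℝ] Forms V :=
  ((LinearMap.mul ℝ (CliffordAlgebra (cliffordForm V))).compl₁₂
    (CliffordAlgebra.equivExterior (cliffordForm V)).symm.toLinearMap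
    (CliffordAlgebra.equivExterior (cliffordForm V)).symm.toLinearMap).compr₂
    (CliffordAlgebra.equivExterior (cliffordForm V)).toLinearMap

/-- The Clifford Lie bracket `[α, β] = α . β - β . α` on `Λ V*`. -/
def cliffordBracket [FiniteDimensional ℝ V] : Forms V →ₗ[ℝ] Forms V →ₗ[ℝ] Forms V :=
  cliffordMul - cliffordMul.flip

/-- The sharp product of double forms, `(α₁ ⊗ α₂) # (β₁ ⊗ β₂) = [α₁, β₁] ⊗ [α₂, β₂]`. -/
def sharpProduct [FiniteDimensional ℝ V] :
    DoubleForms V →ₗ[ℝ] DoubleForms V →ₗ[ℝ] DoubleForms V :=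
  TensorProduct.map₂ cliffordBracket cliffordBracket

variable (V) in
/-- The metric as a `(1, 1)` double form, `g = ∑ e^i ⊗ e^i`. -/
def metricForm [FiniteDimensional ℝ V] : DoubleForms V :=
  ∑ i, flat (onb V i) ⊗ₜ[ℝ] flat (onb V i)

variable (V) in
/-- `g^k / k!` for an integer `k`, with the convention `g^k = 0` for `k < 0`. -/
def metricPow [FiniteDimensional ℝ V] (k : ℤ) : DoubleForms V :=
  if k < 0 then 0 else ((k.toNat ! : ℕ) : ℝ)⁻¹ • metricForm V ^ k.toNat

/-- The contraction `c η = ι_g η = ∑ i_{e_i ⊗ e_i} η` of double forms. -/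
def contraction [FiniteDimensional ℝ V] : DoubleForms V →ₗ[ℝ] DoubleForms V :=
  ∑ i, insertLeft (onb V i) ∘ₗ insertRight (onb V i)

/-- The `(2, 2)` double form whose value on `(u, v; z, w)` is `T u v z w`. -/
def doubleFormOfTensor [FiniteDimensional ℝ V] (T : V → V → V → V → ℝ) : DoubleForms V :=
  (1 / 4 : ℝ) • ∑ i, ∑ j, ∑ k, ∑ l, T (onb V i) (onb V j) (onb V k) (onb V l) •
    ((flat (onb V i) * flat (onb V j)) ⊗ₜ[ℝ] (flat (onb V k) * flat (onb V l)))

end Algebra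

/-! ### Double forms on a Riemannian manifold -/

section Manifold

variable {E : Type*} [NormedAddCommGroup E] [NormedSpace ℝ E] [FiniteDimensional ℝ E]
  {M : Type*} [TopologicalSpace M] [ChartedSpace E M] [IsManifold 𝓘(ℝ, E) ∞ M]

/-- The linear map `T_x M → T_y M` that sends `v` to the value at `y` of the local vector field
extending `v` with constant coefficients in the preferred bundle chart at `x`. -/
def transport (x y : M) : TangentSpace 𝓘(ℝ, E) x →ₗ[ℝ] TangentSpace 𝓘(ℝ, E) y :=
  ((trivializationAt E (TangentSpace 𝓘(ℝ, E)) x).symmL ℝ y).toLinearMap ∘ₗ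
    ((trivializationAt E (TangentSpace 𝓘(ℝ, E)) x).continuousLinearMapAt ℝ x).toLinearMap

theorem transport_apply (x y : M) (v : TangentSpace 𝓘(ℝ, E) x)
    (hy : y ∈ (trivializationAt E (TangentSpace 𝓘(ℝ, E)) x).baseSet) :
    transport x y v = FiberBundle.extend E v y := by
  have hx : x ∈ (trivializationAt E (TangentSpace 𝓘(ℝ, E)) x).baseSet :=
    FiberBundle.mem_baseSet_trivializationAt' x
  rw [transport, LinearMap.comp_apply, FiberBundle.extend]
  rw [ContinuousLinearMap.coe_coe, Bundle.Trivialization.symmL_apply _ hy]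
  exact congrArg ((trivializationAt E (TangentSpace 𝓘(ℝ, E)) x).symm y)
    (congrFun (Bundle.Trivialization.coe_linearMapAt_of_mem (R := ℝ) _ hx) v)

/-- A smooth `(p, q)` double form on `M`: a section of `Λ^p T*M ⊗ Λ^q T*M` whose coefficients in
every preferred bundle chart of `M` are smooth. -/
structure IsSmoothDoubleForm (p q : ℕ) (η : ∀ x : M, DoubleForms (TangentSpace 𝓘(ℝ, E) x)) :
    Prop where
  bidegree : ∀ x, η x ∈ bidegree (TangentSpace 𝓘(ℝ, E) x) p q
  smooth : ∀ (x : M) (l : Module.Dual ℝ (DoubleForms (TangentSpace 𝓘(ℝ, E) x))),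
    ContMDiffOn 𝓘(ℝ, E) 𝓘(ℝ, ℝ) ∞ (fun y => l (pullback (transport x y) (η y)))
      (trivializationAt E (TangentSpace 𝓘(ℝ, E)) x).baseSet

variable [RiemannianBundle (fun x : M => TangentSpace 𝓘(ℝ, E) x)]
  [IsContMDiffRiemannianBundle 𝓘(ℝ, E) ∞ E (fun x : M => TangentSpace 𝓘(ℝ, E) x)]

instance (x : M) : FiniteDimensional ℝ (TangentSpace 𝓘(ℝ, E) x) :=
  inferInstanceAs (FiniteDimensional ℝ E)

/-- `nabla` is the Levi-Civita connection: a smooth affine connection (it maps vector fields that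
are smooth on an open set to tensor fields that are smooth there), metric and torsion free. -/
structure IsLeviCivita
    (nabla : CovariantDerivative 𝓘(ℝ, E) E (TangentSpace 𝓘(ℝ, E) : M → Type _)) : Prop where
  smooth : ∀ U : Set M, IsOpen U → ContMDiffCovariantDerivativeOn E ∞ nabla U
  metric : ∀ (Y Z : ∀ x : M, TangentSpace 𝓘(ℝ, E) x) (x : M) (u : TangentSpace 𝓘(ℝ, E) x),
    MDiffAt (T% Y) x → MDiffAt (T% Z) x →
      mvfderiv 𝓘(ℝ, E) (fun y => inner ℝ (Y y) (Z y)) x u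
        = inner ℝ (nabla Y x u) (Z x) + inner ℝ (Y x) (nabla Z x u)
  torsion : nabla.torsion = 0

variable (nabla : CovariantDerivative 𝓘(ℝ, E) E (TangentSpace 𝓘(ℝ, E) : M → Type _))

/-- The second covariant derivative `∇²_{u,v} Z = ∇_u ∇_v Z - ∇_{∇_u v} Z` of a vector field. -/
def secondCovVec (Z : ∀ x : M, TangentSpace 𝓘(ℝ, E) x) (x : M)
    (u v : TangentSpace 𝓘(ℝ, E) x) : TangentSpace 𝓘(ℝ, E) x :=
  nabla (fun y => nabla Z y (FiberBundle.extend E v y)) x u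
    - nabla Z x (nabla (FiberBundle.extend E v) x u)

/-- The Riemann curvature tensor as a `(2, 2)` double form,
`R(u, v; z, w) = g((∇²_{v,u} - ∇²_{u,v}) z, w)`, so that `R = g²/2` on the unit sphere. -/
def riemann (x : M) : DoubleForms (TangentSpace 𝓘(ℝ, E) x) :=
  doubleFormOfTensor fun u v z w =>
    inner ℝ (secondCovVec nabla (FiberBundle.extend E z) x v u
      - secondCovVec nabla (FiberBundle.extend E z) x u v) w

/-- The Ricci curvature `Ric = c R` as a `(1, 1)` double form. -/
def ricci (x : M) : DoubleForms (TangentSpace 𝓘(ℝ, E) x) :=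
  contraction (riemann nabla x)

/-- The covariant derivative `∇_v η` of a double form at `x`, by the Leibniz rule
`(∇_v η)(Y₁, …; Z₁, …) = v(η(Y₁, …; Z₁, …)) - η(∇_v Y₁, …; Z₁, …) - … - η(Y₁, …; ∇_v Z₁, …) - …`
for the vector fields `FiberBundle.extend E (e_i)` extending the orthonormal basis `(e_i)` of
`T_x M`. The first sum differentiates the coefficients; in the second, `∑ e^i ∧ i_{A e_i}` is the
operator that inserts `A = ∇_v` into one argument after the other. -/
def cov (η : ∀ x : M, DoubleForms (TangentSpace 𝓘(ℝ, E) x)) (x : M)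
    (v : TangentSpace 𝓘(ℝ, E) x) : DoubleForms (TangentSpace 𝓘(ℝ, E) x) :=
  ∑ a, mvfderiv 𝓘(ℝ, E)
      (fun y => (dfBasis (TangentSpace 𝓘(ℝ, E) x)).repr (pullback (transport x y) (η y)) a) x v
        • dfBasis (TangentSpace 𝓘(ℝ, E) x) a
    - ∑ i, (flatLeft (onb (TangentSpace 𝓘(ℝ, E) x) i) *
          insertLeft (nabla (FiberBundle.extend E (onb (TangentSpace 𝓘(ℝ, E) x) i)) x v) (η x)
        + flatRight (onb (TangentSpace 𝓘(ℝ, E) x) i) *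
          insertRight (nabla (FiberBundle.extend E (onb (TangentSpace 𝓘(ℝ, E) x) i)) x v) (η x))

/-- The second covariant derivative `∇²_{u,v} η = ∇_u ∇_v η - ∇_{∇_u v} η` of a double form. -/
def secondCov (η : ∀ x : M, DoubleForms (TangentSpace 𝓘(ℝ, E) x)) (x : M)
    (u v : TangentSpace 𝓘(ℝ, E) x) : DoubleForms (TangentSpace 𝓘(ℝ, E) x) :=
  cov nabla (fun y => cov nabla η y (FiberBundle.extend E v y)) x u
    - cov nabla η x (nabla (FiberBundle.extend E v) x u)

/-- The exterior derivative (second Bianchi sum) `D η = ∑ (e^i ⊗ 1) . ∇_{e_i} η`, that is, the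
alternation of `∇η` in its first `p + 1` arguments. -/
def extD (η : ∀ x : M, DoubleForms (TangentSpace 𝓘(ℝ, E) x)) (x : M) :
    DoubleForms (TangentSpace 𝓘(ℝ, E) x) :=
  ∑ i, flatLeft (onb (TangentSpace 𝓘(ℝ, E) x) i) *
    cov nabla η x (onb (TangentSpace 𝓘(ℝ, E) x) i)

/-- The divergence `δ η = -∑ i_{e_i ⊗ 1} ∇_{e_i} η`. -/
def div (η : ∀ x : M, DoubleForms (TangentSpace 𝓘(ℝ, E) x)) (x : M) :
    DoubleForms (TangentSpace 𝓘(ℝ, E) x) :=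
  -∑ i, insertLeft (onb (TangentSpace 𝓘(ℝ, E) x) i)
    (cov nabla η x (onb (TangentSpace 𝓘(ℝ, E) x) i))

/-- The Hodge-de Rham Laplacian `Δ = D δ + δ D` on double forms. -/
def hodgeLaplacian (η : ∀ x : M, DoubleForms (TangentSpace 𝓘(ℝ, E) x)) (x : M) :
    DoubleForms (TangentSpace 𝓘(ℝ, E) x) :=
  extD nabla (div nabla η) x + div nabla (extD nabla η) x

/-- The connection Laplacian `∇*∇ η = -∑ ∇²_{e_i, e_i} η`. -/
def connectionLaplacian (η : ∀ x : M, DoubleForms (TangentSpace 𝓘(ℝ, E) x)) (x : M) :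
    DoubleForms (TangentSpace 𝓘(ℝ, E) x) :=
  -∑ i, secondCov nabla η x (onb (TangentSpace 𝓘(ℝ, E) x) i) (onb (TangentSpace 𝓘(ℝ, E) x) i)

/-- The Weitzenböck curvature term `∑ i_{e_i ⊗ 1}((e^j ⊗ 1) . R_{e_i e_j} η)`, where
`R_{uv} η = ∇²_{v,u} η - ∇²_{u,v} η` and `(e_i)` is an orthonormal basis of `T_x M`. -/
def weit (η : ∀ x : M, DoubleForms (TangentSpace 𝓘(ℝ, E) x)) (x : M)
    (e : OrthonormalBasis (Fin (Module.finrank ℝ (TangentSpace 𝓘(ℝ, E) x))) ℝ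
      (TangentSpace 𝓘(ℝ, E) x)) : DoubleForms (TangentSpace 𝓘(ℝ, E) x) :=
  ∑ i, ∑ j, insertLeft (e i) (flatLeft (e j) *
    (secondCov nabla η x (e j) (e i) - secondCov nabla η x (e i) (e j)))

end Manifold

end DForm

end

/-! Because the connection is metric, the contractions of frame and coframe in `D` and `δ` are
parallel: `∇_v (Dω) = ∑ e^a ∇²_{v,e_a} ω` and `∇_v (δω) = -∑ i_{e_a} ∇²_{v,e_a} ω` (`cov_extD`,
`cov_div`). Inserting these into `Dδ + δD` and using `i_{e_i} e^j + e^j i_{e_i} = δ_ij` on the left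
factor separates the trace `∇*∇` from the part skew in the two derivatives, which is the curvature
term (`hodgeLaplacian_eq`).

By the Ricci identity (`secondCov_sub_secondCov`), `R_{uv} ω = -dfDer (K u v) ω`, where `K` is the
curvature endomorphism of tangent vectors and `dfDer A` is the derivation extending `α ↦ α ∘ A` on
both factors. The rest is linear algebra at a point (`weitzenboeck_curvature_identity`). In an
orthonormal frame, with `e^j`, `i_i` acting on the left factor unless a tensor sign is written,
`Weit ω = -∑ R_ijkl e^j i_i e^l i_k ω - ∑ R_ijkl (e^j i_i ⊗ e^l i_k) ω`. The second sum is `R # ω /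
4`, because the Clifford commutator with `e^i ∧ e^j` is `2 (e^j i_i - e^i i_j)`
(`cliffordBracket_flat_mul_flat`). In the first sum, moving `i_i` past `e^l` produces a Ricci term
and `∑ R_ijkl e^j e^l i_i i_k`, which the Bianchi identity turns into `-1/2 ∑ R_ijkl e^i e^j i_l
i_k` (`sum_curvature_smul_of_skew`). Both are composition products, since `ω ∘ (g^k/k!) = ω` in left
degree `k` and `ω ∘ ((u ⊗ v) Ψ) = u · ((i_v ω) ∘ Ψ)` (`comp_metricPow`, `comp_flat_tmul_flat_mul`).

The analysis takes place in the chart at `x`. There `∇` is the coordinate derivative minus `dfDer`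
of the connection matrix `conn` (`localCov_eq`). Vanishing torsion makes `conn` symmetric, and
compatibility with the metric makes the derivative of the metric at `x` the sum of `conn` and its
adjoint. Together with the symmetry of second derivatives this gives the Ricci identity and the
symmetries of `K`. -/

noncomputable section

namespace DForm

/-! ### Insertions on forms and double forms. -/

section Insertion

variable {V : Type*} [AddCommGroup V] [Module ℝ V]

theorem insertVec_ι_mul (v : V) (α : Module.Dual ℝ V) (θ : Forms V) :
    insertVec v (ExteriorAlgebra.ι ℝ α * θ) =
      α v • θ - ExteriorAlgebra.ι ℝ α * insertVec v θ :=
  CliffordAlgebra.contractLeft_ι_mul (Q := 0) _ _ _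

@[simp]
theorem insertVec_algebraMap (v : V) (r : ℝ) :
    insertVec v (algebraMap ℝ (Forms V) r) = 0 :=
  CliffordAlgebra.contractLeft_algebraMap (Q := 0) _ _

@[simp]
theorem insertVec_one (v : V) : insertVec v (1 : Forms V) = 0 :=
  CliffordAlgebra.contractLeft_one (Q := 0) _

theorem insertVec_comm (u v : V) (θ : Forms V) :
    insertVec u (insertVec v θ) = -insertVec v (insertVec u θ) :=
  CliffordAlgebra.contractLeft_comm (Q := 0) _ _ _

@[simp]
theorem insertVec_add (u v : V) : insertVec (u + v) = insertVec u + insertVec v := by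
  simp [insertVec]

@[simp]
theorem insertVec_smul (c : ℝ) (v : V) : insertVec (c • v) = c • insertVec v := by
  simp [insertVec]

variable (V) in
/-- The insertion `v ↦ i_v` as a linear map. -/
def insertVecₗ : V →ₗ[ℝ] Module.End ℝ (Forms V) where
  toFun := insertVec
  map_add' := insertVec_add
  map_smul' := insertVec_smul

@[simp]
theorem insertVecₗ_apply (v : V) : insertVecₗ V v = insertVec v := rfl

/-- Operators that agree on scalars and obey the same rule for left multiplication by a covector
coincide; identities between insertions, derivations and pull-backs are checked this way. -/
theorem forms_induction {P : Forms V → Prop} (algebraMap : ∀ r : ℝ, P (algebraMap ℝ (Forms V) r))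
    (add : ∀ x y, P x → P y → P (x + y))
    (ι_mul : ∀ (α : Module.Dual ℝ V) x, P x → P (ExteriorAlgebra.ι ℝ α * x)) (x : Forms V) : P x :=
  CliffordAlgebra.left_induction (0 : QuadraticForm ℝ (Module.Dual ℝ V)) algebraMap add
    (fun x α h => ι_mul α x h) x

theorem ι_mul_ι_mul_swap (α β : Module.Dual ℝ V) (θ : Forms V) :
    ExteriorAlgebra.ι ℝ α * (ExteriorAlgebra.ι ℝ β * θ) =
      -(ExteriorAlgebra.ι ℝ β * (ExteriorAlgebra.ι ℝ α * θ)) := by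
  rw [← mul_assoc, ← mul_assoc, eq_neg_iff_add_eq_zero, ← add_mul,
    ExteriorAlgebra.ι_add_mul_swap, zero_mul]

theorem map_dualMap_insertVec {W : Type*} [AddCommGroup W] [Module ℝ W] (L : V →ₗ[ℝ] W) (v : V)
    (θ : Forms W) :
    ExteriorAlgebra.map L.dualMap (insertVec (L v) θ) =
      insertVec v (ExteriorAlgebra.map L.dualMap θ) := by
  induction θ using forms_induction with
  | algebraMap r => simp
  | add x y hx hy => simp [hx, hy]
  | ι_mul α x hx =>
    simp only [insertVec_ι_mul, map_sub, map_smul, map_mul, ExteriorAlgebra.map_apply_ι, hx]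
    rfl

@[simp]
theorem insertLeft_tmul (v : V) (a b : Forms V) :
    insertLeft v (a ⊗ₜ[ℝ] b) = insertVec v a ⊗ₜ[ℝ] b := rfl

@[simp]
theorem insertRight_tmul (v : V) (a b : Forms V) :
    insertRight v (a ⊗ₜ[ℝ] b) = a ⊗ₜ[ℝ] insertVec v b := rfl

variable (V) in
/-- The insertion `v ↦ i_{v ⊗ 1}` as a linear map. -/
def insertLeftₗ : V →ₗ[ℝ] Module.End ℝ (DoubleForms V) :=
  LinearMap.rTensorHom (Forms V) ∘ₗ insertVecₗ V

@[simp]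
theorem insertLeftₗ_apply (v : V) : insertLeftₗ V v = insertLeft v := rfl

variable (V) in
/-- The insertion `v ↦ i_{1 ⊗ v}` as a linear map. -/
def insertRightₗ : V →ₗ[ℝ] Module.End ℝ (DoubleForms V) :=
  LinearMap.lTensorHom (Forms V) ∘ₗ insertVecₗ V

@[simp]
theorem insertRightₗ_apply (v : V) : insertRightₗ V v = insertRight v := rfl

end Insertion

/-! ### Derivations induced by endomorphisms of the tangent space. -/

section Derivation

variable {V : Type*} [NormedAddCommGroup V] [InnerProductSpace ℝ V]

theorem insertVec_flat_mul (u v : V) (θ : Forms V) :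
    insertVec u (flat v * θ) = inner ℝ v u • θ - flat v * insertVec u θ :=
  insertVec_ι_mul _ _ _

theorem flat_mul_flat_mul_swap (u v : V) (θ : Forms V) :
    flat u * (flat v * θ) = -(flat v * (flat u * θ)) := ι_mul_ι_mul_swap _ _ _

@[simp]
theorem flatLeft_mul_tmul (v : V) (a b : Forms V) :
    flatLeft v * (a ⊗ₜ[ℝ] b) = (flat v * a) ⊗ₜ[ℝ] b := by
  simp [flatLeft, Algebra.TensorProduct.tmul_mul_tmul]

@[simp]
theorem flatRight_mul_tmul (v : V) (a b : Forms V) :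
    flatRight v * (a ⊗ₜ[ℝ] b) = a ⊗ₜ[ℝ] (flat v * b) := by
  simp [flatRight, Algebra.TensorProduct.tmul_mul_tmul]

theorem insertLeft_flatLeft_mul (u v : V) (η : DoubleForms V) :
    insertLeft u (flatLeft v * η) = inner ℝ v u • η - flatLeft v * insertLeft u η := by
  induction η using TensorProduct.induction_on with
  | zero => simp
  | add x y hx hy => simp only [map_add, mul_add, hx, hy, smul_add]; abel
  | tmul a b =>
    simp [insertVec_flat_mul, TensorProduct.sub_tmul, TensorProduct.smul_tmul']

variable [FiniteDimensional ℝ V]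

theorem sum_dual_onb_smul_flat (α : Module.Dual ℝ V) :
    ∑ i, α (onb V i) • flat (onb V i) = ExteriorAlgebra.ι ℝ α := by
  simp only [flat, ← map_smul, ← map_sum]
  congr 1
  refine (onb V).toBasis.ext fun j => ?_
  simp [(onb V).inner_eq_ite]

/-- The derivation `∑ e^i ∧ i_{A e_i}` of the exterior algebra that extends `α ↦ α ∘ A`. -/
def extDer : Module.End ℝ V →ₗ[ℝ] Module.End ℝ (Forms V) where
  toFun A := ∑ i, LinearMap.mulLeft ℝ (flat (onb V i)) ∘ₗ insertVec (A (onb V i))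
  map_add' A B := by
    simp [LinearMap.comp_add, Finset.sum_add_distrib]
  map_smul' c A := by
    simp [LinearMap.comp_smul, Finset.smul_sum]

theorem extDer_apply (A : Module.End ℝ V) (θ : Forms V) :
    extDer A θ = ∑ i, flat (onb V i) * insertVec (A (onb V i)) θ := by
  simp [extDer, LinearMap.sum_apply]

@[simp]
theorem extDer_algebraMap (A : Module.End ℝ V) (r : ℝ) :
    extDer A (algebraMap ℝ (Forms V) r) = 0 := by
  simp [extDer_apply]

/-- The sign from moving the insertion past `α` cancels the sign from swapping two covectors; the
remaining sum is the expansion of `α ∘ A` in the coframe. -/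
theorem extDer_ι_mul (A : Module.End ℝ V) (α : Module.Dual ℝ V) (θ : Forms V) :
    extDer A (ExteriorAlgebra.ι ℝ α * θ) =
      ExteriorAlgebra.ι ℝ (α ∘ₗ A) * θ + ExteriorAlgebra.ι ℝ α * extDer A θ := by
  simp only [extDer_apply, insertVec_ι_mul, mul_sub, Finset.sum_sub_distrib, Finset.mul_sum]
  rw [← sum_dual_onb_smul_flat (α ∘ₗ A), Finset.sum_mul, sub_eq_add_neg,
    ← Finset.sum_neg_distrib]
  congr 1
  · simp
  · refine Finset.sum_congr rfl fun i _ => ?_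
    rw [flat, ι_mul_ι_mul_swap, neg_neg]

theorem insertVec_extDer (A : Module.End ℝ V) (v : V) (θ : Forms V) :
    insertVec v (extDer A θ) = extDer A (insertVec v θ) + insertVec (A v) θ := by
  induction θ using forms_induction with
  | algebraMap r => simp
  | add x y hx hy => simp only [map_add, hx, hy]; abel
  | ι_mul α x hx =>
    simp only [extDer_ι_mul, insertVec_ι_mul, map_sub, map_add, map_smul, hx, mul_add,
      LinearMap.comp_apply]
    abel

/-- The order is reversed on the right because endomorphisms act on covectors by precomposition.
This is the source of the minus sign in the Ricci identity for forms. -/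
theorem extDer_commutator (A B : Module.End ℝ V) (θ : Forms V) :
    extDer A (extDer B θ) - extDer B (extDer A θ) = extDer (B * A - A * B) θ := by
  induction θ using forms_induction with
  | algebraMap r => simp
  | add x y hx hy => simp only [map_add, ← hx, ← hy]; abel
  | ι_mul α x hx =>
    have h : α ∘ₗ (B * A - A * B) = (α ∘ₗ B) ∘ₗ A - (α ∘ₗ A) ∘ₗ B := by
      ext; simp
    rw [extDer_ι_mul (B * A - A * B), h, ← hx]
    simp only [extDer_ι_mul, map_add, map_sub, sub_mul, mul_sub]
    abel

theorem map_dualMap_extDer {W : Type*} [NormedAddCommGroup W] [InnerProductSpace ℝ W]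
    [FiniteDimensional ℝ W] (L : V →ₗ[ℝ] W) (A : Module.End ℝ V) (B : Module.End ℝ W)
    (h : B ∘ₗ L = L ∘ₗ A) (θ : Forms W) :
    ExteriorAlgebra.map L.dualMap (extDer B θ) = extDer A (ExteriorAlgebra.map L.dualMap θ) := by
  induction θ using forms_induction with
  | algebraMap r => simp
  | add x y hx hy => simp [hx, hy]
  | ι_mul α x hx =>
    have h' : L.dualMap (α ∘ₗ B) = L.dualMap α ∘ₗ A := by
      ext v
      simpa using congrArg α (LinearMap.congr_fun h v)
    simp only [extDer_ι_mul, map_add, map_mul, ExteriorAlgebra.map_apply_ι, hx, h']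

/-- The derivation of the algebra of double forms that extends `α ↦ α ∘ A` on both factors. -/
def dfDer : Module.End ℝ V →ₗ[ℝ] Module.End ℝ (DoubleForms V) :=
  (TensorProduct.mapBilinear (RingHom.id ℝ) (Forms V) (Forms V) (Forms V) (Forms V)).flip
      LinearMap.id ∘ₗ extDer +
    TensorProduct.mapBilinear (RingHom.id ℝ) (Forms V) (Forms V) (Forms V) (Forms V)
      LinearMap.id ∘ₗ extDer

@[simp]
theorem dfDer_tmul (A : Module.End ℝ V) (a b : Forms V) :
    dfDer A (a ⊗ₜ[ℝ] b) = extDer A a ⊗ₜ[ℝ] b + a ⊗ₜ[ℝ] extDer A b := by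
  simp [dfDer]

theorem dfDer_eq_sum (A : Module.End ℝ V) (η : DoubleForms V) :
    dfDer A η = ∑ i, (flatLeft (onb V i) * insertLeft (A (onb V i)) η
      + flatRight (onb V i) * insertRight (A (onb V i)) η) := by
  induction η using TensorProduct.induction_on with
  | zero => simp
  | add x y hx hy => simp only [map_add, hx, hy, mul_add, ← Finset.sum_add_distrib]
                     exact Finset.sum_congr rfl fun i _ => by abel
  | tmul a b =>
    simp [extDer_apply, Finset.sum_add_distrib, TensorProduct.sum_tmul, TensorProduct.tmul_sum]

theorem dfDer_commutator (A B : Module.End ℝ V) (η : DoubleForms V) :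
    dfDer A (dfDer B η) - dfDer B (dfDer A η) = dfDer (B * A - A * B) η := by
  induction η using TensorProduct.induction_on with
  | zero => simp
  | add x y hx hy => simp only [map_add, ← hx, ← hy]; abel
  | tmul a b =>
    simp only [dfDer_tmul, map_add, ← extDer_commutator, TensorProduct.sub_tmul,
      TensorProduct.tmul_sub]
    abel

theorem insertLeft_dfDer (A : Module.End ℝ V) (v : V) (η : DoubleForms V) :
    insertLeft v (dfDer A η) = dfDer A (insertLeft v η) + insertLeft (A v) η := by
  induction η using TensorProduct.induction_on with
  | zero => simp
  | add x y hx hy => simp only [map_add, hx, hy]; abel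
  | tmul a b =>
    simp only [dfDer_tmul, map_add, insertLeft_tmul, insertVec_extDer, TensorProduct.add_tmul]
    abel

theorem dfDer_ι_tmul_one_mul (A : Module.End ℝ V) (α : Module.Dual ℝ V) (η : DoubleForms V) :
    dfDer A ((ExteriorAlgebra.ι ℝ α ⊗ₜ[ℝ] 1) * η) =
      (ExteriorAlgebra.ι ℝ (α ∘ₗ A) ⊗ₜ[ℝ] 1) * η +
        (ExteriorAlgebra.ι ℝ α ⊗ₜ[ℝ] 1) * dfDer A η := by
  induction η using TensorProduct.induction_on with
  | zero => simp
  | add x y hx hy => simp only [map_add, mul_add, hx, hy]; abel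
  | tmul a b =>
    simp only [Algebra.TensorProduct.tmul_mul_tmul, one_mul, dfDer_tmul, extDer_ι_mul,
      TensorProduct.add_tmul, mul_add]
    abel

end Derivation

/-! ### Functoriality of the pull-back of double forms. -/

section Pullback

variable {V W : Type*}

theorem pullback_tmul [AddCommGroup V] [Module ℝ V] [AddCommGroup W] [Module ℝ W]
    (L : V →ₗ[ℝ] W) (a b : Forms W) :
    pullback L (a ⊗ₜ[ℝ] b) =
      ExteriorAlgebra.map L.dualMap a ⊗ₜ[ℝ] ExteriorAlgebra.map L.dualMap b := rfl

theorem pullback_mul [AddCommGroup V] [Module ℝ V] [AddCommGroup W] [Module ℝ W]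
    (L : V →ₗ[ℝ] W) (a b : DoubleForms W) : pullback L (a * b) = pullback L a * pullback L b :=
  map_mul (Algebra.TensorProduct.map (ExteriorAlgebra.map L.dualMap)
    (ExteriorAlgebra.map L.dualMap)) a b

theorem pullback_id [AddCommGroup V] [Module ℝ V] (η : DoubleForms V) :
    pullback (LinearMap.id : V →ₗ[ℝ] V) η = η := by
  simp [pullback, LinearMap.dualMap_id]

theorem pullback_pullback {U : Type*} [AddCommGroup U] [Module ℝ U] [AddCommGroup V] [Module ℝ V]
    [AddCommGroup W] [Module ℝ W] (L : V →ₗ[ℝ] W) (L' : U →ₗ[ℝ] V) (η : DoubleForms W) :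
    pullback L' (pullback L η) = pullback (L ∘ₗ L') η := by
  have h : (ExteriorAlgebra.map (L ∘ₗ L').dualMap) =
      (ExteriorAlgebra.map L'.dualMap).comp (ExteriorAlgebra.map L.dualMap) := by
    rw [ExteriorAlgebra.map_comp_map, LinearMap.dualMap_comp_dualMap]
  simp only [pullback, h]
  rw [AlgHom.comp_toLinearMap, TensorProduct.map_comp, LinearMap.comp_apply]

variable [NormedAddCommGroup V] [InnerProductSpace ℝ V] [NormedAddCommGroup W]
  [InnerProductSpace ℝ W]

theorem pullback_insertLeft (L : V →ₗ[ℝ] W) (v : V) (η : DoubleForms W) :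
    pullback L (insertLeft (L v) η) = insertLeft v (pullback L η) := by
  induction η using TensorProduct.induction_on with
  | zero => simp
  | add x y hx hy => simp only [map_add, hx, hy]
  | tmul a b => simp [pullback_tmul, map_dualMap_insertVec]

/-- Lets a change of frame pass through the action of a connection matrix. -/
theorem pullback_dfDer [FiniteDimensional ℝ V] [FiniteDimensional ℝ W] (L : V →ₗ[ℝ] W)
    (A : Module.End ℝ V) (B : Module.End ℝ W) (h : B ∘ₗ L = L ∘ₗ A) (η : DoubleForms W) :
    pullback L (dfDer B η) = dfDer A (pullback L η) := by
  induction η using TensorProduct.induction_on with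
  | zero => simp
  | add x y hx hy => simp only [map_add, hx, hy]
  | tmul a b => simp [pullback_tmul, map_dualMap_extDer L A B h]

end Pullback

/-! ### Degrees and insertions. -/

section Degree

variable {V : Type*} [AddCommGroup V] [Module ℝ V]

theorem insertVec_mem_exteriorPower (v : V) (k : ℕ) {θ : Forms V}
    (h : θ ∈ ⋀[ℝ]^(k + 1) (Module.Dual ℝ V)) : insertVec v θ ∈ ⋀[ℝ]^k (Module.Dual ℝ V) := by
  induction k generalizing θ with
  | zero =>
    rw [ExteriorAlgebra.exteriorPower, zero_add, pow_one] at h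
    obtain ⟨α, rfl⟩ := h
    have : insertVec v (ExteriorAlgebra.ι ℝ α) = algebraMap ℝ (Forms V) (α v) :=
      CliffordAlgebra.contractLeft_ι (Q := 0) _ _
    rw [this, ExteriorAlgebra.exteriorPower, pow_zero]
    exact Submodule.algebraMap_mem _
  | succ k ih =>
    rw [ExteriorAlgebra.exteriorPower, pow_succ'] at h
    induction h using Submodule.mul_induction_on' with
    | add x _ y _ hx hy => simpa using add_mem hx hy
    | mem_mul_mem x hx y hy =>
      obtain ⟨α, rfl⟩ := hx
      rw [insertVec_ι_mul]
      refine sub_mem (Submodule.smul_mem _ _ hy) ?_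
      rw [ExteriorAlgebra.exteriorPower, pow_succ']
      exact Submodule.mul_mem_mul ⟨α, rfl⟩ (ih hy)

theorem insertVec_of_mem_exteriorPower_zero (v : V) {θ : Forms V}
    (h : θ ∈ ⋀[ℝ]^0 (Module.Dual ℝ V)) : insertVec v θ = 0 := by
  rw [ExteriorAlgebra.exteriorPower, pow_zero] at h
  obtain ⟨r, rfl⟩ := Submodule.mem_one.1 h
  simp

theorem bidegree_induction {p q : ℕ} {P : DoubleForms V → Prop} (zero : P 0)
    (add : ∀ x y, P x → P y → P (x + y))
    (tmul : ∀ a ∈ ⋀[ℝ]^p (Module.Dual ℝ V), ∀ b ∈ ⋀[ℝ]^q (Module.Dual ℝ V), P (a ⊗ₜ[ℝ] b))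
    {η : DoubleForms V} (h : η ∈ bidegree V p q) : P η := by
  obtain ⟨t, rfl⟩ := h
  induction t using TensorProduct.induction_on with
  | zero => simpa using zero
  | add x y hx hy => simpa using add _ _ hx hy
  | tmul a b => exact tmul _ a.2 _ b.2

theorem tmul_mem_bidegree {p q : ℕ} {a b : Forms V} (ha : a ∈ ⋀[ℝ]^p (Module.Dual ℝ V))
    (hb : b ∈ ⋀[ℝ]^q (Module.Dual ℝ V)) : a ⊗ₜ[ℝ] b ∈ bidegree V p q :=
  ⟨(⟨a, ha⟩ : ⋀[ℝ]^p (Module.Dual ℝ V)) ⊗ₜ[ℝ] (⟨b, hb⟩ : ⋀[ℝ]^q (Module.Dual ℝ V)), rfl⟩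

theorem insertLeft_mem_bidegree (v : V) {p q : ℕ} {η : DoubleForms V}
    (h : η ∈ bidegree V (p + 1) q) : insertLeft v η ∈ bidegree V p q := by
  refine bidegree_induction (P := fun η => insertLeft v η ∈ bidegree V p q) ?_ ?_ ?_ h
  · simp
  · intro x y hx hy
    simpa using add_mem hx hy
  · intro a ha b hb
    exact tmul_mem_bidegree (insertVec_mem_exteriorPower v p ha) hb

theorem insertLeft_of_mem_bidegree_zero (v : V) {q : ℕ} {η : DoubleForms V}
    (h : η ∈ bidegree V 0 q) : insertLeft v η = 0 := by
  refine bidegree_induction (P := fun η => insertLeft v η = 0) ?_ ?_ ?_ h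
  · simp
  · intro x y hx hy
    simp [hx, hy]
  · intro a ha b hb
    simp [insertVec_of_mem_exteriorPower_zero v ha]

end Degree

/-! ### Adjointness of exterior multiplication and insertion. -/

section FormInner

variable {V : Type*} [NormedAddCommGroup V] [InnerProductSpace ℝ V] [FiniteDimensional ℝ V]

@[simp]
theorem sharp_innerₗ (v : V) : sharp (innerₗ V v) = v := by
  simp only [sharp, LinearMap.sum_apply, LinearMap.smulRight_apply, LinearMap.applyₗ_apply_apply,
    innerₗ_apply_apply]
  simpa only [real_inner_comm] using (onb V).sum_repr' v

@[simp]
theorem innerₗ_sharp (α : Module.Dual ℝ V) : innerₗ V (sharp α) = α := by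
  refine (onb V).toBasis.ext fun j => ?_
  simp [sharp, (onb V).inner_eq_ite]

theorem flat_sharp (α : Module.Dual ℝ V) : flat (sharp α) = ExteriorAlgebra.ι ℝ α := by
  rw [flat, innerₗ_sharp]

theorem flat_induction {P : Forms V → Prop} (algebraMap : ∀ r : ℝ, P (algebraMap ℝ (Forms V) r))
    (add : ∀ x y, P x → P y → P (x + y))
    (flat_mul : ∀ (v : V) x, P x → P (flat v * x)) (x : Forms V) : P x :=
  forms_induction algebraMap add (fun α x h => by simpa [flat_sharp] using flat_mul (sharp α) x h) x

/-- `reverse` moves the leading covector to the end of the product, so its insertion is the first to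
act. -/
theorem interiorMul_flat_mul (v : V) (θ b : Forms V) :
    interiorMul (flat v * θ) b = interiorMul θ (insertVec v b) := by
  have h : CliffordAlgebra.reverse (flat v * θ) = CliffordAlgebra.reverse θ * flat v := by
    rw [CliffordAlgebra.reverse.map_mul]
    exact congrArg _ (CliffordAlgebra.reverse_ι (Q := 0) _)
  simp only [interiorMul, LinearMap.comp_apply, AlgHom.toLinearMap_apply]
  erw [h]
  rw [map_mul, Module.End.mul_apply, flat]
  erw [ExteriorAlgebra.lift_ι_apply]
  simp only [LinearMap.comp_apply, sharp_innerₗ]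
  rfl

theorem formInner_flat_mul (v : V) (θ b : Forms V) :
    formInner (flat v * θ) b = formInner θ (insertVec v b) := by
  simp [formInner, interiorMul_flat_mul]

theorem formInner_algebraMap (r : ℝ) (b : Forms V) :
    formInner (algebraMap ℝ (Forms V) r) b = r * ExteriorAlgebra.algebraMapInv b := by
  have h : CliffordAlgebra.reverse (algebraMap ℝ (Forms V) r) = algebraMap ℝ (Forms V) r :=
    CliffordAlgebra.reverse.commutes (Q := 0) r
  simp only [formInner, interiorMul, LinearMap.compr₂_apply, LinearMap.comp_apply,
    AlgHom.toLinearMap_apply]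
  erw [h]
  simp [Algebra.algebraMap_eq_smul_one]

/-- The definition gives adjointness in the first slot only. The second slot follows by induction on
`θ`, because the Leibniz rules for `i_v (u ∧ x)` and `i_u (v ∧ b)` produce the same scalar `⟨u, v⟩`.
-/
theorem formInner_mul_flat (v : V) (θ b : Forms V) :
    formInner θ (flat v * b) = formInner (insertVec v θ) b := by
  induction θ using flat_induction generalizing b with
  | algebraMap r =>
    -- Both sides vanish: `v ∧ b` has no part of degree zero, and insertion kills scalars.
    simp [formInner_algebraMap, flat, ExteriorAlgebra.algebraMapInv]
  | add x y hx hy => simp [hx, hy]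
  | flat_mul u x hx =>
    rw [formInner_flat_mul, insertVec_flat_mul, insertVec_flat_mul]
    simp [hx, formInner_flat_mul, real_inner_comm]

end FormInner

/-! ### The composition product with powers of the metric. -/

section Composition

variable {V : Type*} [NormedAddCommGroup V] [InnerProductSpace ℝ V] [FiniteDimensional ℝ V]

theorem comp_tmul (a b c d : Forms V) :
    comp (a ⊗ₜ[ℝ] b) (c ⊗ₜ[ℝ] d) = formInner a d • (c ⊗ₜ[ℝ] b) := by
  simp [comp, TensorProduct.smul_tmul']

/-- The composition pairs the left factor of `η` with the right factor of its second argument, so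
adjointness turns `v` into an insertion on `η`, while `u` stays outside the pairing. -/
theorem comp_flat_tmul_flat_mul (u v : V) (η Ψ : DoubleForms V) :
    comp η ((flat u ⊗ₜ[ℝ] flat v) * Ψ) = flatLeft u * comp (insertLeft v η) Ψ := by
  induction η using TensorProduct.induction_on with
  | zero => simp
  | add x y hx hy => simp only [map_add, LinearMap.add_apply, mul_add, hx, hy]
  | tmul a b =>
    induction Ψ using TensorProduct.induction_on with
    | zero => simp
    | add x y hx hy => simp only [map_add, mul_add, hx, hy]
    | tmul c d =>
      simp [comp_tmul, Algebra.TensorProduct.tmul_mul_tmul, formInner_mul_flat]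

/-- Euler's identity: the derivation that fixes every covector counts the degree. -/
theorem extDer_one_of_mem_exteriorPower (k : ℕ) {θ : Forms V}
    (h : θ ∈ ⋀[ℝ]^k (Module.Dual ℝ V)) : extDer 1 θ = (k : ℝ) • θ := by
  induction k generalizing θ with
  | zero =>
    rw [ExteriorAlgebra.exteriorPower, pow_zero] at h
    obtain ⟨r, rfl⟩ := Submodule.mem_one.1 h
    simp
  | succ k ih =>
    rw [ExteriorAlgebra.exteriorPower, pow_succ'] at h
    induction h using Submodule.mul_induction_on' with
    | add x _ y _ hx hy => simp [hx, hy]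
    | mem_mul_mem x hx y hy =>
      obtain ⟨α, rfl⟩ := hx
      rw [extDer_ι_mul, ih hy]
      simp only [Nat.cast_add, Nat.cast_one, add_smul, one_smul, mul_smul_comm]
      rw [add_comm]
      rfl

theorem sum_flatLeft_mul_insertLeft {p q : ℕ} {η : DoubleForms V} (h : η ∈ bidegree V p q) :
    ∑ i, flatLeft (onb V i) * insertLeft (onb V i) η = (p : ℝ) • η := by
  refine bidegree_induction
    (P := fun η => ∑ i, flatLeft (onb V i) * insertLeft (onb V i) η = (p : ℝ) • η) ?_ ?_ ?_ h
  · simp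
  · intro x y hx hy
    simp [mul_add, Finset.sum_add_distrib, hx, hy]
  · intro a ha b hb
    have := extDer_one_of_mem_exteriorPower p ha
    rw [extDer_apply] at this
    simp only [Module.End.one_apply] at this
    simp [← TensorProduct.sum_tmul, this, TensorProduct.smul_tmul']

theorem comp_one_of_mem_bidegree_zero {q : ℕ} {η : DoubleForms V} (h : η ∈ bidegree V 0 q) :
    comp η 1 = η := by
  refine bidegree_induction (P := fun η => comp η 1 = η) ?_ ?_ ?_ h
  · simp
  · intro x y hx hy
    simp [hx, hy]
  · intro a ha b hb
    rw [ExteriorAlgebra.exteriorPower, pow_zero] at ha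
    obtain ⟨r, rfl⟩ := Submodule.mem_one.1 ha
    rw [Algebra.TensorProduct.one_def, comp_tmul, formInner_algebraMap]
    simp [TensorProduct.smul_tmul', Algebra.algebraMap_eq_smul_one]

/-- Each factor `g = ∑ e^i ⊗ e^i` peeled off contributes `∑ e^i i_{e_i}`, which multiplies by the
current left degree; the degrees multiply up to the factorial. -/
theorem comp_metricForm_pow {k q : ℕ} {η : DoubleForms V} (h : η ∈ bidegree V k q) :
    comp η (metricForm V ^ k) = ((k ! : ℕ) : ℝ) • η := by
  induction k generalizing η with
  | zero => simpa using comp_one_of_mem_bidegree_zero h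
  | succ k ih =>
    rw [pow_succ', metricForm, Finset.sum_mul, map_sum]
    simp only [comp_flat_tmul_flat_mul]
    change ∑ i, flatLeft (onb V i) * comp (insertLeft (onb V i) η) (metricForm V ^ k) = _
    simp only [ih (insertLeft_mem_bidegree _ h), mul_smul_comm, ← Finset.smul_sum]
    rw [sum_flatLeft_mul_insertLeft h, smul_smul, Nat.factorial_succ]
    congr 1
    push_cast
    ring

theorem comp_metricPow {k q : ℕ} {η : DoubleForms V} (h : η ∈ bidegree V k q) :
    comp η (metricPow V k) = η := by
  have hk : ¬ (k : ℤ) < 0 := by omega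
  rw [metricPow, if_neg hk, Int.toNat_natCast, map_smul, comp_metricForm_pow h, smul_smul,
    inv_mul_cancel₀ (by positivity), one_smul]

theorem flat_tmul_flat_commute_metricForm (u v : V) :
    Commute (metricForm V) (flat u ⊗ₜ[ℝ] flat v) := by
  rw [metricForm]
  refine Commute.sum_left _ _ _ fun i _ => ?_
  have hu := flat_mul_flat_mul_swap (onb V i) u 1
  have hv := flat_mul_flat_mul_swap (onb V i) v 1
  simp only [mul_one] at hu hv
  simp [Commute, SemiconjBy, Algebra.TensorProduct.tmul_mul_tmul, hu, hv, TensorProduct.neg_tmul,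
    TensorProduct.tmul_neg]

theorem metricPow_mul_flat_tmul_flat (k : ℤ) (u v : V) :
    metricPow V k * (flat u ⊗ₜ[ℝ] flat v) = (flat u ⊗ₜ[ℝ] flat v) * metricPow V k := by
  rw [metricPow]
  split_ifs
  · simp
  · exact (((flat_tmul_flat_commute_metricForm u v).pow_left _).smul_left _).eq

theorem comp_metricPow_mul_flat_tmul_flat {p q : ℕ} {η : DoubleForms V} (h : η ∈ bidegree V p q)
    (u v : V) :
    comp η (metricPow V ((p : ℤ) - 1) * (flat u ⊗ₜ[ℝ] flat v)) =
      flatLeft u * insertLeft v η := by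
  rw [metricPow_mul_flat_tmul_flat, comp_flat_tmul_flat_mul]
  cases p with
  -- In left degree zero the insertion already vanishes, so the convention for negative powers of
  -- `g` is not needed here.
  | zero => simp [insertLeft_of_mem_bidegree_zero v h]
  | succ p =>
    have : ((p + 1 : ℕ) : ℤ) - 1 = (p : ℕ) := by push_cast; ring
    rw [this, comp_metricPow (insertLeft_mem_bidegree v h)]

theorem comp_metricPow_mul_flat_mul_flat_tmul {p q : ℕ} {η : DoubleForms V}
    (h : η ∈ bidegree V p q) (u v z w : V) :
    comp η (metricPow V ((p : ℤ) - 2) * ((flat u * flat v) ⊗ₜ[ℝ] (flat z * flat w))) =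
      flatLeft u * (flatLeft v * insertLeft w (insertLeft z η)) := by
  rw [← Algebra.TensorProduct.tmul_mul_tmul, ← mul_assoc, metricPow_mul_flat_tmul_flat, mul_assoc,
    metricPow_mul_flat_tmul_flat, comp_flat_tmul_flat_mul, comp_flat_tmul_flat_mul]
  match p, h with
  | 0, h => simp [insertLeft_of_mem_bidegree_zero z h]
  | 1, h => simp [insertLeft_of_mem_bidegree_zero w (insertLeft_mem_bidegree z h)]
  | p + 2, h =>
    have : ((p + 2 : ℕ) : ℤ) - 2 = (p : ℕ) := by push_cast; ring
    rw [this, comp_metricPow (insertLeft_mem_bidegree w (insertLeft_mem_bidegree z h))]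

end Composition

/-! ### The Clifford product and commutators with bivectors. -/

section Clifford

variable {V : Type*} [NormedAddCommGroup V] [InnerProductSpace ℝ V] [FiniteDimensional ℝ V]

theorem cliffordForm_apply (v : V) : cliffordForm V (innerₗ V v) = -inner ℝ v v := by
  simp [cliffordForm, dualInner]

/-- Changing the quadratic form from `Q` to `0` corrects the product by contraction with the
bilinear form of `-Q`, which is the inner product because `Q` is minus the squared norm. -/
theorem equivExterior_ι_mul (v : V) (x : CliffordAlgebra (cliffordForm V)) :
    CliffordAlgebra.equivExterior (cliffordForm V)
        (CliffordAlgebra.ι (cliffordForm V) (innerₗ V v) * x) =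
      flat v * CliffordAlgebra.equivExterior (cliffordForm V) x -
        insertVec v (CliffordAlgebra.equivExterior (cliffordForm V) x) := by
  have h := CliffordAlgebra.changeForm_ι_mul
    (CliffordAlgebra.changeForm.associated_neg_proof (Q := cliffordForm V)) (innerₗ V v) x
  have hB : QuadraticMap.associated (-cliffordForm V) (innerₗ V v) = Module.Dual.eval ℝ V v := by
    have : -cliffordForm V = (dualInner (V := V)).toQuadraticMap := by
      ext α
      simp [cliffordForm]
    rw [this, QuadraticMap.associated_left_inverse]
    · ext α
      obtain ⟨w, rfl⟩ : ∃ w, innerₗ V w = α := ⟨_, innerₗ_sharp α⟩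
      simp [dualInner, real_inner_comm]
    · exact fun α β => real_inner_comm _ _
  rw [hB] at h
  exact h

theorem equivExterior_algebraMap (r : ℝ) :
    CliffordAlgebra.equivExterior (cliffordForm V) (algebraMap ℝ _ r) =
      algebraMap ℝ (Forms V) r :=
  CliffordAlgebra.changeForm_algebraMap
    (CliffordAlgebra.changeForm.associated_neg_proof (Q := cliffordForm V)) r

theorem ι_mul_ι_add_swap (v w : V) :
    CliffordAlgebra.ι (cliffordForm V) (innerₗ V v) * CliffordAlgebra.ι (cliffordForm V)
      (innerₗ V w) = -(CliffordAlgebra.ι (cliffordForm V) (innerₗ V w) *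
        CliffordAlgebra.ι (cliffordForm V) (innerₗ V v)) + algebraMap ℝ _ (-2 * inner ℝ v w) := by
  have h := CliffordAlgebra.ι_mul_ι_add_swap (Q := cliffordForm V) (innerₗ V v) (innerₗ V w)
  have hp : QuadraticMap.polar (cliffordForm V) (innerₗ V v) (innerₗ V w) = -2 * inner ℝ v w := by
    rw [QuadraticMap.polar, ← map_add, cliffordForm_apply, cliffordForm_apply, cliffordForm_apply]
    simp only [inner_add_left, inner_add_right, real_inner_comm v w]
    ring
  rw [← hp, ← h]
  abel

/-- The commutator with `c_u c_v` is a derivation of the Clifford algebra that preserves the span of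
the covectors, on which it is twice an infinitesimal rotation. The right side obeys the same Leibniz
rule. -/
theorem equivExterior_commutator (u v : V) (x : CliffordAlgebra (cliffordForm V)) :
    CliffordAlgebra.equivExterior (cliffordForm V)
        (CliffordAlgebra.ι (cliffordForm V) (innerₗ V u) *
            CliffordAlgebra.ι (cliffordForm V) (innerₗ V v) * x -
          x * (CliffordAlgebra.ι (cliffordForm V) (innerₗ V u) *
            CliffordAlgebra.ι (cliffordForm V) (innerₗ V v))) =
      (2 : ℝ) • (flat v * insertVec u (CliffordAlgebra.equivExterior (cliffordForm V) x) -
        flat u * insertVec v (CliffordAlgebra.equivExterior (cliffordForm V) x)) := by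
  induction x using CliffordAlgebra.left_induction with
  | algebraMap r =>
    rw [← Algebra.commutes r, sub_self, equivExterior_algebraMap]
    simp
  | add x y hx hy =>
    rw [mul_add, add_mul, add_sub_add_comm, map_add, hx, hy]
    simp only [map_add, mul_add, smul_sub, smul_add]
    abel
  | ι_mul x m hx =>
    obtain ⟨w, rfl⟩ : ∃ w, innerₗ V w = m := ⟨_, innerₗ_sharp m⟩
    set c := fun z : V => CliffordAlgebra.ι (cliffordForm V) (innerₗ V z) with hc
    have key : c u * c v * (c w * x) - c w * x * (c u * c v) =
        (2 * inner ℝ u w : ℝ) • (c v * x) - (2 * inner ℝ v w : ℝ) • (c u * x) +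
          c w * (c u * c v * x - x * (c u * c v)) := by
      have h1 : c v * c w = -(c w * c v) + algebraMap ℝ _ (-2 * inner ℝ v w) :=
        ι_mul_ι_add_swap v w
      have h2 : c u * c w = -(c w * c u) + algebraMap ℝ _ (-2 * inner ℝ u w) :=
        ι_mul_ι_add_swap u w
      have h3 : c u * c v * c w = c w * (c u * c v) + (2 * inner ℝ u w : ℝ) • c v -
          (2 * inner ℝ v w : ℝ) • c u := by
        rw [mul_assoc, h1, mul_add, mul_neg, ← mul_assoc, h2, ← Algebra.commutes,
          ← Algebra.smul_def, add_mul, ← Algebra.smul_def, neg_mul, mul_assoc]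
        module
      calc c u * c v * (c w * x) - c w * x * (c u * c v)
          = (c u * c v * c w) * x - c w * (x * (c u * c v)) := by simp only [mul_assoc]
        _ = _ := by
          rw [h3]
          simp only [add_mul, sub_mul, smul_mul_assoc, mul_sub, mul_assoc]
          abel
    have hE : ∀ z y, CliffordAlgebra.equivExterior (cliffordForm V) (c z * y) =
        flat z * CliffordAlgebra.equivExterior (cliffordForm V) y -
        insertVec z (CliffordAlgebra.equivExterior (cliffordForm V) y) := equivExterior_ι_mul
    change CliffordAlgebra.equivExterior (cliffordForm V)
      (c u * c v * (c w * x) - c w * x * (c u * c v)) = _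
    rw [key, map_add, map_sub, map_smul, map_smul, hE, hE, hE, hx]
    change _ = (2 : ℝ) • (flat v * insertVec u
      (CliffordAlgebra.equivExterior (cliffordForm V) (c w * x)) - flat u * insertVec v
        (CliffordAlgebra.equivExterior (cliffordForm V) (c w * x)))
    rw [hE]
    generalize CliffordAlgebra.equivExterior (cliffordForm V) x = y
    simp only [map_sub, map_smul, insertVec_flat_mul, mul_sub, mul_smul_comm,
      flat_mul_flat_mul_swap w, insertVec_comm w, mul_neg]
    rw [real_inner_comm u w, real_inner_comm v w]
    module

/-- The wedge `u ∧ v` differs from the Clifford product by the scalar `⟨u, v⟩`, which is central and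
drops out of the commutator. -/
theorem cliffordBracket_flat_mul_flat (u v : V) (θ : Forms V) :
    cliffordBracket (flat u * flat v) θ =
      (2 : ℝ) • (flat v * insertVec u θ - flat u * insertVec v θ) := by
  set E := CliffordAlgebra.equivExterior (cliffordForm V)
  have h1 : flat u * flat v = E (CliffordAlgebra.ι (cliffordForm V) (innerₗ V u) *
      CliffordAlgebra.ι (cliffordForm V) (innerₗ V v) + algebraMap ℝ _ (inner ℝ u v)) := by
    have h2 : E (CliffordAlgebra.ι (cliffordForm V) (innerₗ V v)) = flat v :=
      CliffordAlgebra.changeForm_ι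
      (CliffordAlgebra.changeForm.associated_neg_proof (Q := cliffordForm V)) _
    have h3 : insertVec u (flat v) = algebraMap ℝ (Forms V) (inner ℝ v u) := by
      simpa [Algebra.algebraMap_eq_smul_one] using insertVec_flat_mul u v 1
    rw [map_add, equivExterior_ι_mul, h2, equivExterior_algebraMap, h3, real_inner_comm]
    abel
  have h4 := equivExterior_commutator u v (E.symm θ)
  rw [LinearEquiv.apply_symm_apply] at h4
  rw [← h4, h1]
  simp only [cliffordBracket, cliffordMul, LinearMap.sub_apply, LinearMap.flip_apply,
    LinearMap.compr₂_apply, LinearMap.compl₁₂_apply, LinearEquiv.coe_coe, LinearMap.mul_apply']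
  rw [← map_sub]
  erw [LinearEquiv.symm_apply_apply]
  congr 1
  rw [add_mul, mul_add, Algebra.commutes]
  abel

theorem sharpProduct_tmul (a b c d : Forms V) :
    sharpProduct (a ⊗ₜ[ℝ] b) (c ⊗ₜ[ℝ] d) = cliffordBracket a c ⊗ₜ[ℝ] cliffordBracket b d := rfl

end Clifford

/-! ### Double forms built from curvature-type tensors. -/

section CurvatureAlgebra

/-- The pair symmetry of an algebraic curvature tensor. -/
theorem curvature_pair_symm {ι : Type*} {R : ι → ι → ι → ι → ℝ}
    (h12 : ∀ i j k l, R i j k l = -R j i k l) (h34 : ∀ i j k l, R i j k l = -R i j l k)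
    (hB : ∀ i j k l, R i j k l + R j k i l + R k i j l = 0) (i j k l : ι) :
    R i j k l = R k l i j := by
  -- Four cyclic identities, one for each choice of the index held fixed, combine through the two
  -- skew symmetries.
  linarith [hB i j k l, hB j k l i, hB k l i j, hB l i j k, h12 i j k l, h34 i j k l,
    h34 j k i l, h34 k i j l, h12 k i j l, h12 l i j k, h12 k l i j, h34 k l i j, h34 l i j k,
    h34 j k l i, h12 j k l i, h12 k l j i, h34 k l j i, h34 l j k i, h12 l j k i, h12 j l k i,
    h12 l i k j, h34 i k l j, h12 i k l j, h12 k i l j, h34 i j l k, h12 j l i k, h34 j l i k,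
    h12 i j l k]

variable {V : Type*} [NormedAddCommGroup V] [InnerProductSpace ℝ V] [FiniteDimensional ℝ V]

theorem sum_sum_neg_swap {ι X : Type*} [Fintype ι] [AddCommGroup X] [Module ℝ X]
    {T : ι → ι → ℝ} (hT : ∀ i j, T i j = -T j i) (f : ι → ι → X) :
    ∑ i, ∑ j, T i j • (f i j - f j i) = (2 : ℝ) • ∑ i, ∑ j, T i j • f i j := by
  have h : ∑ i, ∑ j, T i j • f j i = -∑ i, ∑ j, T i j • f i j := by
    rw [Finset.sum_comm, ← Finset.sum_neg_distrib]
    refine Finset.sum_congr rfl fun i _ => ?_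
    rw [← Finset.sum_neg_distrib]
    refine Finset.sum_congr rfl fun j _ => ?_
    rw [hT j i, neg_smul]
  simp only [smul_sub, Finset.sum_sub_distrib, h]
  module

theorem insertVec_sum_flat_mul_flat {T : Fin (Module.finrank ℝ V) → Fin (Module.finrank ℝ V) → ℝ}
    (hT : ∀ i j, T i j = -T j i) (m : Fin (Module.finrank ℝ V)) :
    insertVec (onb V m) (∑ i, ∑ j, T i j • (flat (onb V i) * flat (onb V j))) =
      (2 : ℝ) • ∑ j, T m j • flat (onb V j) := by
  have h (i j) : insertVec (onb V m) (flat (onb V i) * flat (onb V j)) =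
      (if i = m then (1 : ℝ) else 0) • flat (onb V j) -
        (if j = m then (1 : ℝ) else 0) • flat (onb V i) := by
    have h1 := insertVec_flat_mul (onb V m) (onb V j) 1
    rw [mul_one, insertVec_one, mul_zero, sub_zero, (onb V).inner_eq_ite] at h1
    rw [insertVec_flat_mul, h1, (onb V).inner_eq_ite, mul_smul_comm, mul_one]
  simp only [map_sum, map_smul, h]
  rw [sum_sum_neg_swap hT fun i j => (if i = m then (1 : ℝ) else 0) • flat (onb V j)]
  congr 1
  rw [Finset.sum_comm]
  simp

theorem cliffordBracket_sum_flat_mul_flat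
    {T : Fin (Module.finrank ℝ V) → Fin (Module.finrank ℝ V) → ℝ}
    (hT : ∀ i j, T i j = -T j i) (θ : Forms V) :
    cliffordBracket (∑ i, ∑ j, T i j • (flat (onb V i) * flat (onb V j))) θ =
      (4 : ℝ) • ∑ i, ∑ j, T i j • (flat (onb V j) * insertVec (onb V i) θ) := by
  simp only [map_sum, map_smul, LinearMap.sum_apply, LinearMap.smul_apply,
    cliffordBracket_flat_mul_flat, smul_comm _ (2 : ℝ), ← Finset.smul_sum]
  rw [sum_sum_neg_swap hT fun i j => flat (onb V j) * insertVec (onb V i) θ, smul_smul]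
  norm_num

/-- The components of a `4`-tensor in the chosen orthonormal basis. -/
def tensorComp (T : V → V → V → V → ℝ) (i j k l : Fin (Module.finrank ℝ V)) : ℝ :=
  T (onb V i) (onb V j) (onb V k) (onb V l)

/-- The `2`-form `∑ T_{ij} e^i ∧ e^j`. -/
def twoForm (T : Fin (Module.finrank ℝ V) → Fin (Module.finrank ℝ V) → ℝ) : Forms V :=
  ∑ i, ∑ j, T i j • (flat (onb V i) * flat (onb V j))

theorem sum_sum_comm_pairs {ι X : Type*} [Fintype ι] [AddCommMonoid X] (f : ι → ι → ι → ι → X) :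
    ∑ i, ∑ j, ∑ k, ∑ l, f i j k l = ∑ k, ∑ l, ∑ i, ∑ j, f i j k l := by
  calc ∑ i, ∑ j, ∑ k, ∑ l, f i j k l = ∑ i, ∑ k, ∑ j, ∑ l, f i j k l :=
        Finset.sum_congr rfl fun i _ => Finset.sum_comm
    _ = ∑ k, ∑ i, ∑ j, ∑ l, f i j k l := Finset.sum_comm
    _ = ∑ k, ∑ i, ∑ l, ∑ j, f i j k l :=
        Finset.sum_congr rfl fun k _ => Finset.sum_congr rfl fun i _ => Finset.sum_comm
    _ = _ := Finset.sum_congr rfl fun k _ => Finset.sum_comm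

theorem doubleFormOfTensor_eq_sum_twoForm_tmul (T : V → V → V → V → ℝ) :
    doubleFormOfTensor T = (1 / 4 : ℝ) • ∑ k, ∑ l,
      twoForm (fun i j => tensorComp T i j k l) ⊗ₜ[ℝ] (flat (onb V k) * flat (onb V l)) := by
  rw [doubleFormOfTensor, sum_sum_comm_pairs]
  simp only [twoForm, TensorProduct.sum_tmul, TensorProduct.smul_tmul', tensorComp]

theorem insertLeft_insertRight_comm {V : Type*} [AddCommGroup V] [Module ℝ V] (u v : V)
    (η : DoubleForms V) : insertLeft u (insertRight v η) = insertRight v (insertLeft u η) := by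
  induction η using TensorProduct.induction_on with
  | zero => simp
  | add x y hx hy => simp only [map_add, hx, hy]
  | tmul a b => rfl

/-- By skewness each of the two insertions gives a factor `2`, and these cancel the normalisation
`1/4`. -/
theorem contraction_doubleFormOfTensor {T : V → V → V → V → ℝ}
    (h12 : ∀ i j k l, tensorComp T i j k l = -tensorComp T j i k l)
    (h34 : ∀ i j k l, tensorComp T i j k l = -tensorComp T i j l k) :
    contraction (doubleFormOfTensor T) =
      ∑ m, ∑ j, ∑ l, tensorComp T m j m l • (flat (onb V j) ⊗ₜ[ℝ] flat (onb V l)) := by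
  simp only [contraction, LinearMap.sum_apply, LinearMap.comp_apply, insertLeft_insertRight_comm]
  refine Finset.sum_congr rfl fun m _ => ?_
  have hL : insertLeft (onb V m) (doubleFormOfTensor T) = (1 / 2 : ℝ) •
      ∑ j, flat (onb V j) ⊗ₜ[ℝ] twoForm (fun k l => tensorComp T m j k l) := by
    rw [doubleFormOfTensor_eq_sum_twoForm_tmul]
    simp only [map_smul, map_sum, insertLeft_tmul]
    simp only [twoForm, insertVec_sum_flat_mul_flat fun i j => h12 i j _ _, TensorProduct.sum_tmul,
      TensorProduct.tmul_sum, ← TensorProduct.smul_tmul', TensorProduct.tmul_smul, Finset.smul_sum]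
    rw [Finset.sum_comm_cycle]
    refine Finset.sum_congr rfl fun j _ => Finset.sum_congr rfl fun k _ =>
      Finset.sum_congr rfl fun l _ => ?_
    rw [smul_smul]
    congr 1
    ring
  rw [hL]
  simp only [map_smul, map_sum, insertRight_tmul]
  simp only [twoForm, insertVec_sum_flat_mul_flat fun k l => h34 m _ k l, TensorProduct.tmul_sum,
    TensorProduct.tmul_smul, Finset.smul_sum, smul_smul]
  refine Finset.sum_congr rfl fun j _ => Finset.sum_congr rfl fun l _ => ?_
  congr 1
  ring

/-- Each of the two commutators contributes `4`: a `2` from the bracket and a `2` from the skew sum.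
With the normalisation `1/4` this leaves the constant `4`. -/
theorem sharpProduct_doubleFormOfTensor {T : V → V → V → V → ℝ}
    (h12 : ∀ i j k l, tensorComp T i j k l = -tensorComp T j i k l)
    (h34 : ∀ i j k l, tensorComp T i j k l = -tensorComp T i j l k) (η : DoubleForms V) :
    sharpProduct (doubleFormOfTensor T) η = (4 : ℝ) • ∑ i, ∑ j, ∑ k, ∑ l, tensorComp T i j k l •
      (flatLeft (onb V j) * insertLeft (onb V i)
        (flatRight (onb V l) * insertRight (onb V k) η)) := by
  induction η using TensorProduct.induction_on with
  | zero => simp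
  | add x y hx hy =>
    simp only [map_add, hx, hy, mul_add, smul_add, Finset.sum_add_distrib]
  | tmul a b =>
    rw [doubleFormOfTensor_eq_sum_twoForm_tmul]
    simp only [map_smul, map_sum, LinearMap.smul_apply, LinearMap.sum_apply, sharpProduct_tmul]
    have h (k l) : cliffordBracket (twoForm fun i j => tensorComp T i j k l) a ⊗ₜ[ℝ]
        cliffordBracket (flat (onb V k) * flat (onb V l)) b =
        (8 : ℝ) • ∑ i, ∑ j, (flat (onb V j) * insertVec (onb V i) a) ⊗ₜ[ℝ]
          (tensorComp T i j k l • (flat (onb V l) * insertVec (onb V k) b -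
            flat (onb V k) * insertVec (onb V l) b)) := by
      rw [twoForm, cliffordBracket_sum_flat_mul_flat fun i j => h12 i j k l,
        cliffordBracket_flat_mul_flat, TensorProduct.tmul_smul, ← TensorProduct.smul_tmul',
        smul_smul]
      simp only [TensorProduct.sum_tmul, ← TensorProduct.smul_tmul', TensorProduct.tmul_smul]
      norm_num
    simp only [h, ← Finset.smul_sum]
    rw [← sum_sum_comm_pairs]
    simp only [← TensorProduct.tmul_sum,
      sum_sum_neg_swap (h34 _ _) fun k l => flat (onb V l) * insertVec (onb V k) b]
    simp only [TensorProduct.tmul_sum, TensorProduct.tmul_smul, ← Finset.smul_sum, smul_smul,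
      flatRight_mul_tmul, flatLeft_mul_tmul, insertLeft_tmul, insertRight_tmul]
    norm_num

end CurvatureAlgebra

/-! ### The curvature term as pointwise linear algebra. -/

section WeitzenboeckAlgebra

variable {V : Type*} [NormedAddCommGroup V] [InnerProductSpace ℝ V] [FiniteDimensional ℝ V]

theorem flatLeft_mul_flatLeft_mul_swap {V : Type*} [NormedAddCommGroup V] [InnerProductSpace ℝ V]
    (u v : V) (η : DoubleForms V) :
    flatLeft u * (flatLeft v * η) = -(flatLeft v * (flatLeft u * η)) := by
  induction η using TensorProduct.induction_on with
  | zero => simp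
  | add x y hx hy => simp only [mul_add, hx, hy, neg_add]
  | tmul a b => simp [flat_mul_flat_mul_swap u v, TensorProduct.neg_tmul]

/-- A contraction of a curvature tensor with a tensor that is skew in two pairs of slots. -/
theorem sum_curvature_smul_of_skew {ι X : Type*} [Fintype ι] [AddCommGroup X] [Module ℝ X]
    {R : ι → ι → ι → ι → ℝ}
    (h12 : ∀ i j k l, R i j k l = -R j i k l) (h34 : ∀ i j k l, R i j k l = -R i j l k)
    (hB : ∀ i j k l, R i j k l + R j k i l + R k i j l = 0)
    {F : ι → ι → ι → ι → X} (hF : ∀ i j k l, F i j k l = -F j i k l) :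
    (2 : ℝ) • ∑ i, ∑ j, ∑ k, ∑ l, R i j k l • F j l i k =
      -∑ i, ∑ j, ∑ k, ∑ l, R i j k l • F i j l k := by
  have hsymm := curvature_pair_symm h12 h34 hB
  -- Exchanging `j` and `l` and using the skewness of `F` gives a second expression for the same
  -- sum. Adding the two leaves the coefficient `R i j k l - R i l k j`, which by Bianchi and pair
  -- symmetry is the single component `-R j l k i`.
  have e1 : ∑ i, ∑ j, ∑ k, ∑ l, R i j k l • F j l i k =
      ∑ i, ∑ j, ∑ k, ∑ l, (-R i l k j) • F j l i k := by
    refine Finset.sum_congr rfl fun i _ => ?_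
    calc ∑ j, ∑ k, ∑ l, R i j k l • F j l i k = ∑ l, ∑ k, ∑ j, R i j k l • F j l i k :=
          Finset.sum_comm_cycle.trans (Finset.sum_congr rfl fun l _ => Finset.sum_comm)
      _ = _ := by
        refine Finset.sum_congr rfl fun j _ => Finset.sum_congr rfl fun k _ =>
          Finset.sum_congr rfl fun l _ => ?_
        rw [hF l j, smul_neg, neg_smul]
  have e2 : ∑ i, ∑ j, ∑ k, ∑ l, R i j k l • F i j l k =
      ∑ i, ∑ j, ∑ k, ∑ l, R j l k i • F j l i k := by
    calc ∑ i, ∑ j, ∑ k, ∑ l, R i j k l • F i j l k = ∑ i, ∑ l, ∑ j, ∑ k, R i j k l • F i j l k :=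
          Finset.sum_congr rfl fun i _ => Finset.sum_comm_cycle
      _ = ∑ l, ∑ i, ∑ j, ∑ k, R i j k l • F i j l k := Finset.sum_comm
      _ = _ := Finset.sum_congr rfl fun i _ => Finset.sum_congr rfl fun j _ => Finset.sum_comm
  rw [two_smul]
  nth_rewrite 2 [e1]
  rw [e2]
  simp only [← Finset.sum_add_distrib, ← Finset.sum_neg_distrib]
  refine Finset.sum_congr rfl fun i _ => Finset.sum_congr rfl fun j _ =>
    Finset.sum_congr rfl fun k _ => Finset.sum_congr rfl fun l _ => ?_
  rw [← add_smul, ← neg_smul]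
  congr 1
  linarith [hB i j k l, hsymm j k i l, h12 i l j k, hsymm i l k j, h12 k j i l, h34 j l k i,
    hsymm k i j l, h34 i l k j, h12 l i j k, h34 j k i l]

/-- Insertion of `e_i` and multiplication by `e^j` anticommute for `i ≠ j`, and the diagonal terms
carry a zero coefficient. -/
theorem sum_smul_insertLeft_flatLeft_mul
    {T : Fin (Module.finrank ℝ V) → Fin (Module.finrank ℝ V) → ℝ} (hT : ∀ i, T i i = 0)
    (η : DoubleForms V) :
    ∑ i, ∑ j, T i j • insertLeft (onb V i) (flatLeft (onb V j) * η) =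
      -∑ i, ∑ j, T i j • (flatLeft (onb V j) * insertLeft (onb V i) η) := by
  simp only [← Finset.sum_neg_distrib]
  refine Finset.sum_congr rfl fun i _ => Finset.sum_congr rfl fun j _ => ?_
  rw [insertLeft_flatLeft_mul, (onb V).inner_eq_ite]
  split_ifs with h
  · simp [← h, hT]
  · simp

/-- Expanding `A e_k` in the frame gives the transposed matrix; skewness transposes it back at the
cost of the sign. -/
theorem dfDer_eq_neg_sum (A : Module.End ℝ V)
    (hA : ∀ k l, inner ℝ (A (onb V k)) (onb V l) = -inner ℝ (A (onb V l)) (onb V k))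
    (η : DoubleForms V) :
    dfDer A η = -∑ k, ∑ l, inner ℝ (A (onb V k)) (onb V l) •
      (flatLeft (onb V l) * insertLeft (onb V k) η +
        flatRight (onb V l) * insertRight (onb V k) η) := by
  have h (k) : A (onb V k) = ∑ l, inner ℝ (A (onb V k)) (onb V l) • onb V l := by
    simpa only [real_inner_comm] using ((onb V).sum_repr' (A (onb V k))).symm
  have hL (k) : insertLeft (A (onb V k)) η =
      ∑ l, inner ℝ (A (onb V k)) (onb V l) • insertLeft (onb V l) η := by
    conv_lhs => rw [h k, ← insertLeftₗ_apply]
    simp only [map_sum, map_smul, LinearMap.sum_apply, LinearMap.smul_apply, insertLeftₗ_apply]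
  have hR (k) : insertRight (A (onb V k)) η =
      ∑ l, inner ℝ (A (onb V k)) (onb V l) • insertRight (onb V l) η := by
    conv_lhs => rw [h k, ← insertRightₗ_apply]
    simp only [map_sum, map_smul, LinearMap.sum_apply, LinearMap.smul_apply, insertRightₗ_apply]
  rw [dfDer_eq_sum]
  simp only [hL, hR, Finset.mul_sum, ← Finset.sum_add_distrib, mul_smul_comm, ← smul_add]
  rw [Finset.sum_comm, ← Finset.sum_neg_distrib]
  refine Finset.sum_congr rfl fun k _ => ?_
  rw [← Finset.sum_neg_distrib]
  refine Finset.sum_congr rfl fun l _ => ?_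
  rw [hA l k, neg_smul]

/-- The algebraic core, for any endomorphism-valued `K` with the symmetries of a curvature. Both
sides are reduced to sums of `R_ijkl` against products of exterior multiplications and insertions.
-/
theorem weitzenboeck_curvature_identity (K : V → V → Module.End ℝ V)
    (h12 : ∀ u v, K u v = -K v u)
    (h34 : ∀ u v z w, inner ℝ (K u v z) w = -inner ℝ (K u v w) z)
    (hB : ∀ u v z, K u v z + K v z u + K z u v = 0)
    {p q : ℕ} {η : DoubleForms V} (hη : η ∈ bidegree V p q) :
    -∑ i, ∑ j, insertLeft (onb V i) (flatLeft (onb V j) * dfDer (K (onb V i) (onb V j)) η) =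
      comp η (metricPow V ((p : ℤ) - 1) *
            contraction (doubleFormOfTensor fun u v z w => inner ℝ (K u v z) w) -
          (2 : ℝ) • (metricPow V ((p : ℤ) - 2) *
            doubleFormOfTensor fun u v z w => inner ℝ (K u v z) w)) -
        (1 / 4 : ℝ) • sharpProduct (doubleFormOfTensor fun u v z w => inner ℝ (K u v z) w) η := by
  set T : V → V → V → V → ℝ := fun u v z w => inner ℝ (K u v z) w with hT
  set R := tensorComp T with hR
  have r12 (i j k l) : R i j k l = -R j i k l := by
    simp [hR, hT, tensorComp, h12 (onb V i) (onb V j)]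
  have r34 (i j k l) : R i j k l = -R i j l k := h34 _ _ _ _
  have rB (i j k l) : R i j k l + R j k i l + R k i j l = 0 := by
    simp only [hR, hT, tensorComp, ← inner_add_left, hB, inner_zero_left]
  have rdiag (i k l) : R i i k l = 0 := by linarith [r12 i i k l]
  have hder (i j) : dfDer (K (onb V i) (onb V j)) η = -∑ k, ∑ l, R i j k l •
      (flatLeft (onb V l) * insertLeft (onb V k) η +
        flatRight (onb V l) * insertRight (onb V k) η) :=
    dfDer_eq_neg_sum _ (fun k l => h34 _ _ _ _) η
  -- The derivation acts on the left and on the right factor; the right action will match the sharp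
  -- product, the left one the composition products.
  have lhs : -∑ i, ∑ j, insertLeft (onb V i)
        (flatLeft (onb V j) * dfDer (K (onb V i) (onb V j)) η) =
      -∑ i, ∑ j, ∑ k, ∑ l, R i j k l • (flatLeft (onb V j) * insertLeft (onb V i)
        (flatLeft (onb V l) * insertLeft (onb V k) η)) -
      ∑ i, ∑ j, ∑ k, ∑ l, R i j k l • (flatLeft (onb V j) * insertLeft (onb V i)
        (flatRight (onb V l) * insertRight (onb V k) η)) := by
    simp only [hder, mul_neg, map_neg, Finset.sum_neg_distrib, neg_neg, Finset.mul_sum, map_sum,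
      mul_smul_comm, map_smul]
    rw [sum_sum_comm_pairs]
    have key (k l) := sum_smul_insertLeft_flatLeft_mul (T := fun i j => R i j k l)
      (fun i => rdiag i k l)
    simp only [key, Finset.sum_neg_distrib]
    rw [← sum_sum_comm_pairs]
    simp only [map_add, mul_add, smul_add, Finset.sum_add_distrib, neg_add]
    abel
  have ric : comp η (metricPow V ((p : ℤ) - 1) * contraction (doubleFormOfTensor T)) =
      ∑ m, ∑ j, ∑ l, R m j m l • (flatLeft (onb V j) * insertLeft (onb V l) η) := by
    rw [contraction_doubleFormOfTensor r12 r34]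
    simp only [Finset.mul_sum, mul_smul_comm, map_sum, map_smul,
      comp_metricPow_mul_flat_tmul_flat hη]
    rfl
  have riem : comp η (metricPow V ((p : ℤ) - 2) * doubleFormOfTensor T) =
      (1 / 4 : ℝ) • ∑ i, ∑ j, ∑ k, ∑ l, R i j k l •
        (flatLeft (onb V i) * (flatLeft (onb V j) *
          insertLeft (onb V l) (insertLeft (onb V k) η))) := by
    simp only [doubleFormOfTensor, Finset.mul_sum, mul_smul_comm, map_sum, map_smul,
      comp_metricPow_mul_flat_mul_flat_tmul hη]
    rfl
  have hskew := sum_curvature_smul_of_skew r12 r34 rB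
    (F := fun i j k l => flatLeft (onb V i) * (flatLeft (onb V j) *
      insertLeft (onb V k) (insertLeft (onb V l) η)))
    (fun i j k l => flatLeft_mul_flatLeft_mul_swap _ _ _)
  -- Normal ordering: moving `i_{e_i}` past `e^l` leaves `δ_il`, whose trace of `R` is Ricci (with a
  -- sign from the last pair), and a term with both multiplications in front.
  have hric : ∑ i, ∑ j, ∑ k, ∑ l, R i j k l • (flatLeft (onb V j) * insertLeft (onb V i)
        (flatLeft (onb V l) * insertLeft (onb V k) η)) =
      -∑ m, ∑ j, ∑ l, R m j m l • (flatLeft (onb V j) * insertLeft (onb V l) η) -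
      ∑ i, ∑ j, ∑ k, ∑ l, R i j k l • (flatLeft (onb V j) * (flatLeft (onb V l) *
        insertLeft (onb V i) (insertLeft (onb V k) η))) := by
    simp only [insertLeft_flatLeft_mul, (onb V).inner_eq_ite, mul_sub, smul_sub,
      Finset.sum_sub_distrib, mul_smul_comm, smul_smul]
    congr 1
    simp only [← Finset.sum_neg_distrib]
    refine Finset.sum_congr rfl fun i _ => Finset.sum_congr rfl fun j _ =>
      Finset.sum_congr rfl fun k _ => ?_
    rw [r34 i j i k]
    simp
  rw [lhs, map_sub, map_smul, ric, riem, sharpProduct_doubleFormOfTensor r12 r34, hric]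
  simp only [smul_smul]
  rw [show (∑ i, ∑ j, ∑ k, ∑ l, R i j k l • (flatLeft (onb V i) * (flatLeft (onb V j) *
          insertLeft (onb V l) (insertLeft (onb V k) η)))) = -((2 : ℝ) •
        ∑ i, ∑ j, ∑ k, ∑ l, R i j k l • (flatLeft (onb V j) * (flatLeft (onb V l) *
          insertLeft (onb V i) (insertLeft (onb V k) η)))) by rw [hskew, neg_neg]]
  rw [hR]
  module

end WeitzenboeckAlgebra

/-! ### Norms on finite-dimensional spaces of tensors -/

section Norms

/-- A norm on a finite-dimensional vector space, given by a choice of coordinates. -/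
@[reducible]
def normedAddCommGroupOfFinite (W : Type*) [AddCommGroup W] [Module ℝ W] [FiniteDimensional ℝ W] :
    NormedAddCommGroup W :=
  NormedAddCommGroup.induced W (Fin (Module.finrank ℝ W) → ℝ) (Module.finBasis ℝ W).equivFun
    (Module.finBasis ℝ W).equivFun.injective

/-- The scalar multiplication is bounded for `normedAddCommGroupOfFinite`. -/
@[reducible]
def normedSpaceOfFinite (W : Type*) [AddCommGroup W] [Module ℝ W] [FiniteDimensional ℝ W] :
    letI := normedAddCommGroupOfFinite W
    NormedSpace ℝ W :=
  letI := normedAddCommGroupOfFinite W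
  NormedSpace.induced ℝ W (Fin (Module.finrank ℝ W) → ℝ) (Module.finBasis ℝ W).equivFun

variable (V W : Type*) [AddCommGroup V] [Module ℝ V] [FiniteDimensional ℝ V]
  [AddCommGroup W] [Module ℝ W] [FiniteDimensional ℝ W]

instance : FiniteDimensional ℝ (Forms V) :=
  Module.Basis.finiteDimensional_of_finite
    (Module.finBasis ℝ (Module.Dual ℝ V)).ExteriorAlgebra

/-- Norms are needed only to speak of derivatives of functions with values in these
finite-dimensional spaces; the derivatives do not depend on the choice. -/
instance : NormedAddCommGroup (V →ₗ[ℝ] W) := normedAddCommGroupOfFinite _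

instance : NormedSpace ℝ (V →ₗ[ℝ] W) := normedSpaceOfFinite _

instance : NormedAddCommGroup (Forms V) := normedAddCommGroupOfFinite _

instance : NormedSpace ℝ (Forms V) := normedSpaceOfFinite _

instance : NormedAddCommGroup (DoubleForms V) := normedAddCommGroupOfFinite _

instance : NormedSpace ℝ (DoubleForms V) := normedSpaceOfFinite _

end Norms

/-! ### Derivatives of vector-valued functions -/

section Calculus

variable {E : Type*} [NormedAddCommGroup E] [NormedSpace ℝ E]
  {M : Type*} [TopologicalSpace M] [ChartedSpace E M]
  {F₁ F₂ F₃ : Type*} [NormedAddCommGroup F₁] [NormedSpace ℝ F₁] [FiniteDimensional ℝ F₁]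
  [NormedAddCommGroup F₂] [NormedSpace ℝ F₂] [FiniteDimensional ℝ F₂]
  [NormedAddCommGroup F₃] [NormedSpace ℝ F₃]

theorem contMDiffOn_linearMap_comp {n : ℕ∞ω} {s : Set M} (L : F₁ →ₗ[ℝ] F₃) {f : M → F₁}
    (hf : ContMDiffOn 𝓘(ℝ, E) 𝓘(ℝ, F₁) n f s) :
    ContMDiffOn 𝓘(ℝ, E) 𝓘(ℝ, F₃) n (fun y => L (f y)) s :=
  L.toContinuousLinearMap.contMDiff.comp_contMDiffOn hf

theorem mdifferentiableAt_linearMap_comp {x : M} (L : F₁ →ₗ[ℝ] F₃) {f : M → F₁}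
    (hf : MDifferentiableAt 𝓘(ℝ, E) 𝓘(ℝ, F₁) f x) :
    MDifferentiableAt 𝓘(ℝ, E) 𝓘(ℝ, F₃) (fun y => L (f y)) x :=
  L.toContinuousLinearMap.mdifferentiableAt.comp x hf

theorem mvfderiv_linearMap_comp {x : M} (L : F₁ →ₗ[ℝ] F₃) {f : M → F₁}
    (hf : MDifferentiableAt 𝓘(ℝ, E) 𝓘(ℝ, F₁) f x) (w : TangentSpace 𝓘(ℝ, E) x) :
    mvfderiv 𝓘(ℝ, E) (fun y => L (f y)) x w = L (mvfderiv 𝓘(ℝ, E) f x w) := by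
  have h := mfderiv_comp x (L.toContinuousLinearMap.mdifferentiableAt (x := f x)) hf
  rw [ContinuousLinearMap.mfderiv_eq] at h
  exact congrArg (fun T => T w) h

theorem mdifferentiableAt_mvfderiv_bilinear {x : M} (B : F₁ →ₗ[ℝ] F₂ →ₗ[ℝ] F₃)
    {f : M → F₁} {g : M → F₂}
    (hf : MDifferentiableAt 𝓘(ℝ, E) 𝓘(ℝ, F₁) f x) (hg : MDifferentiableAt 𝓘(ℝ, E) 𝓘(ℝ, F₂) g x) :
    MDifferentiableAt 𝓘(ℝ, E) 𝓘(ℝ, F₃) (fun y => B (f y) (g y)) x ∧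
      ∀ w, mvfderiv 𝓘(ℝ, E) (fun y => B (f y) (g y)) x w =
        B (mvfderiv 𝓘(ℝ, E) f x w) (g x) + B (f x) (mvfderiv 𝓘(ℝ, E) g x w) := by
  let B' : F₁ →L[ℝ] F₂ →L[ℝ] F₃ :=
    (LinearMap.toContinuousLinearMap.toLinearMap ∘ₗ B).toContinuousLinearMap
  have h : HasMFDerivAt 𝓘(ℝ, E) 𝓘(ℝ, F₃) (fun y => B' (f y) (g y)) x
      (B'.precompR E (f x) (mfderiv 𝓘(ℝ, E) 𝓘(ℝ, F₂) g x) +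
        B'.precompL E (mfderiv 𝓘(ℝ, E) 𝓘(ℝ, F₁) f x) (g x)) := by
    refine ⟨?_, ?_⟩
    · exact (B'.continuous.continuousAt.comp hf.continuousAt).clm_apply hg.continuousAt
    · have h1 := B'.hasFDerivWithinAt_of_bilinear hf.hasMFDerivAt.2 hg.hasMFDerivAt.2
      simp only [writtenInExtChartAt, Function.comp_apply, extChartAt_to_inv] at h1
      exact h1
  refine ⟨h.mdifferentiableAt, fun w => ?_⟩
  have h' := congrArg (fun T => T w) h.mfderiv
  refine h'.trans ?_
  rw [add_comm]
  rfl

end Calculus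

theorem two_le_infty : (2 : ℕ∞ω) ≤ ∞ := ENat.LEInfty.out

/-! ### Constant-coefficient frames of a chart and derivatives along them. -/

section Transport

variable {E : Type*} [NormedAddCommGroup E] [NormedSpace ℝ E]
  {M : Type*} [TopologicalSpace M] [ChartedSpace E M] [IsManifold 𝓘(ℝ, E) ∞ M]

/-- The domain of the preferred bundle chart at `x`. -/
abbrev chartDomain (x : M) : Set M := (trivializationAt E (TangentSpace 𝓘(ℝ, E)) x).baseSet

theorem mem_chartDomain_self (x : M) : x ∈ chartDomain (E := E) x :=
  FiberBundle.mem_baseSet_trivializationAt' x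

theorem isOpen_chartDomain (x : M) : IsOpen (chartDomain (E := E) x) :=
  (trivializationAt E (TangentSpace 𝓘(ℝ, E)) x).open_baseSet

theorem chartDomain_mem_nhds {x y : M} (hy : y ∈ chartDomain (E := E) x) :
    chartDomain (E := E) x ∈ nhds y :=
  (isOpen_chartDomain x).mem_nhds hy

/-- The inverse of `transport x y : T_x M → T_y M`. -/
def transportInv (x y : M) : TangentSpace 𝓘(ℝ, E) y →ₗ[ℝ] TangentSpace 𝓘(ℝ, E) x :=
  ((trivializationAt E (TangentSpace 𝓘(ℝ, E)) x).symmL ℝ x).toLinearMap ∘ₗ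
    ((trivializationAt E (TangentSpace 𝓘(ℝ, E)) x).continuousLinearMapAt ℝ y).toLinearMap

theorem transportInv_transport {x y : M} (hy : y ∈ chartDomain (E := E) x)
    (v : TangentSpace 𝓘(ℝ, E) x) : transportInv x y (transport x y v) = v := by
  simp only [transportInv, transport, LinearMap.comp_apply, ContinuousLinearMap.coe_coe]
  rw [Trivialization.continuousLinearMapAt_symmL _ hy,
    Trivialization.symmL_continuousLinearMapAt _ (mem_chartDomain_self x)]

theorem transport_transportInv {x y : M} (hy : y ∈ chartDomain (E := E) x)
    (v : TangentSpace 𝓘(ℝ, E) y) : transport x y (transportInv x y v) = v := by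
  simp only [transportInv, transport, LinearMap.comp_apply, ContinuousLinearMap.coe_coe]
  rw [Trivialization.continuousLinearMapAt_symmL _ (mem_chartDomain_self x),
    Trivialization.symmL_continuousLinearMapAt _ hy]

@[simp]
theorem transport_self (x : M) (v : TangentSpace 𝓘(ℝ, E) x) : transport x x v = v :=
  Trivialization.symmL_continuousLinearMapAt _ (mem_chartDomain_self x) v

theorem transport_self_eq_id (x : M) : transport (E := E) x x = LinearMap.id :=
  LinearMap.ext (transport_self x)

@[simp]
theorem transportInv_self (x : M) (v : TangentSpace 𝓘(ℝ, E) x) : transportInv x x v = v :=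
  transport_self x v

/-- The coordinates of a tangent vector at `x` in the preferred chart. -/
def coords (x : M) (v : TangentSpace 𝓘(ℝ, E) x) : E :=
  (trivializationAt E (TangentSpace 𝓘(ℝ, E)) x).continuousLinearMapAt ℝ x v

variable {F : Type*} [NormedAddCommGroup F] [NormedSpace ℝ F]

theorem transport_eq_mfderiv {x y : M} (hy : y ∈ chartDomain (E := E) x)
    (v : TangentSpace 𝓘(ℝ, E) x) :
    transport x y v = mfderiv 𝓘(ℝ, E) 𝓘(ℝ, E) (extChartAt 𝓘(ℝ, E) x).symm
      (extChartAt 𝓘(ℝ, E) x y) (coords (E := E) x v) := by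
  have hy' : y ∈ (chartAt E x).source := hy
  have h := TangentBundle.symmL_trivializationAt (I := 𝓘(ℝ, E)) hy'
  rw [ModelWithCorners.range_eq_univ, mfderivWithin_univ] at h
  exact congrArg (fun T => T (coords x v)) h

theorem contMDiffAt_extChartAt_symm {x y : M} (hy : y ∈ chartDomain (E := E) x) :
    ContMDiffAt 𝓘(ℝ, E) 𝓘(ℝ, E) ∞ (extChartAt 𝓘(ℝ, E) x).symm (extChartAt 𝓘(ℝ, E) x y) := by
  have hy' : y ∈ (extChartAt 𝓘(ℝ, E) x).source := by rw [extChartAt_source]; exact hy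
  exact (contMDiffOn_extChartAt_symm x).contMDiffAt
    (extChartAt_target_mem_nhds' ((extChartAt 𝓘(ℝ, E) x).map_source hy'))

/-- `transport x y` is the differential of the inverse chart applied to a fixed coordinate vector,
so this is the chain rule. -/
theorem mvfderiv_transport {x y : M} (hy : y ∈ chartDomain (E := E) x) {f : M → F}
    (hf : MDifferentiableAt 𝓘(ℝ, E) 𝓘(ℝ, F) f y) (v : TangentSpace 𝓘(ℝ, E) x) :
    mvfderiv 𝓘(ℝ, E) f y (transport x y v) =
      fderiv ℝ (f ∘ (extChartAt 𝓘(ℝ, E) x).symm) (extChartAt 𝓘(ℝ, E) x y) (coords x v) := by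
  have hy' : y ∈ (extChartAt 𝓘(ℝ, E) x).source := by rw [extChartAt_source]; exact hy
  have hl := (extChartAt 𝓘(ℝ, E) x).left_inv hy'
  have h := mfderiv_comp_of_eq (I'' := 𝓘(ℝ, F)) hf
    ((contMDiffAt_extChartAt_symm hy).mdifferentiableAt (by simp)) hl
  rw [transport_eq_mfderiv hy, ← mfderiv_eq_fderiv, h, hl]
  rfl

/-- The derivative of `f` along the coordinate field extending `v`. -/
def coordDeriv (x : M) (v : TangentSpace 𝓘(ℝ, E) x) (f : M → F) (y : M) : F :=
  mvfderiv 𝓘(ℝ, E) f y (transport x y v)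

theorem contDiffOn_comp_extChartAt_symm {x : M} {f : M → F}
    (hf : ContMDiffOn 𝓘(ℝ, E) 𝓘(ℝ, F) ∞ f (chartDomain (E := E) x)) :
    ContDiffOn ℝ ∞ (f ∘ (extChartAt 𝓘(ℝ, E) x).symm) (extChartAt 𝓘(ℝ, E) x).target := by
  rw [← contMDiffOn_iff_contDiffOn]
  refine hf.comp (contMDiffOn_extChartAt_symm x) fun e he => ?_
  have := (extChartAt 𝓘(ℝ, E) x).map_target he
  rwa [extChartAt_source] at this

theorem coordDeriv_eq {x y : M} (hy : y ∈ chartDomain (E := E) x) {f : M → F}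
    (hf : ContMDiffOn 𝓘(ℝ, E) 𝓘(ℝ, F) ∞ f (chartDomain (E := E) x))
    (v : TangentSpace 𝓘(ℝ, E) x) :
    coordDeriv x v f y =
      fderiv ℝ (f ∘ (extChartAt 𝓘(ℝ, E) x).symm) (extChartAt 𝓘(ℝ, E) x y) (coords x v) :=
  mvfderiv_transport hy ((hf.contMDiffAt (chartDomain_mem_nhds hy)).mdifferentiableAt (by simp)) v

theorem contMDiffOn_coordDeriv {x : M} {f : M → F}
    (hf : ContMDiffOn 𝓘(ℝ, E) 𝓘(ℝ, F) ∞ f (chartDomain (E := E) x))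
    (v : TangentSpace 𝓘(ℝ, E) x) :
    ContMDiffOn 𝓘(ℝ, E) 𝓘(ℝ, F) ∞ (coordDeriv x v f) (chartDomain (E := E) x) := by
  have h := (contDiffOn_comp_extChartAt_symm hf).fderiv_of_isOpen (m := ∞)
    (isOpen_extChartAt_target x) (by simp)
  have h2 : ContMDiffOn 𝓘(ℝ, E) 𝓘(ℝ, F) ∞ (fun y => fderiv ℝ
      (f ∘ (extChartAt 𝓘(ℝ, E) x).symm) (extChartAt 𝓘(ℝ, E) x y) (coords x v))
      (chartDomain (E := E) x) := by
    refine (contMDiffOn_iff_contDiffOn.2 (h.clm_apply contDiffOn_const)).comp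
      (contMDiffOn_extChartAt (x := x)) fun y hy => ?_
    exact (extChartAt 𝓘(ℝ, E) x).map_source (by rw [extChartAt_source]; exact hy)
  exact h2.congr fun y hy => coordDeriv_eq hy hf v

/-- In the chart the fields have constant coefficients, so both iterated derivatives are values of
one second Fréchet derivative, which is symmetric. -/
theorem coordDeriv_comm {x : M} {f : M → F}
    (hf : ContMDiffOn 𝓘(ℝ, E) 𝓘(ℝ, F) ∞ f (chartDomain (E := E) x))
    (u v : TangentSpace 𝓘(ℝ, E) x) :
    mvfderiv 𝓘(ℝ, E) (coordDeriv x v f) x u = mvfderiv 𝓘(ℝ, E) (coordDeriv x u f) x v := by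
  set g := f ∘ (extChartAt 𝓘(ℝ, E) x).symm with hg
  have hgd := contDiffOn_comp_extChartAt_symm hf
  have hx := mem_chartDomain_self (E := E) x
  have hnhds : (extChartAt 𝓘(ℝ, E) x).target ∈ nhds (extChartAt 𝓘(ℝ, E) x x) :=
    extChartAt_target_mem_nhds x
  have hgx : ContDiffAt ℝ ∞ g (extChartAt 𝓘(ℝ, E) x x) := hgd.contDiffAt hnhds
  have hdg : DifferentiableAt ℝ (fderiv ℝ g) (extChartAt 𝓘(ℝ, E) x x) :=
    (hgx.fderiv_right (m := 1) (one_add_one_eq_two.trans_le two_le_infty)).differentiableAt (by simp)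
  have key (u v : TangentSpace 𝓘(ℝ, E) x) : mvfderiv 𝓘(ℝ, E) (coordDeriv x v f) x u =
      fderiv ℝ (fderiv ℝ g) (extChartAt 𝓘(ℝ, E) x x) (coords x u) (coords x v) := by
    have h1 := coordDeriv_eq hx (contMDiffOn_coordDeriv hf v) u
    rw [coordDeriv, transport_self] at h1
    rw [h1]
    have h2 : (coordDeriv x v f ∘ (extChartAt 𝓘(ℝ, E) x).symm) =ᶠ[nhds (extChartAt 𝓘(ℝ, E) x x)]
        fun e => fderiv ℝ g e (coords x v) := by
      filter_upwards [hnhds] with e he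
      have he' := (extChartAt 𝓘(ℝ, E) x).map_target he
      rw [extChartAt_source] at he'
      rw [Function.comp_apply, coordDeriv_eq he' hf, (extChartAt 𝓘(ℝ, E) x).right_inv he]
    rw [h2.fderiv_eq, fderiv_clm_apply hdg (differentiableAt_const _)]
    simp
  rw [key, key]
  exact hgx.isSymmSndFDerivAt (by simpa using two_le_infty) _ _

theorem contMDiffOn_extend (x : M) (v : TangentSpace 𝓘(ℝ, E) x) :
    ContMDiffOn 𝓘(ℝ, E) (𝓘(ℝ, E).prod 𝓘(ℝ, E)) ∞ (T% (FiberBundle.extend E v))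
      (chartDomain (E := E) x) := by
  rw [Trivialization.contMDiffOn_section_baseSet_iff]
  refine (contMDiffOn_const (c := (trivializationAt E (TangentSpace 𝓘(ℝ, E)) x ⟨x, v⟩).2)).congr
    fun y hy => ?_
  simp only [FiberBundle.extend]
  rw [Trivialization.apply_mk_symm _ hy]

theorem mdifferentiableAt_extend' {x y : M} (hy : y ∈ chartDomain (E := E) x)
    (v : TangentSpace 𝓘(ℝ, E) x) :
    MDifferentiableAt 𝓘(ℝ, E) (𝓘(ℝ, E).prod 𝓘(ℝ, E)) (T% (FiberBundle.extend E v)) y :=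
  ((contMDiffOn_extend x v).contMDiffAt (chartDomain_mem_nhds hy)).mdifferentiableAt (by simp)

end Transport

/-! ### Coordinate fields commute. -/

section LieBracket

variable {E : Type*} [NormedAddCommGroup E] [NormedSpace ℝ E]

theorem mlieBracket_const (a b e : E) :
    VectorField.mlieBracket 𝓘(ℝ, E) (fun _ => a : Π e : E, TangentSpace 𝓘(ℝ, E) e)
      (fun _ => b : Π e : E, TangentSpace 𝓘(ℝ, E) e) e = 0 := by
  have h : VectorField.mlieBracket 𝓘(ℝ, E) (fun _ => a : Π e : E, TangentSpace 𝓘(ℝ, E) e)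
      (fun _ => b : Π e : E, TangentSpace 𝓘(ℝ, E) e) =
        VectorField.lieBracket ℝ (fun _ => a) (fun _ => b) :=
    VectorField.mlieBracketWithin_univ.symm.trans
      (VectorField.mlieBracketWithin_eq_lieBracketWithin.trans VectorField.lieBracketWithin_univ)
  exact (congrFun h e).trans (by simp [VectorField.lieBracket_eq]; rfl)

variable [FiniteDimensional ℝ E]
  {M : Type*} [TopologicalSpace M] [ChartedSpace E M] [IsManifold 𝓘(ℝ, E) ∞ M]

theorem mpullback_extend {x : M} (v : TangentSpace 𝓘(ℝ, E) x) {e : E}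
    (he : e ∈ (extChartAt 𝓘(ℝ, E) x).target) :
    VectorField.mpullback 𝓘(ℝ, E) 𝓘(ℝ, E) (extChartAt 𝓘(ℝ, E) x).symm
      (FiberBundle.extend E v) e = coords (E := E) x v := by
  have hy := (extChartAt 𝓘(ℝ, E) x).map_target he
  rw [extChartAt_source] at hy
  have hinv := isInvertible_mfderivWithin_extChartAt_symm (I := 𝓘(ℝ, E)) he
  rw [ModelWithCorners.range_eq_univ, mfderivWithin_univ] at hinv
  rw [VectorField.mpullback_apply, ← transport_apply x _ v hy, transport_eq_mfderiv hy,
    (extChartAt 𝓘(ℝ, E) x).right_inv he]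
  exact congrArg (fun T => T (coords (E := E) x v)) hinv.inverse_comp_self

/-- The Lie bracket is natural under the inverse chart, which pulls both fields back to constant
fields on `E`; invertibility of its differential carries the vanishing back to `M`. -/
theorem mlieBracket_extend {x y : M} (hy : y ∈ chartDomain (E := E) x)
    (u v : TangentSpace 𝓘(ℝ, E) x) :
    VectorField.mlieBracket 𝓘(ℝ, E) (FiberBundle.extend E u) (FiberBundle.extend E v) y = 0 := by
  have hy' : y ∈ (extChartAt 𝓘(ℝ, E) x).source := by rw [extChartAt_source]; exact hy
  have he := (extChartAt 𝓘(ℝ, E) x).map_source hy'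
  have hl := (extChartAt 𝓘(ℝ, E) x).left_inv hy'
  have hinv := isInvertible_mfderivWithin_extChartAt_symm (I := 𝓘(ℝ, E)) he
  rw [ModelWithCorners.range_eq_univ, mfderivWithin_univ] at hinv
  have := FiniteDimensional.complete ℝ E
  have : IsManifold 𝓘(ℝ, E) (minSmoothness ℝ 2) M := by
    rw [minSmoothness_of_isRCLikeNormedField]
    exact IsManifold.of_le two_le_infty
  have h := VectorField.mpullback_mlieBracket (I := 𝓘(ℝ, E)) (I' := 𝓘(ℝ, E)) (n := 2)
    (f := (extChartAt 𝓘(ℝ, E) x).symm) (x₀ := extChartAt 𝓘(ℝ, E) x y)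
    (V := FiberBundle.extend E u) (W := FiberBundle.extend E v)
    (by rw [hl]; exact mdifferentiableAt_extend' hy u)
    (by rw [hl]; exact mdifferentiableAt_extend' hy v)
    ((contMDiffAt_extChartAt_symm hy).of_le two_le_infty) (by simp)
  have hc (w : TangentSpace 𝓘(ℝ, E) x) : VectorField.mpullback 𝓘(ℝ, E) 𝓘(ℝ, E)
      (extChartAt 𝓘(ℝ, E) x).symm (FiberBundle.extend E w)
        =ᶠ[nhds (extChartAt 𝓘(ℝ, E) x y)] fun _ => coords (E := E) x w := by
    filter_upwards [(isOpen_extChartAt_target x).mem_nhds he] with e he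
    exact mpullback_extend w he
  rw [(hc u).mlieBracket_vectorField_eq (hc v), mlieBracket_const, VectorField.mpullback_apply] at h
  set B := VectorField.mlieBracket 𝓘(ℝ, E) (FiberBundle.extend E u) (FiberBundle.extend E v)
  have hB : B ((extChartAt 𝓘(ℝ, E) x).symm (extChartAt 𝓘(ℝ, E) x y)) = 0 := by
    have h3 := DFunLike.congr_fun hinv.self_comp_inverse
      (B ((extChartAt 𝓘(ℝ, E) x).symm (extChartAt 𝓘(ℝ, E) x y)))
    rw [ContinuousLinearMap.comp_apply, h, map_zero] at h3
    exact h3.symm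
  rwa [hl] at hB

end LieBracket

/-! ### Differentiability tested on components. -/

section Components

variable {E : Type*} [NormedAddCommGroup E] [NormedSpace ℝ E]
  {M : Type*} [TopologicalSpace M] [ChartedSpace E M]
  {F : Type*} [NormedAddCommGroup F] [NormedSpace ℝ F]

theorem mvfderiv_congr {x : M} {f g : M → F} (h : f =ᶠ[nhds x] g) :
    mvfderiv 𝓘(ℝ, E) f x = mvfderiv 𝓘(ℝ, E) g x := by
  have h1 : mfderiv 𝓘(ℝ, E) 𝓘(ℝ, F) f x = mfderiv 𝓘(ℝ, E) 𝓘(ℝ, F) g x := h.mfderiv_eq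
  ext w
  exact congrArg (fun T => T w) h1

theorem mdifferentiableAt_pi {ι : Type*} [Fintype ι] {x : M} {f : M → ι → F}
    (h : ∀ i, MDifferentiableAt 𝓘(ℝ, E) 𝓘(ℝ, F) (fun y => f y i) x) :
    MDifferentiableAt 𝓘(ℝ, E) 𝓘(ℝ, ι → F) f x := by
  rw [mdifferentiableAt_iff]
  refine ⟨continuousAt_pi.2 fun i => (h i).continuousAt, ?_⟩
  exact differentiableWithinAt_pi.2 fun i => ((mdifferentiableAt_iff _ _).1 (h i)).2

variable {G : Type*} [NormedAddCommGroup G] [NormedSpace ℝ G] [FiniteDimensional ℝ G]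

theorem contMDiffOn_of_dual {n : ℕ∞ω} {s : Set M} {f : M → G}
    (h : ∀ l : Module.Dual ℝ G, ContMDiffOn 𝓘(ℝ, E) 𝓘(ℝ, ℝ) n (fun y => l (f y)) s) :
    ContMDiffOn 𝓘(ℝ, E) 𝓘(ℝ, G) n f s := by
  let b := Module.finBasis ℝ G
  have h1 := contMDiffOn_linearMap_comp b.equivFun.symm.toLinearMap
    (contMDiffOn_pi_space.2 fun i => h (b.coord i))
  refine h1.congr fun y _ => ?_
  exact (b.equivFun.symm_apply_apply (f y)).symm

variable {V : Type*} [AddCommGroup V] [Module ℝ V] [FiniteDimensional ℝ V]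

theorem mdifferentiableAt_linearMap {x : M} {f : M → V →ₗ[ℝ] G}
    (h : ∀ v, MDifferentiableAt 𝓘(ℝ, E) 𝓘(ℝ, G) (fun y => f y v) x) :
    MDifferentiableAt 𝓘(ℝ, E) 𝓘(ℝ, V →ₗ[ℝ] G) f x := by
  let b := Module.finBasis ℝ V
  have h1 := mdifferentiableAt_linearMap_comp (b.constr ℝ (M' := G)).toLinearMap
    (mdifferentiableAt_pi fun i => h (b i))
  refine h1.congr_of_eventuallyEq (Filter.Eventually.of_forall fun y => ?_)
  exact (b.constr_self ℝ (f y)).symm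

theorem mdifferentiableAt_linearMap_apply {x : M} {f : M → V →ₗ[ℝ] G}
    (h : MDifferentiableAt 𝓘(ℝ, E) 𝓘(ℝ, V →ₗ[ℝ] G) f x) (v : V) :
    MDifferentiableAt 𝓘(ℝ, E) 𝓘(ℝ, G) (fun y => f y v) x :=
  mdifferentiableAt_linearMap_comp (LinearMap.applyₗ (R := ℝ) (M₂ := G) v) h

theorem mvfderiv_linearMap_apply {x : M} {f : M → V →ₗ[ℝ] G}
    (h : MDifferentiableAt 𝓘(ℝ, E) 𝓘(ℝ, V →ₗ[ℝ] G) f x) (v : V) (w : TangentSpace 𝓘(ℝ, E) x) :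
    mvfderiv 𝓘(ℝ, E) (fun y => f y v) x w = mvfderiv 𝓘(ℝ, E) f x w v :=
  mvfderiv_linearMap_comp (LinearMap.applyₗ (R := ℝ) (M₂ := G) v) h w

theorem mdifferentiableAt_mvfderiv_sum {ι : Type*} {s : Finset ι} {x : M} {f : ι → M → F}
    (h : ∀ i ∈ s, MDifferentiableAt 𝓘(ℝ, E) 𝓘(ℝ, F) (f i) x) :
    MDifferentiableAt 𝓘(ℝ, E) 𝓘(ℝ, F) (fun y => ∑ i ∈ s, f i y) x ∧
      ∀ w, mvfderiv 𝓘(ℝ, E) (fun y => ∑ i ∈ s, f i y) x w =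
        ∑ i ∈ s, mvfderiv 𝓘(ℝ, E) (f i) x w := by
  classical
  induction s using Finset.induction_on with
  | empty =>
    simp only [Finset.sum_empty]
    refine ⟨mdifferentiableAt_const, fun w => ?_⟩
    rw [mvfderiv_const]
    rfl
  | insert a s ha ih =>
    obtain ⟨h1, h2⟩ := ih fun i hi => h i (Finset.mem_insert_of_mem hi)
    have h3 := h a (Finset.mem_insert_self a s)
    simp only [Finset.sum_insert ha]
    refine ⟨h3.add h1, fun w => ?_⟩
    rw [← h2]
    exact congrArg (fun T => T w) (mvfderiv_add h3 h1)

end Components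

/-! ### The derivative of a pull-back of double forms -/

section PullbackDeriv

variable {E : Type*} [NormedAddCommGroup E] [NormedSpace ℝ E]
  {M : Type*} [TopologicalSpace M] [ChartedSpace E M]
  {V W : Type*} [NormedAddCommGroup V] [InnerProductSpace ℝ V] [FiniteDimensional ℝ V]
  [NormedAddCommGroup W] [InnerProductSpace ℝ W] [FiniteDimensional ℝ W]

/-- `A` is the logarithmic derivative of `G`. Pull-back is multiplicative, so its derivative obeys
the Leibniz rule and is determined by `α ↦ α ∘ A` on covectors. -/
theorem mdifferentiableAt_mvfderiv_map_dualMap {x : M} {G : M → V →ₗ[ℝ] W}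
    (hG : MDifferentiableAt 𝓘(ℝ, E) 𝓘(ℝ, V →ₗ[ℝ] W) G x) (w : TangentSpace 𝓘(ℝ, E) x)
    {A : Module.End ℝ W} (hA : A ∘ₗ G x = mvfderiv 𝓘(ℝ, E) G x w) (θ : Forms W) :
    MDifferentiableAt 𝓘(ℝ, E) 𝓘(ℝ, Forms V) (fun y => ExteriorAlgebra.map (G y).dualMap θ) x ∧
      mvfderiv 𝓘(ℝ, E) (fun y => ExteriorAlgebra.map (G y).dualMap θ) x w =
        ExteriorAlgebra.map (G x).dualMap (extDer A θ) := by
  induction θ using forms_induction with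
  | algebraMap r =>
    simp only [AlgHom.commutes]
    refine ⟨mdifferentiableAt_const, ?_⟩
    rw [mvfderiv_const, extDer_algebraMap, map_zero]
    rfl
  | add a b ha hb =>
    simp only [map_add]
    refine ⟨ha.1.add hb.1, ?_⟩
    rw [← ha.2, ← hb.2]
    exact congrArg (fun T => T w) (mvfderiv_add ha.1 hb.1)
  | ι_mul α θ h =>
    let L : (V →ₗ[ℝ] W) →ₗ[ℝ] Forms V :=
      ExteriorAlgebra.ι ℝ ∘ₗ LinearMap.compRight ℝ (M := V) (α : W →ₗ[ℝ] ℝ)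
    have hB := mdifferentiableAt_mvfderiv_bilinear (LinearMap.mul ℝ (Forms V))
      (mdifferentiableAt_linearMap_comp L hG) h.1
    have hf (y : M) : ExteriorAlgebra.map (G y).dualMap (ExteriorAlgebra.ι ℝ α * θ) =
        LinearMap.mul ℝ (Forms V) (L (G y)) (ExteriorAlgebra.map (G y).dualMap θ) := by
      rw [map_mul, ExteriorAlgebra.map_apply_ι]
      rfl
    simp only [hf]
    refine ⟨hB.1, ?_⟩
    rw [hB.2, mvfderiv_linearMap_comp L hG, h.2, extDer_ι_mul, ← hA, map_add, map_mul, map_mul,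
      ExteriorAlgebra.map_apply_ι, ExteriorAlgebra.map_apply_ι]
    rfl

theorem mdifferentiableAt_mvfderiv_pullback_const {x : M} {G : M → V →ₗ[ℝ] W}
    (hG : MDifferentiableAt 𝓘(ℝ, E) 𝓘(ℝ, V →ₗ[ℝ] W) G x) (w : TangentSpace 𝓘(ℝ, E) x)
    {A : Module.End ℝ W} (hA : A ∘ₗ G x = mvfderiv 𝓘(ℝ, E) G x w) (θ : DoubleForms W) :
    MDifferentiableAt 𝓘(ℝ, E) 𝓘(ℝ, DoubleForms V) (fun y => pullback (G y) θ) x ∧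
      mvfderiv 𝓘(ℝ, E) (fun y => pullback (G y) θ) x w = pullback (G x) (dfDer A θ) := by
  induction θ using TensorProduct.induction_on with
  | zero =>
    simp only [map_zero]
    refine ⟨mdifferentiableAt_const, ?_⟩
    rw [mvfderiv_const]
    rfl
  | add a b ha hb =>
    simp only [map_add]
    refine ⟨ha.1.add hb.1, ?_⟩
    rw [← ha.2, ← hb.2]
    exact congrArg (fun T => T w) (mvfderiv_add ha.1 hb.1)
  | tmul a b =>
    have ha := mdifferentiableAt_mvfderiv_map_dualMap hG w hA a
    have hb := mdifferentiableAt_mvfderiv_map_dualMap hG w hA b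
    have hB := mdifferentiableAt_mvfderiv_bilinear (TensorProduct.mk ℝ (Forms V) (Forms V))
      ha.1 hb.1
    refine ⟨hB.1, (hB.2 w).trans ?_⟩
    rw [ha.2, hb.2, dfDer_tmul, map_add, pullback_tmul, pullback_tmul]
    rfl

theorem mdifferentiableAt_mvfderiv_pullback {x : M} {G : M → V →ₗ[ℝ] W}
    (hG : MDifferentiableAt 𝓘(ℝ, E) 𝓘(ℝ, V →ₗ[ℝ] W) G x) {f : M → DoubleForms W}
    (hf : MDifferentiableAt 𝓘(ℝ, E) 𝓘(ℝ, DoubleForms W) f x) (w : TangentSpace 𝓘(ℝ, E) x)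
    {A : Module.End ℝ W} (hA : A ∘ₗ G x = mvfderiv 𝓘(ℝ, E) G x w) :
    MDifferentiableAt 𝓘(ℝ, E) 𝓘(ℝ, DoubleForms V) (fun y => pullback (G y) (f y)) x ∧
      mvfderiv 𝓘(ℝ, E) (fun y => pullback (G y) (f y)) x w =
        pullback (G x) (mvfderiv 𝓘(ℝ, E) f x w + dfDer A (f x)) := by
  have h1 : MDifferentiableAt 𝓘(ℝ, E) 𝓘(ℝ, DoubleForms W →ₗ[ℝ] DoubleForms V)
      (fun y => pullback (G y)) x :=
    mdifferentiableAt_linearMap fun θ => (mdifferentiableAt_mvfderiv_pullback_const hG w hA θ).1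
  have h2 := mdifferentiableAt_mvfderiv_bilinear LinearMap.id h1 hf
  refine ⟨h2.1, (h2.2 w).trans ?_⟩
  rw [map_add, add_comm, ← (mdifferentiableAt_mvfderiv_pullback_const hG w hA (f x)).2,
    mvfderiv_linearMap_apply h1]
  rfl

end PullbackDeriv

/-! ### The connection in the frame of a chart -/

section Frame

variable {E : Type*} [NormedAddCommGroup E] [NormedSpace ℝ E]
  {M : Type*} [TopologicalSpace M] [ChartedSpace E M] [IsManifold 𝓘(ℝ, E) ∞ M]

theorem transportInv_eq {x y : M} (hy : y ∈ chartDomain (E := E) x) (v : TangentSpace 𝓘(ℝ, E) y) :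
    transportInv x y v = ((trivializationAt E (TangentSpace 𝓘(ℝ, E)) x).symmL ℝ x).toLinearMap
      (trivializationAt E (TangentSpace 𝓘(ℝ, E)) x ⟨y, v⟩).2 :=
  congrArg ((trivializationAt E (TangentSpace 𝓘(ℝ, E)) x).symmL ℝ x)
    (congrFun (Bundle.Trivialization.coe_linearMapAt_of_mem (R := ℝ) _ hy) v)

variable (nabla : CovariantDerivative 𝓘(ℝ, E) E (TangentSpace 𝓘(ℝ, E) : M → Type _))

theorem nabla_sum {ι : Type*} (s : Finset ι) {Z : ι → ∀ x : M, TangentSpace 𝓘(ℝ, E) x} {y : M}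
    (hZ : ∀ i ∈ s, MDifferentiableAt 𝓘(ℝ, E) (𝓘(ℝ, E).prod 𝓘(ℝ, E)) (T% (Z i)) y) :
    nabla (fun z => ∑ i ∈ s, Z i z) y = ∑ i ∈ s, nabla (Z i) y := by
  classical
  induction s using Finset.induction_on with
  | empty =>
    simp only [Finset.sum_empty]
    exact congrFun nabla.zero y
  | insert a s ha ih =>
    simp only [Finset.sum_insert ha]
    have h1 := fun i hi => hZ i (Finset.mem_insert_of_mem hi)
    have h2 := hZ a (Finset.mem_insert_self a s)
    rw [← ih h1]
    exact nabla.isCovariantDerivativeOnUniv.add h2 (MDifferentiableAt.sum_section h1)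

variable [FiniteDimensional ℝ E]

theorem transportInv_extend {x y : M} (hy : y ∈ chartDomain (E := E) x)
    (c : TangentSpace 𝓘(ℝ, E) x) : transportInv x y (FiberBundle.extend E c y) = c := by
  rw [← transport_apply x y c hy, transportInv_transport hy]

variable [RiemannianBundle (fun x : M => TangentSpace 𝓘(ℝ, E) x)]

/-- The connection matrix `A_u c = ∇_u c` of `∇` at `y`, in the frame of the preferred chart at
`x`, as a function of `u` and `c`. -/
def conn (x y : M) :
    TangentSpace 𝓘(ℝ, E) x →ₗ[ℝ] TangentSpace 𝓘(ℝ, E) x →ₗ[ℝ] TangentSpace 𝓘(ℝ, E) x :=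
  (∑ i, (innerₗ _ (onb (TangentSpace 𝓘(ℝ, E) x) i)).smulRight
    (transportInv x y ∘ₗ (nabla (FiberBundle.extend E (onb (TangentSpace 𝓘(ℝ, E) x) i)) y).toLinearMap
      ∘ₗ transport x y)).flip

theorem conn_apply (x y : M) (u c : TangentSpace 𝓘(ℝ, E) x) :
    conn nabla x y u c = ∑ i, inner ℝ (onb (TangentSpace 𝓘(ℝ, E) x) i) c •
      transportInv x y (nabla (FiberBundle.extend E (onb (TangentSpace 𝓘(ℝ, E) x) i)) y
        (transport x y u)) := by
  simp [conn, LinearMap.sum_apply]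

theorem mdifferentiableAt_transportInv {x y : M} (hy : y ∈ chartDomain (E := E) x)
    {Z : ∀ x : M, TangentSpace 𝓘(ℝ, E) x}
    (hZ : MDifferentiableAt 𝓘(ℝ, E) (𝓘(ℝ, E).prod 𝓘(ℝ, E)) (T% Z) y) :
    MDifferentiableAt 𝓘(ℝ, E) 𝓘(ℝ, TangentSpace 𝓘(ℝ, E) x) (fun z => transportInv x z (Z z)) y := by
  have h1 := (Trivialization.mdifferentiableAt_section_iff 𝓘(ℝ, E)
    (trivializationAt E (TangentSpace 𝓘(ℝ, E)) x) Z hy).1 hZ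
  have h2 := mdifferentiableAt_linearMap_comp (F₃ := TangentSpace 𝓘(ℝ, E) x)
    ((trivializationAt E (TangentSpace 𝓘(ℝ, E)) x).symmL ℝ x).toLinearMap h1
  refine h2.congr_of_eventuallyEq ?_
  filter_upwards [chartDomain_mem_nhds hy] with z hz
  exact transportInv_eq hz _

theorem contMDiffOn_transportInv {x : M} {Z : ∀ x : M, TangentSpace 𝓘(ℝ, E) x}
    (hZ : ContMDiffOn 𝓘(ℝ, E) (𝓘(ℝ, E).prod 𝓘(ℝ, E)) ∞ (T% Z) (chartDomain (E := E) x)) :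
    ContMDiffOn 𝓘(ℝ, E) 𝓘(ℝ, TangentSpace 𝓘(ℝ, E) x) ∞ (fun z => transportInv x z (Z z))
      (chartDomain (E := E) x) := by
  have h1 := (Trivialization.contMDiffOn_section_baseSet_iff
    (trivializationAt E (TangentSpace 𝓘(ℝ, E)) x)).1 hZ
  have h2 := contMDiffOn_linearMap_comp (F₃ := TangentSpace 𝓘(ℝ, E) x)
    ((trivializationAt E (TangentSpace 𝓘(ℝ, E)) x).symmL ℝ x).toLinearMap h1
  exact h2.congr fun z hz => transportInv_eq hz _

/-- Near `y` the field is expanded in the coordinate frame, and the Leibniz rule for `nabla`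
separates the derivative of the coefficients from that of the frame. -/
theorem transportInv_nabla {x y : M} (hy : y ∈ chartDomain (E := E) x)
    {Z : ∀ x : M, TangentSpace 𝓘(ℝ, E) x}
    (hZ : MDifferentiableAt 𝓘(ℝ, E) (𝓘(ℝ, E).prod 𝓘(ℝ, E)) (T% Z) y)
    (u : TangentSpace 𝓘(ℝ, E) x) :
    transportInv x y (nabla Z y (transport x y u)) =
      mvfderiv 𝓘(ℝ, E) (fun z => transportInv x z (Z z)) y (transport x y u) +
        conn nabla x y u (transportInv x y (Z y)) := by
  set b := onb (TangentSpace 𝓘(ℝ, E) x) with hb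
  have hZ' := mdifferentiableAt_transportInv hy hZ
  let g (i) (z : M) : ℝ := innerₗ _ (b i) (transportInv x z (Z z))
  have hg i : MDifferentiableAt 𝓘(ℝ, E) 𝓘(ℝ, ℝ) (g i) y :=
    mdifferentiableAt_linearMap_comp (innerₗ _ (b i)) hZ'
  have hext i := mdifferentiableAt_extend' hy (b i)
  have hsm i : MDifferentiableAt 𝓘(ℝ, E) (𝓘(ℝ, E).prod 𝓘(ℝ, E))
      (T% (g i • FiberBundle.extend E (b i))) y := (hg i).smul_section (hext i)
  have heq : nabla Z y = nabla (fun z => ∑ i, (g i • FiberBundle.extend E (b i)) z) y := by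
    refine nabla.isCovariantDerivativeOnUniv.congr_of_eventuallyEq hZ
      (MDifferentiableAt.sum_section fun i _ => hsm i) Filter.univ_mem ?_
    filter_upwards [chartDomain_mem_nhds hy] with z hz
    have h1 : ∑ i, (g i • FiberBundle.extend E (b i)) z =
        transport x z (∑ i, inner ℝ (b i) (transportInv x z (Z z)) • b i) := by
      rw [map_sum]
      refine Finset.sum_congr rfl fun i _ => ?_
      rw [map_smul, transport_apply x z (b i) hz]
      rfl
    rw [h1, b.sum_repr', transport_transportInv hz]
  have hlei i : nabla (g i • FiberBundle.extend E (b i)) y = g i y •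
      nabla (FiberBundle.extend E (b i)) y + (mvfderiv 𝓘(ℝ, E) (g i) y).smulRight
        (FiberBundle.extend E (b i) y) :=
    nabla.isCovariantDerivativeOnUniv.leibniz (hext i) (hg i)
  rw [heq, nabla_sum nabla _ fun i _ => hsm i, sum_apply, map_sum, conn_apply,
    ← b.sum_repr' (mvfderiv 𝓘(ℝ, E) (fun z => transportInv x z (Z z)) y (transport x y u)),
    ← Finset.sum_add_distrib]
  refine Finset.sum_congr rfl fun i _ => ?_
  rw [hlei, add_apply, map_add, add_comm, smul_apply,
    map_smul, ContinuousLinearMap.smulRight_apply, map_smul, ← transport_apply x y (b i) hy,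
    transportInv_transport hy, mvfderiv_linearMap_comp (innerₗ _ (b i)) hZ']
  rfl

theorem transportInv_nabla_extend {x y : M} (hy : y ∈ chartDomain (E := E) x)
    (u c : TangentSpace 𝓘(ℝ, E) x) :
    transportInv x y (nabla (FiberBundle.extend E c) y (transport x y u)) =
      conn nabla x y u c := by
  rw [transportInv_nabla nabla hy (mdifferentiableAt_extend' hy c), transportInv_extend hy]
  have h : (fun z => transportInv x z (FiberBundle.extend E c z)) =ᶠ[nhds y] fun _ => c := by
    filter_upwards [chartDomain_mem_nhds hy] with z hz
    exact transportInv_extend hz c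
  rw [mvfderiv_congr h, mvfderiv_const]
  exact zero_add _

theorem nabla_extend {x y : M} (hy : y ∈ chartDomain (E := E) x)
    (u c : TangentSpace 𝓘(ℝ, E) x) :
    nabla (FiberBundle.extend E c) y (transport x y u) = transport x y (conn nabla x y u c) := by
  rw [← transportInv_nabla_extend nabla hy, transport_transportInv hy]

theorem nabla_extend_self (x : M) (u c : TangentSpace 𝓘(ℝ, E) x) :
    nabla (FiberBundle.extend E c) x u = conn nabla x x u c := by
  have h := nabla_extend nabla (mem_chartDomain_self x) u c
  rwa [transport_self, transport_self] at h

variable {nabla}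

theorem contMDiffOn_conn_apply (hnabla : IsLeviCivita nabla) (x : M)
    (u c : TangentSpace 𝓘(ℝ, E) x) :
    ContMDiffOn 𝓘(ℝ, E) 𝓘(ℝ, TangentSpace 𝓘(ℝ, E) x) ∞ (fun y => conn nabla x y u c)
      (chartDomain (E := E) x) := by
  have h1 := (hnabla.smooth _ (isOpen_chartDomain x)).contMDiff (σ := FiberBundle.extend E c)
    (contMDiffOn_extend x c)
  have h2 := ContMDiffOn.clm_bundle_apply h1 (contMDiffOn_extend x u)
  refine (contMDiffOn_transportInv h2).congr fun y hy => ?_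
  rw [← transportInv_nabla_extend nabla hy, transport_apply x y u hy]

theorem mdifferentiableAt_conn (hnabla : IsLeviCivita nabla) {x y : M}
    (hy : y ∈ chartDomain (E := E) x) :
    MDifferentiableAt 𝓘(ℝ, E) 𝓘(ℝ, TangentSpace 𝓘(ℝ, E) x →ₗ[ℝ] TangentSpace 𝓘(ℝ, E) x →ₗ[ℝ]
      TangentSpace 𝓘(ℝ, E) x) (conn nabla x) y :=
  mdifferentiableAt_linearMap fun u => mdifferentiableAt_linearMap fun c =>
    ((contMDiffOn_conn_apply hnabla x u c).contMDiffAt (chartDomain_mem_nhds hy)).mdifferentiableAt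
      (by simp)

/-- Coordinate fields have zero bracket, so vanishing torsion says exactly that the Christoffel
symbols are symmetric. -/
theorem conn_symm (hnabla : IsLeviCivita nabla) {x y : M} (hy : y ∈ chartDomain (E := E) x)
    (u v : TangentSpace 𝓘(ℝ, E) x) : conn nabla x y u v = conn nabla x y v u := by
  have h := nabla.torsion_eq_zero_iff.1 hnabla.torsion (mdifferentiableAt_extend' hy u)
    (mdifferentiableAt_extend' hy v)
  rw [mlieBracket_extend hy, sub_eq_zero, ← transport_apply x y u hy, ← transport_apply x y v hy] at h
  rw [← transportInv_nabla_extend nabla hy, h, transportInv_nabla_extend nabla hy]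

theorem coordDeriv_inner (hnabla : IsLeviCivita nabla) {x y : M} (hy : y ∈ chartDomain (E := E) x)
    (u z w : TangentSpace 𝓘(ℝ, E) x) :
    coordDeriv x u (fun y => inner ℝ (transport x y z) (transport x y w)) y =
      inner ℝ (transport x y (conn nabla x y u z)) (transport x y w) +
        inner ℝ (transport x y z) (transport x y (conn nabla x y u w)) := by
  have h := hnabla.metric _ _ y (transport x y u) (mdifferentiableAt_extend' hy z)
    (mdifferentiableAt_extend' hy w)
  rw [nabla_extend nabla hy, nabla_extend nabla hy, ← transport_apply x y z hy,
    ← transport_apply x y w hy] at h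
  rw [coordDeriv, ← h]
  refine congrArg (fun T : TangentSpace 𝓘(ℝ, E) y →L[ℝ] ℝ => T (transport x y u))
    (mvfderiv_congr ?_)
  filter_upwards [chartDomain_mem_nhds hy] with z' hz'
  rw [transport_apply x z' z hz', transport_apply x z' w hz']

variable [IsContMDiffRiemannianBundle 𝓘(ℝ, E) ∞ E (fun x : M => TangentSpace 𝓘(ℝ, E) x)]

theorem contMDiffOn_inner_transport (x : M) (z w : TangentSpace 𝓘(ℝ, E) x) :
    ContMDiffOn 𝓘(ℝ, E) 𝓘(ℝ, ℝ) ∞ (fun y => inner ℝ (transport x y z) (transport x y w))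
      (chartDomain (E := E) x) := by
  have h := ContMDiffOn.inner_bundle (E := fun x : M => TangentSpace 𝓘(ℝ, E) x)
    (contMDiffOn_extend x z) (contMDiffOn_extend x w)
  refine h.congr fun y hy => ?_
  rw [transport_apply x y z hy, transport_apply x y w hy]

end Frame

/-! ### Covariant derivatives of double forms in the frame of a chart -/

section CovFrame

variable {E : Type*} [NormedAddCommGroup E] [NormedSpace ℝ E]
  {M : Type*} [TopologicalSpace M] [ChartedSpace E M] [IsManifold 𝓘(ℝ, E) ∞ M]

/-- A double form in the frame of the preferred chart at `x`. -/
def localForm (η : ∀ x : M, DoubleForms (TangentSpace 𝓘(ℝ, E) x)) (x y : M) :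
    DoubleForms (TangentSpace 𝓘(ℝ, E) x) :=
  pullback (transport x y) (η y)

theorem localForm_self (η : ∀ x : M, DoubleForms (TangentSpace 𝓘(ℝ, E) x)) (x : M) :
    localForm η x x = η x := by
  rw [localForm, transport_self_eq_id, pullback_id]

variable [FiniteDimensional ℝ E]

theorem IsSmoothDoubleForm.contMDiffOn_localForm {p q : ℕ}
    {η : ∀ x : M, DoubleForms (TangentSpace 𝓘(ℝ, E) x)} (hη : IsSmoothDoubleForm p q η) (x : M) :
    ContMDiffOn 𝓘(ℝ, E) 𝓘(ℝ, DoubleForms (TangentSpace 𝓘(ℝ, E) x)) ∞ (localForm η x)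
      (chartDomain (E := E) x) :=
  contMDiffOn_of_dual (hη.smooth x)

theorem IsSmoothDoubleForm.mdifferentiableAt_localForm {p q : ℕ}
    {η : ∀ x : M, DoubleForms (TangentSpace 𝓘(ℝ, E) x)} (hη : IsSmoothDoubleForm p q η) {x y : M}
    (hy : y ∈ chartDomain (E := E) x) :
    MDifferentiableAt 𝓘(ℝ, E) 𝓘(ℝ, DoubleForms (TangentSpace 𝓘(ℝ, E) x)) (localForm η x) y :=
  ((hη.contMDiffOn_localForm x).contMDiffAt (chartDomain_mem_nhds hy)).mdifferentiableAt (by simp)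

variable [RiemannianBundle (fun x : M => TangentSpace 𝓘(ℝ, E) x)]

variable (nabla : CovariantDerivative 𝓘(ℝ, E) E (TangentSpace 𝓘(ℝ, E) : M → Type _))

theorem cov_eq {η : ∀ x : M, DoubleForms (TangentSpace 𝓘(ℝ, E) x)} {x : M}
    (hη : MDifferentiableAt 𝓘(ℝ, E) 𝓘(ℝ, DoubleForms (TangentSpace 𝓘(ℝ, E) x)) (localForm η x) x)
    (v : TangentSpace 𝓘(ℝ, E) x) :
    cov nabla η x v =
      mvfderiv 𝓘(ℝ, E) (localForm η x) x v - dfDer (conn nabla x x v) (η x) := by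
  rw [cov, dfDer_eq_sum]
  congr 1
  · rw [← (dfBasis (TangentSpace 𝓘(ℝ, E) x)).sum_repr (mvfderiv 𝓘(ℝ, E) (localForm η x) x v)]
    refine Finset.sum_congr rfl fun a _ => ?_
    congr 1
    exact mvfderiv_linearMap_comp ((dfBasis (TangentSpace 𝓘(ℝ, E) x)).coord a) hη v
  · simp only [nabla_extend_self]

/-- The covariant derivative `v ↦ ∇_v η` as a linear map. -/
def covₗ (η : ∀ x : M, DoubleForms (TangentSpace 𝓘(ℝ, E) x)) (x : M) :
    TangentSpace 𝓘(ℝ, E) x →ₗ[ℝ] DoubleForms (TangentSpace 𝓘(ℝ, E) x) where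
  toFun := cov nabla η x
  map_add' u v := by
    simp only [cov, map_add, add_smul, Finset.sum_add_distrib, ← insertLeftₗ_apply,
      ← insertRightₗ_apply, LinearMap.add_apply, mul_add]
    abel
  map_smul' r v := by
    simp only [cov, map_smul, smul_eq_mul, mul_smul, ← insertLeftₗ_apply,
      ← insertRightₗ_apply, LinearMap.smul_apply, mul_smul_comm, RingHom.id_apply, smul_sub,
      Finset.smul_sum, smul_add]

@[simp]
theorem covₗ_apply (η : ∀ x : M, DoubleForms (TangentSpace 𝓘(ℝ, E) x)) (x : M)
    (v : TangentSpace 𝓘(ℝ, E) x) : covₗ nabla η x v = cov nabla η x v := rfl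

/-- The covariant derivative of a double form in the frame of the preferred chart at `x`. -/
def localCov (η : ∀ x : M, DoubleForms (TangentSpace 𝓘(ℝ, E) x)) (x y : M) :
    TangentSpace 𝓘(ℝ, E) x →ₗ[ℝ] DoubleForms (TangentSpace 𝓘(ℝ, E) x) :=
  pullback (transport x y) ∘ₗ covₗ nabla η y ∘ₗ transport x y

theorem localCov_apply (η : ∀ x : M, DoubleForms (TangentSpace 𝓘(ℝ, E) x)) (x y : M)
    (u : TangentSpace 𝓘(ℝ, E) x) :
    localCov nabla η x y u = pullback (transport x y) (cov nabla η y (transport x y u)) := rfl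

theorem localCov_self (η : ∀ x : M, DoubleForms (TangentSpace 𝓘(ℝ, E) x)) (x : M)
    (u : TangentSpace 𝓘(ℝ, E) x) : localCov nabla η x x u = cov nabla η x u := by
  rw [localCov_apply, transport_self, transport_self_eq_id, pullback_id]

set_option maxHeartbeats 1000000 in
-- `cov` at `y` is defined in the chart at `y`, while second derivatives at `x` need it near `x` in
-- one fixed frame. The content is the independence of the covariant derivative from the chart.
theorem localCov_eq {p q : ℕ} {η : ∀ x : M, DoubleForms (TangentSpace 𝓘(ℝ, E) x)}
    (hη : IsSmoothDoubleForm p q η) {x y : M} (hy : y ∈ chartDomain (E := E) x)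
    (u : TangentSpace 𝓘(ℝ, E) x) :
    localCov nabla η x y u =
      coordDeriv x u (localForm η x) y - dfDer (conn nabla x y u) (localForm η x y) := by
  have hyy := mem_chartDomain_self (E := E) y
  let w := transport x y u
  -- The transition map from the frame of the chart at `x` to that of the chart at `y`.
  let G (z : M) : TangentSpace 𝓘(ℝ, E) x →ₗ[ℝ] TangentSpace 𝓘(ℝ, E) y :=
    transportInv y z ∘ₗ transport x z
  have hGc (c : TangentSpace 𝓘(ℝ, E) x) : (fun z => G z c) =ᶠ[nhds y]
      fun z => transportInv y z (FiberBundle.extend E c z) := by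
    filter_upwards [chartDomain_mem_nhds hy] with z hz
    rw [← transport_apply x z c hz]
    rfl
  have hG : MDifferentiableAt 𝓘(ℝ, E)
      𝓘(ℝ, TangentSpace 𝓘(ℝ, E) x →ₗ[ℝ] TangentSpace 𝓘(ℝ, E) y) G y :=
    mdifferentiableAt_linearMap fun c => (mdifferentiableAt_transportInv hyy
      (mdifferentiableAt_extend' hy c)).congr_of_eventuallyEq (hGc c)
  have hGy : G y = transport x y := LinearMap.ext fun c => transportInv_self y (transport x y c)
  let A : Module.End ℝ (TangentSpace 𝓘(ℝ, E) y) := mvfderiv 𝓘(ℝ, E) G y w ∘ₗ transportInv x y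
  have hA : A ∘ₗ G y = mvfderiv 𝓘(ℝ, E) G y w := by
    rw [hGy]
    exact LinearMap.ext fun c =>
      congrArg (mvfderiv 𝓘(ℝ, E) G y w) (transportInv_transport hy c)
  have hloc : localForm η x =ᶠ[nhds y] fun z => pullback (G z) (localForm η y z) := by
    filter_upwards [chartDomain_mem_nhds hyy] with z hz
    have hL : transport y z ∘ₗ G z = transport x z :=
      LinearMap.ext fun c => transport_transportInv hz (transport x z c)
    rw [localForm, localForm, pullback_pullback, hL]
  have hd := (mdifferentiableAt_mvfderiv_pullback hG (hη.mdifferentiableAt_localForm hyy) w hA).2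
  -- The transformation law of connection matrices: the inhomogeneous term is the logarithmic
  -- derivative `A` of the transition map, which also appears when the pulled-back form is
  -- differentiated.
  have hconn : (conn nabla y y w + A) ∘ₗ transport x y = transport x y ∘ₗ conn nabla x y u := by
    refine LinearMap.ext fun c => ?_
    have h1 := transportInv_nabla nabla hyy (mdifferentiableAt_extend' hy c) w
    rw [transportInv_self, transportInv_self, transport_self, nabla_extend nabla hy,
      ← mvfderiv_congr (hGc c), mvfderiv_linearMap_apply hG, ← transport_apply x y c hy] at h1
    have h2 : A (transport x y c) = mvfderiv 𝓘(ℝ, E) G y w c :=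
      congrArg (mvfderiv 𝓘(ℝ, E) G y w) (transportInv_transport hy c)
    rw [LinearMap.comp_apply, LinearMap.comp_apply, LinearMap.add_apply, h1, h2, add_comm]
  rw [localCov_apply, cov_eq nabla (hη.mdifferentiableAt_localForm hyy), coordDeriv,
    mvfderiv_congr hloc, hd, hGy, localForm_self]
  rw [show localForm η x y = pullback (transport x y) (η y) from rfl,
    ← pullback_dfDer _ _ _ hconn, map_add dfDer, LinearMap.add_apply, map_sub, map_add, map_add]
  abel

variable {nabla}

theorem mdifferentiableAt_mvfderiv_dfDer_conn (hnabla : IsLeviCivita nabla) {x : M}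
    {f : M → DoubleForms (TangentSpace 𝓘(ℝ, E) x)}
    (hf : MDifferentiableAt 𝓘(ℝ, E) 𝓘(ℝ, DoubleForms (TangentSpace 𝓘(ℝ, E) x)) f x)
    (v : TangentSpace 𝓘(ℝ, E) x) :
    MDifferentiableAt 𝓘(ℝ, E) 𝓘(ℝ, DoubleForms (TangentSpace 𝓘(ℝ, E) x))
        (fun y => dfDer (conn nabla x y v) (f y)) x ∧
      ∀ u, mvfderiv 𝓘(ℝ, E) (fun y => dfDer (conn nabla x y v) (f y)) x u =
        dfDer (mvfderiv 𝓘(ℝ, E) (conn nabla x) x u v) (f x) +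
          dfDer (conn nabla x x v) (mvfderiv 𝓘(ℝ, E) f x u) := by
  have h1 := mdifferentiableAt_conn hnabla (mem_chartDomain_self (E := E) x)
  have h2 := mdifferentiableAt_mvfderiv_bilinear
    (dfDer : (TangentSpace 𝓘(ℝ, E) x →ₗ[ℝ] TangentSpace 𝓘(ℝ, E) x) →ₗ[ℝ] _)
    (mdifferentiableAt_linearMap_apply h1 v) hf
  refine ⟨h2.1, fun u => (h2.2 u).trans ?_⟩
  rw [mvfderiv_linearMap_apply h1]

theorem mdifferentiableAt_localCov (hnabla : IsLeviCivita nabla) {p q : ℕ}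
    {η : ∀ x : M, DoubleForms (TangentSpace 𝓘(ℝ, E) x)} (hη : IsSmoothDoubleForm p q η) (x : M) :
    MDifferentiableAt 𝓘(ℝ, E) 𝓘(ℝ, TangentSpace 𝓘(ℝ, E) x →ₗ[ℝ]
      DoubleForms (TangentSpace 𝓘(ℝ, E) x)) (localCov nabla η x) x := by
  have hx := mem_chartDomain_self (E := E) x
  refine mdifferentiableAt_linearMap fun v => ?_
  have h1 := ((contMDiffOn_coordDeriv (hη.contMDiffOn_localForm x) v).contMDiffAt
    (chartDomain_mem_nhds hx)).mdifferentiableAt (by simp)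
  have h2 := mdifferentiableAt_mvfderiv_dfDer_conn hnabla (hη.mdifferentiableAt_localForm hx) v
  refine (h1.sub h2.1).congr_of_eventuallyEq ?_
  filter_upwards [chartDomain_mem_nhds hx] with y hy
  exact localCov_eq nabla hη hy v

set_option maxHeartbeats 1000000 in
-- The extension of `v` is constant in the frame at `x`, so `∇_v η` near `x` is `localCov` at the
-- fixed argument `v`; only its value at `x` is acted on by the connection matrix.
theorem secondCov_eq (hnabla : IsLeviCivita nabla) {p q : ℕ}
    {η : ∀ x : M, DoubleForms (TangentSpace 𝓘(ℝ, E) x)} (hη : IsSmoothDoubleForm p q η) (x : M)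
    (u v : TangentSpace 𝓘(ℝ, E) x) :
    secondCov nabla η x u v = mvfderiv 𝓘(ℝ, E) (localCov nabla η x) x u v -
      dfDer (conn nabla x x u) (cov nabla η x v) - cov nabla η x (conn nabla x x u v) := by
  have hx := mem_chartDomain_self (E := E) x
  have hT := mdifferentiableAt_localCov hnabla hη x
  have heq : localForm (fun y => cov nabla η y (FiberBundle.extend E v y)) x =ᶠ[nhds x]
      fun y => localCov nabla η x y v := by
    filter_upwards [chartDomain_mem_nhds hx] with y hy
    rw [localCov_apply, transport_apply x y v hy]
    rfl
  rw [secondCov, cov_eq nabla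
    ((mdifferentiableAt_linearMap_apply hT v).congr_of_eventuallyEq heq), mvfderiv_congr heq,
    mvfderiv_linearMap_apply hT, nabla_extend_self, ← transport_apply x x v hx, transport_self]

end CovFrame

/-! ### Traces in orthonormal bases -/

section Traces

variable {V W : Type*} [NormedAddCommGroup V] [InnerProductSpace ℝ V]

/-- Both sides are the same double sum over matrix entries of `A`. It serves to cancel the adjoint
connection term in the derivative of the divergence. -/
theorem sum_bilin_adjoint {ι : Type*} [Fintype ι] [AddCommGroup W] [Module ℝ W]
    [FiniteDimensional ℝ V] (b : OrthonormalBasis ι ℝ V) (β : V →ₗ[ℝ] V →ₗ[ℝ] W)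
    (A : Module.End ℝ V) :
    ∑ i, β (b i) (LinearMap.adjoint A (b i)) = ∑ i, β (A (b i)) (b i) := by
  have h1 i : β (b i) (LinearMap.adjoint A (b i)) =
      ∑ j, (inner ℝ (A (b j)) (b i) : ℝ) • β (b i) (b j) := by
    conv_lhs => rw [← b.sum_repr' (LinearMap.adjoint A (b i))]
    simp only [map_sum, map_smul, LinearMap.adjoint_inner_right]
  have h2 j : β (A (b j)) (b j) = ∑ i, (inner ℝ (A (b j)) (b i) : ℝ) • β (b i) (b j) := by
    conv_lhs => rw [← b.sum_repr' (A (b j))]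
    simp only [map_sum, map_smul, LinearMap.sum_apply, LinearMap.smul_apply, real_inner_comm]
  simp only [h1, h2]
  exact Finset.sum_comm

theorem sum_bilin_onb_eq {ι κ : Type*} [Fintype ι] [Fintype κ] [AddCommGroup W] [Module ℝ W]
    (b : OrthonormalBasis ι ℝ V) (e : OrthonormalBasis κ ℝ V) (β : V →ₗ[ℝ] V →ₗ[ℝ] W) :
    ∑ i, β (b i) (b i) = ∑ j, β (e j) (e j) := by
  have h1 i : β (b i) (b i) = ∑ j, (inner ℝ (e j) (b i) : ℝ) • β (e j) (b i) := by
    have h : β (b i) (b i) = β (∑ j, (inner ℝ (e j) (b i) : ℝ) • e j) (b i) := by rw [e.sum_repr']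
    rw [h]
    simp only [map_sum, map_smul, LinearMap.sum_apply, LinearMap.smul_apply]
  have h2 j : β (e j) (e j) = ∑ i, (inner ℝ (e j) (b i) : ℝ) • β (e j) (b i) := by
    have h : β (e j) (e j) = β (e j) (∑ i, (inner ℝ (b i) (e j) : ℝ) • b i) := by rw [b.sum_repr']
    rw [h]
    simp only [map_sum, map_smul, real_inner_comm (e j)]
  simp only [h1, h2]
  exact Finset.sum_comm

/-- The canonical element `∑ e^i ⊗ e_i` is independent of the basis and natural in linear maps; this
moves the sum defining `D` from the frame at `y` to the fixed one at `x`. -/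
theorem sum_ι_tmul_mul {ι : Type*} [Fintype ι] [FiniteDimensional ℝ V] [NormedAddCommGroup W]
    [InnerProductSpace ℝ W] (e : OrthonormalBasis ι ℝ W) (L : V →ₗ[ℝ] W)
    (f : W →ₗ[ℝ] DoubleForms V) :
    ∑ i, (ExteriorAlgebra.ι ℝ (innerₗ W (e i) ∘ₗ L) ⊗ₜ[ℝ] 1) * f (e i) =
      ∑ a, flatLeft (onb V a) * f (L (onb V a)) := by
  have h1 i : (ExteriorAlgebra.ι ℝ (innerₗ W (e i) ∘ₗ L) ⊗ₜ[ℝ] 1) * f (e i) =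
      ∑ a, (inner ℝ (e i) (L (onb V a)) : ℝ) • (flatLeft (onb V a) * f (e i)) := by
    rw [← sum_dual_onb_smul_flat, TensorProduct.sum_tmul, Finset.sum_mul]
    simp only [← TensorProduct.smul_tmul', smul_mul_assoc]
    rfl
  have h2 a : flatLeft (onb V a) * f (L (onb V a)) =
      ∑ i, (inner ℝ (e i) (L (onb V a)) : ℝ) • (flatLeft (onb V a) * f (e i)) := by
    conv_lhs => rw [← e.sum_repr' (L (onb V a))]
    simp only [map_sum, map_smul, Finset.mul_sum, mul_smul_comm]
  simp only [h1, h2]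
  exact Finset.sum_comm

theorem sum_flatLeft_mul_dfDer [FiniteDimensional ℝ V] (A : Module.End ℝ V)
    (f : V →ₗ[ℝ] DoubleForms V) :
    dfDer A (∑ a, flatLeft (onb V a) * f (onb V a)) =
      ∑ a, flatLeft (onb V a) * (f (A (onb V a)) + dfDer A (f (onb V a))) := by
  simp only [map_sum, mul_add, Finset.sum_add_distrib]
  rw [← sum_ι_tmul_mul (onb V) A f, ← Finset.sum_add_distrib]
  exact Finset.sum_congr rfl fun a _ => dfDer_ι_tmul_one_mul A _ _

end Traces

/-! ### Differentiating inverses and evaluations of families of linear maps. -/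

section Application

variable {E : Type*} [NormedAddCommGroup E] [NormedSpace ℝ E]
  {M : Type*} [TopologicalSpace M] [ChartedSpace E M]
  {V : Type*} [NormedAddCommGroup V] [NormedSpace ℝ V] [FiniteDimensional ℝ V]

/-- In finite dimension a one-sided inverse is two-sided, and inversion of units is differentiable
in the Banach algebra of endomorphisms. -/
theorem mdifferentiableAt_of_comp_eq_id {x : M} {S P : M → V →ₗ[ℝ] V}
    (hS : MDifferentiableAt 𝓘(ℝ, E) 𝓘(ℝ, V →ₗ[ℝ] V) S x)
    (h : ∀ᶠ y in nhds x, P y ∘ₗ S y = LinearMap.id) :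
    MDifferentiableAt 𝓘(ℝ, E) 𝓘(ℝ, V →ₗ[ℝ] V) P x := by
  have : CompleteSpace V := FiniteDimensional.complete ℝ V
  let T : (V →ₗ[ℝ] V) ≃ₗ[ℝ] (V →L[ℝ] V) := LinearMap.toContinuousLinearMap
  have hu (y : M) (hy : P y ∘ₗ S y = LinearMap.id) :
      ∃ u : (V →L[ℝ] V)ˣ, (u : V →L[ℝ] V) = T (S y) ∧ ((u⁻¹ : (V →L[ℝ] V)ˣ) : V →L[ℝ] V) = T (P y) := by
    have hy' : S y ∘ₗ P y = LinearMap.id := (LinearMap.comp_eq_id_comm ℝ V).1 hy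
    exact ⟨⟨T (S y), T (P y), ContinuousLinearMap.ext fun v => LinearMap.congr_fun hy' v,
      ContinuousLinearMap.ext fun v => LinearMap.congr_fun hy v⟩, rfl, rfl⟩
  obtain ⟨u, hu1, -⟩ := hu x h.self_of_nhds
  have h1 : MDifferentiableAt 𝓘(ℝ, E) 𝓘(ℝ, V →L[ℝ] V) (fun y => T (S y)) x :=
    mdifferentiableAt_linearMap_comp T.toLinearMap hS
  have h2 : DifferentiableAt ℝ (Ring.inverse : (V →L[ℝ] V) → _) (T (S x)) := by
    rw [← hu1]
    exact differentiableAt_inverse u.isUnit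
  have h3 := mdifferentiableAt_linearMap_comp T.symm.toLinearMap (h2.mdifferentiableAt.comp x h1)
  refine h3.congr_of_eventuallyEq ?_
  filter_upwards [h] with y hy
  obtain ⟨u', hu1', hu2'⟩ := hu y hy
  change P y = T.symm (Ring.inverse (T (S y)))
  rw [← hu1', Ring.inverse_unit, hu2', T.symm_apply_apply]

theorem mdifferentiableAt_mvfderiv_apply {W : Type*} [NormedAddCommGroup W] [NormedSpace ℝ W]
    [FiniteDimensional ℝ W] {x : M} {f : M → V →ₗ[ℝ] W} {g : M → V}
    (hf : MDifferentiableAt 𝓘(ℝ, E) 𝓘(ℝ, V →ₗ[ℝ] W) f x)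
    (hg : MDifferentiableAt 𝓘(ℝ, E) 𝓘(ℝ, V) g x) :
    MDifferentiableAt 𝓘(ℝ, E) 𝓘(ℝ, W) (fun y => f y (g y)) x ∧
      ∀ w, mvfderiv 𝓘(ℝ, E) (fun y => f y (g y)) x w =
        mvfderiv 𝓘(ℝ, E) f x w (g x) + f x (mvfderiv 𝓘(ℝ, E) g x w) :=
  mdifferentiableAt_mvfderiv_bilinear (LinearMap.id : (V →ₗ[ℝ] W) →ₗ[ℝ] V →ₗ[ℝ] W) hf hg

end Application

/-! ### The Hodge-de Rham Laplacian in terms of second covariant derivatives -/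

section Laplacian

variable {E : Type*} [NormedAddCommGroup E] [NormedSpace ℝ E] [FiniteDimensional ℝ E]
  {M : Type*} [TopologicalSpace M] [ChartedSpace E M] [IsManifold 𝓘(ℝ, E) ∞ M]
  [RiemannianBundle (fun x : M => TangentSpace 𝓘(ℝ, E) x)]

/-- The metric on covectors at `y`, in the frame of the preferred chart at `x`, as an endomorphism
of `T_x M`. -/
def cometric (x y : M) : Module.End ℝ (TangentSpace 𝓘(ℝ, E) x) :=
  ∑ i, (innerₗ _ (transportInv x y (onb (TangentSpace 𝓘(ℝ, E) y) i))).smulRight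
    (transportInv x y (onb (TangentSpace 𝓘(ℝ, E) y) i))

/-- The metric at `y`, in the frame of the preferred chart at `x`, as an endomorphism of
`T_x M`. -/
def localMetric (x y : M) : Module.End ℝ (TangentSpace 𝓘(ℝ, E) x) :=
  ∑ a, (innerₗ _ (transport x y (onb (TangentSpace 𝓘(ℝ, E) x) a)) ∘ₗ transport x y).smulRight
    (onb (TangentSpace 𝓘(ℝ, E) x) a)

theorem cometric_apply (x y : M) (z : TangentSpace 𝓘(ℝ, E) x) :
    cometric x y z = ∑ i, (inner ℝ (transportInv x y (onb (TangentSpace 𝓘(ℝ, E) y) i)) z : ℝ) •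
      transportInv x y (onb (TangentSpace 𝓘(ℝ, E) y) i) := by
  simp [cometric, LinearMap.sum_apply]

theorem localMetric_apply (x y : M) (z : TangentSpace 𝓘(ℝ, E) x) :
    localMetric x y z = ∑ a, (inner ℝ (transport x y (onb (TangentSpace 𝓘(ℝ, E) x) a))
      (transport x y z) : ℝ) • onb (TangentSpace 𝓘(ℝ, E) x) a := by
  simp [localMetric, LinearMap.sum_apply]

theorem inner_localMetric (x y : M) (w z : TangentSpace 𝓘(ℝ, E) x) :
    (inner ℝ w (localMetric x y z) : ℝ) = inner ℝ (transport x y w) (transport x y z) := by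
  conv_rhs => rw [← (onb (TangentSpace 𝓘(ℝ, E) x)).sum_repr' w]
  simp only [localMetric_apply, inner_sum, map_sum, map_smul, sum_inner, inner_smul_left,
    inner_smul_right, real_inner_comm w, conj_trivial]
  exact Finset.sum_congr rfl fun a _ => mul_comm _ _

theorem cometric_comp_localMetric {x y : M} (hy : y ∈ chartDomain (E := E) x) :
    cometric x y ∘ₗ localMetric (E := E) x y = LinearMap.id := by
  refine LinearMap.ext fun z => ?_
  rw [LinearMap.comp_apply, cometric_apply]
  simp only [inner_localMetric, transport_transportInv hy, ← map_smul, ← map_sum]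
  rw [OrthonormalBasis.sum_repr', transportInv_transport hy]
  rfl

theorem localMetric_self (x : M) : localMetric (E := E) x x = LinearMap.id := by
  refine LinearMap.ext fun z => ?_
  rw [localMetric_apply]
  simp only [transport_self, OrthonormalBasis.sum_repr', LinearMap.id_apply]

theorem cometric_self (x : M) : cometric (E := E) x x = LinearMap.id := by
  have h := cometric_comp_localMetric (mem_chartDomain_self (E := E) x)
  rwa [localMetric_self, LinearMap.comp_id] at h

variable (nabla : CovariantDerivative 𝓘(ℝ, E) E (TangentSpace 𝓘(ℝ, E) : M → Type _))

/-- The orthonormal bases at different `y` are chosen independently; after expansion in the fixed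
basis at `x` they enter only through `cometric`. -/
theorem localForm_div {x y : M} (hy : y ∈ chartDomain (E := E) x)
    (η : ∀ x : M, DoubleForms (TangentSpace 𝓘(ℝ, E) x)) :
    localForm (div nabla η) x y = -∑ a, insertLeft (onb (TangentSpace 𝓘(ℝ, E) x) a)
      (localCov nabla η x y (cometric x y (onb (TangentSpace 𝓘(ℝ, E) x) a))) := by
  set b := onb (TangentSpace 𝓘(ℝ, E) x)
  have h1 i : pullback (transport x y) (insertLeft (onb (TangentSpace 𝓘(ℝ, E) y) i)
      (cov nabla η y (onb (TangentSpace 𝓘(ℝ, E) y) i))) =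
      ∑ a, (inner ℝ (transportInv x y (onb (TangentSpace 𝓘(ℝ, E) y) i)) (b a) : ℝ) •
        insertLeft (b a) (localCov nabla η x y
          (transportInv x y (onb (TangentSpace 𝓘(ℝ, E) y) i))) := by
    set c := transportInv x y (onb (TangentSpace 𝓘(ℝ, E) y) i) with hc
    have h2 : onb (TangentSpace 𝓘(ℝ, E) y) i = transport x y c :=
      (transport_transportInv hy _).symm
    rw [h2, pullback_insertLeft, ← localCov_apply]
    have h3 : insertLeft c = insertLeftₗ _ (∑ a, (inner ℝ (b a) c : ℝ) • b a) := by
      rw [b.sum_repr', insertLeftₗ_apply]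
    rw [h3]
    simp only [map_sum, map_smul, LinearMap.sum_apply, LinearMap.smul_apply, insertLeftₗ_apply,
      real_inner_comm c]
  have h4 a : insertLeft (b a) (localCov nabla η x y (cometric x y (b a))) =
      ∑ i, (inner ℝ (transportInv x y (onb (TangentSpace 𝓘(ℝ, E) y) i)) (b a) : ℝ) •
        insertLeft (b a) (localCov nabla η x y
          (transportInv x y (onb (TangentSpace 𝓘(ℝ, E) y) i))) := by
    rw [cometric_apply]
    simp only [map_sum, map_smul]
  rw [localForm, div, map_neg, map_sum]
  simp only [h1, h4]
  rw [Finset.sum_comm]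

theorem localForm_extD {x y : M} (hy : y ∈ chartDomain (E := E) x)
    (η : ∀ x : M, DoubleForms (TangentSpace 𝓘(ℝ, E) x)) :
    localForm (extD nabla η) x y = ∑ a, flatLeft (onb (TangentSpace 𝓘(ℝ, E) x) a) *
      localCov nabla η x y (onb (TangentSpace 𝓘(ℝ, E) x) a) := by
  have h := sum_ι_tmul_mul (onb (TangentSpace 𝓘(ℝ, E) y)) (transport x y)
    (localCov nabla η x y ∘ₗ transportInv x y)
  simp only [LinearMap.comp_apply, transportInv_transport hy] at h
  rw [← h, localForm, extD, map_sum]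
  refine Finset.sum_congr rfl fun i _ => ?_
  rw [pullback_mul, localCov_apply, transport_transportInv hy]
  congr 1
  rw [flatLeft, pullback_tmul, map_one, flat, ExteriorAlgebra.map_apply_ι]
  rfl

variable {nabla}
set_option maxHeartbeats 1000000 in
-- In the frame at `x` the coframe in `D` is constant. The connection matrix acting on it yields
-- `∇_{A e_a} η` with `A = conn nabla x x v`, which is the term subtracted in the second covariant
-- derivative.
theorem cov_extD (hnabla : IsLeviCivita nabla) {p q : ℕ}
    {η : ∀ x : M, DoubleForms (TangentSpace 𝓘(ℝ, E) x)} (hη : IsSmoothDoubleForm p q η) (x : M)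
    (v : TangentSpace 𝓘(ℝ, E) x) :
    cov nabla (extD nabla η) x v = ∑ a, flatLeft (onb (TangentSpace 𝓘(ℝ, E) x) a) *
      secondCov nabla η x v (onb (TangentSpace 𝓘(ℝ, E) x) a) := by
  have hx := mem_chartDomain_self (E := E) x
  have hT := mdifferentiableAt_localCov hnabla hη x
  have hloc : localForm (extD nabla η) x =ᶠ[nhds x] fun y =>
      ∑ a, LinearMap.mulLeft ℝ (flatLeft (onb (TangentSpace 𝓘(ℝ, E) x) a))
        (localCov nabla η x y (onb (TangentSpace 𝓘(ℝ, E) x) a)) := by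
    filter_upwards [chartDomain_mem_nhds hx] with y hy
    exact localForm_extD nabla hy η
  have hterm a := mdifferentiableAt_linearMap_apply hT (onb (TangentSpace 𝓘(ℝ, E) x) a)
  have hsum := mdifferentiableAt_mvfderiv_sum (s := Finset.univ) fun a _ =>
    mdifferentiableAt_linearMap_comp
      (LinearMap.mulLeft ℝ (flatLeft (onb (TangentSpace 𝓘(ℝ, E) x) a))) (hterm a)
  have hder := sum_flatLeft_mul_dfDer (conn nabla x x v) (covₗ nabla η x)
  rw [cov_eq nabla (hsum.1.congr_of_eventuallyEq hloc), mvfderiv_congr hloc, hsum.2]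
  have hex : extD nabla η x = ∑ a, flatLeft (onb (TangentSpace 𝓘(ℝ, E) x) a) *
      covₗ nabla η x (onb (TangentSpace 𝓘(ℝ, E) x) a) := rfl
  rw [hex, hder, ← Finset.sum_sub_distrib]
  refine Finset.sum_congr rfl fun a _ => ?_
  rw [mvfderiv_linearMap_comp _ (hterm a), mvfderiv_linearMap_apply hT, secondCov_eq hnabla hη,
    LinearMap.mulLeft_apply, ← mul_sub, covₗ_apply, covₗ_apply, sub_sub, add_comm (dfDer _ _)]

variable [IsContMDiffRiemannianBundle 𝓘(ℝ, E) ∞ E (fun x : M => TangentSpace 𝓘(ℝ, E) x)]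

theorem mdifferentiableAt_localMetric (x : M) :
    MDifferentiableAt 𝓘(ℝ, E) 𝓘(ℝ, TangentSpace 𝓘(ℝ, E) x →ₗ[ℝ] TangentSpace 𝓘(ℝ, E) x)
      (localMetric (E := E) x) x := by
  have hx := mem_chartDomain_self (E := E) x
  refine mdifferentiableAt_linearMap fun z => ?_
  have h1 a := mdifferentiableAt_linearMap_comp
    (LinearMap.toSpanSingleton ℝ _ (onb (TangentSpace 𝓘(ℝ, E) x) a))
    (((contMDiffOn_inner_transport x (onb (TangentSpace 𝓘(ℝ, E) x) a) z).contMDiffAt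
      (chartDomain_mem_nhds hx)).mdifferentiableAt (by simp))
  refine (mdifferentiableAt_mvfderiv_sum (s := Finset.univ)
    fun a _ => h1 a).1.congr_of_eventuallyEq (Filter.Eventually.of_forall fun y => ?_)
  exact localMetric_apply x y z

/-- The sum defining `cometric` uses bases chosen without any continuity in `y`; differentiability
comes from its being the inverse of the smooth metric. -/
theorem mdifferentiableAt_cometric (x : M) :
    MDifferentiableAt 𝓘(ℝ, E) 𝓘(ℝ, TangentSpace 𝓘(ℝ, E) x →ₗ[ℝ] TangentSpace 𝓘(ℝ, E) x)
      (cometric (E := E) x) x := by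
  refine mdifferentiableAt_of_comp_eq_id (mdifferentiableAt_localMetric x) ?_
  filter_upwards [chartDomain_mem_nhds (mem_chartDomain_self (E := E) x)] with y hy
  exact cometric_comp_localMetric hy

theorem mvfderiv_localMetric (hnabla : IsLeviCivita nabla) (x : M)
    (v z : TangentSpace 𝓘(ℝ, E) x) :
    mvfderiv 𝓘(ℝ, E) (localMetric (E := E) x) x v z =
      conn nabla x x v z + LinearMap.adjoint (conn nabla x x v) z := by
  have hx := mem_chartDomain_self (E := E) x
  have hS := mdifferentiableAt_localMetric (E := E) x
  refine ext_inner_left ℝ fun w => ?_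
  have h1 : (inner ℝ w (mvfderiv 𝓘(ℝ, E) (localMetric (E := E) x) x v z) : ℝ) =
      mvfderiv 𝓘(ℝ, E) (fun y => innerₗ _ w (localMetric x y z)) x v := by
    rw [mvfderiv_linearMap_comp (innerₗ _ w) (mdifferentiableAt_linearMap_apply hS z),
      mvfderiv_linearMap_apply hS]
    rfl
  have h2 : (fun y => innerₗ _ w (localMetric x y z)) =
      fun y => (inner ℝ (transport x y w) (transport x y z) : ℝ) :=
    funext fun y => inner_localMetric x y w z
  have h3 := coordDeriv_inner hnabla hx v w z
  rw [coordDeriv, transport_self] at h3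
  rw [h1, h2, h3]
  simp only [transport_self, inner_add_right, LinearMap.adjoint_inner_right]
  exact add_comm _ _

/-- Differentiation of `cometric ∘ localMetric = id` at `x`, where both factors are the identity. -/
theorem mvfderiv_cometric (hnabla : IsLeviCivita nabla) (x : M)
    (v z : TangentSpace 𝓘(ℝ, E) x) :
    mvfderiv 𝓘(ℝ, E) (cometric (E := E) x) x v z =
      -(conn nabla x x v z + LinearMap.adjoint (conn nabla x x v) z) := by
  have hS := mdifferentiableAt_localMetric (E := E) x
  have hP := mdifferentiableAt_cometric (E := E) x
  have h1 := (mdifferentiableAt_mvfderiv_apply hP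
    (mdifferentiableAt_linearMap_apply hS z)).2 v
  have h2 : (fun y => cometric x y (localMetric x y z)) =ᶠ[nhds x] fun _ => z := by
    filter_upwards [chartDomain_mem_nhds (mem_chartDomain_self (E := E) x)] with y hy
    exact LinearMap.congr_fun (cometric_comp_localMetric hy) z
  rw [mvfderiv_congr h2, mvfderiv_const, mvfderiv_linearMap_apply hS, mvfderiv_localMetric hnabla,
    cometric_self, localMetric_self] at h1
  exact eq_neg_of_add_eq_zero_left h1.symm

set_option maxHeartbeats 1000000 in
-- With `A = conn nabla x x v`, the derivative of the cometric contributes `A` and its adjoint. The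
-- `A` part is the correction `∇_{A e_a} η` in the second covariant derivative; the adjoint part,
-- transferred by `sum_bilin_adjoint`, cancels the commutator of `i_{e_a}` with `dfDer A`.
theorem cov_div (hnabla : IsLeviCivita nabla) {p q : ℕ}
    {η : ∀ x : M, DoubleForms (TangentSpace 𝓘(ℝ, E) x)} (hη : IsSmoothDoubleForm p q η) (x : M)
    (v : TangentSpace 𝓘(ℝ, E) x) :
    cov nabla (div nabla η) x v = -∑ a, insertLeft (onb (TangentSpace 𝓘(ℝ, E) x) a)
      (secondCov nabla η x v (onb (TangentSpace 𝓘(ℝ, E) x) a)) := by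
  set b := onb (TangentSpace 𝓘(ℝ, E) x)
  have hx := mem_chartDomain_self (E := E) x
  have hT := mdifferentiableAt_localCov hnabla hη x
  have hP := mdifferentiableAt_cometric (E := E) x
  have hloc : localForm (div nabla η) x =ᶠ[nhds x] fun y =>
      ∑ a, (-insertLeft (b a)) (localCov nabla η x y (cometric x y (b a))) := by
    filter_upwards [chartDomain_mem_nhds hx] with y hy
    rw [localForm_div nabla hy η, ← Finset.sum_neg_distrib]
    rfl
  have hterm a := mdifferentiableAt_mvfderiv_apply hT
    (mdifferentiableAt_linearMap_apply hP (b a))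
  have hsum := mdifferentiableAt_mvfderiv_sum (s := Finset.univ) fun a _ =>
    mdifferentiableAt_linearMap_comp (-insertLeft (b a)) (hterm a).1
  have hadj := sum_bilin_adjoint b ((insertLeftₗ _).compl₂ (covₗ nabla η x)) (conn nabla x x v)
  rw [cov_eq nabla (hsum.1.congr_of_eventuallyEq hloc), mvfderiv_congr hloc, hsum.2]
  have hd a : mvfderiv 𝓘(ℝ, E) (fun y => (-insertLeft (b a))
      (localCov nabla η x y (cometric x y (b a)))) x v =
      -insertLeft (b a) (mvfderiv 𝓘(ℝ, E) (localCov nabla η x) x v (b a)) +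
        (insertLeft (b a) (cov nabla η x (conn nabla x x v (b a))) +
        insertLeft (b a) (cov nabla η x (LinearMap.adjoint (conn nabla x x v) (b a)))) := by
    rw [mvfderiv_linearMap_comp _ (hterm a).1, (hterm a).2, mvfderiv_linearMap_apply hP,
      mvfderiv_cometric hnabla, cometric_self]
    simp only [LinearMap.id_apply, LinearMap.neg_apply, map_add, map_neg, localCov_self]
    abel
  have hdiv : div nabla η x = -∑ a, insertLeft (b a) (cov nabla η x (b a)) := rfl
  simp only [LinearMap.compl₂_apply, insertLeftₗ_apply, covₗ_apply] at hadj
  simp only [hd, hdiv, Finset.sum_add_distrib, hadj, map_neg, map_sum, secondCov_eq hnabla hη,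
    map_sub, Finset.sum_sub_distrib, insertLeft_dfDer, Finset.sum_neg_distrib]
  abel

end Laplacian

/-! ### Curvature -/

section Curvature

variable {E : Type*} [NormedAddCommGroup E] [NormedSpace ℝ E] [FiniteDimensional ℝ E]
  {M : Type*} [TopologicalSpace M] [ChartedSpace E M] [IsManifold 𝓘(ℝ, E) ∞ M]
  [RiemannianBundle (fun x : M => TangentSpace 𝓘(ℝ, E) x)]
  (nabla : CovariantDerivative 𝓘(ℝ, E) E (TangentSpace 𝓘(ℝ, E) : M → Type _))

/-- The derivative at `x` of the connection matrix in the frame of the preferred chart at `x`. -/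
def connDeriv (x : M) (u v : TangentSpace 𝓘(ℝ, E) x) : Module.End ℝ (TangentSpace 𝓘(ℝ, E) x) :=
  mvfderiv 𝓘(ℝ, E) (conn nabla x) x u v

/-- The curvature endomorphism `∇²_{v,u} - ∇²_{u,v}`, in terms of the connection matrix. -/
def curv (x : M) : TangentSpace 𝓘(ℝ, E) x →ₗ[ℝ] TangentSpace 𝓘(ℝ, E) x →ₗ[ℝ]
    Module.End ℝ (TangentSpace 𝓘(ℝ, E) x) :=
  LinearMap.mk₂ ℝ (fun u v => connDeriv nabla x v u - connDeriv nabla x u v +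
      (conn nabla x x v * conn nabla x x u - conn nabla x x u * conn nabla x x v))
    (by intro u u' v; simp only [connDeriv, map_add, LinearMap.add_apply, mul_add, add_mul]; abel)
    (by intro r u v; simp only [connDeriv, map_smul, LinearMap.smul_apply, mul_smul_comm,
          smul_mul_assoc, smul_sub, smul_add])
    (by intro u u' v; simp only [connDeriv, map_add, LinearMap.add_apply, mul_add, add_mul]; abel)
    (by intro r u v; simp only [connDeriv, map_smul, LinearMap.smul_apply, mul_smul_comm,
          smul_mul_assoc, smul_sub, smul_add])

theorem curv_apply (x : M) (u v : TangentSpace 𝓘(ℝ, E) x) : curv nabla x u v =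
    connDeriv nabla x v u - connDeriv nabla x u v +
      (conn nabla x x v * conn nabla x x u - conn nabla x x u * conn nabla x x v) := rfl

theorem curv_apply_apply (x : M) (u v z : TangentSpace 𝓘(ℝ, E) x) : curv nabla x u v z =
    connDeriv nabla x v u z - connDeriv nabla x u v z +
      (conn nabla x x v (conn nabla x x u z) - conn nabla x x u (conn nabla x x v z)) := rfl

theorem curv_swap (x : M) (u v : TangentSpace 𝓘(ℝ, E) x) :
    curv nabla x u v = -curv nabla x v u := by
  rw [curv_apply, curv_apply]
  abel

variable {nabla}

theorem mvfderiv_conn_apply (hnabla : IsLeviCivita nabla) (x : M)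
    (u v z : TangentSpace 𝓘(ℝ, E) x) :
    mvfderiv 𝓘(ℝ, E) (fun y => conn nabla x y v z) x u = connDeriv nabla x u v z := by
  have h := mdifferentiableAt_conn hnabla (mem_chartDomain_self (E := E) x)
  rw [mvfderiv_linearMap_apply (mdifferentiableAt_linearMap_apply h v),
    mvfderiv_linearMap_apply h]
  rfl

theorem connDeriv_symm (hnabla : IsLeviCivita nabla) (x : M) (u v z : TangentSpace 𝓘(ℝ, E) x) :
    connDeriv nabla x u v z = connDeriv nabla x u z v := by
  rw [← mvfderiv_conn_apply hnabla, ← mvfderiv_conn_apply hnabla]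
  refine congrArg (fun T : TangentSpace 𝓘(ℝ, E) x →L[ℝ] TangentSpace 𝓘(ℝ, E) x => T u)
    (mvfderiv_congr ?_)
  filter_upwards [chartDomain_mem_nhds (mem_chartDomain_self (E := E) x)] with y hy
  exact conn_symm hnabla hy v z

/-- Symmetry of the connection matrix and of its derivative makes the terms of the cyclic sum cancel
in pairs. -/
theorem curv_bianchi (hnabla : IsLeviCivita nabla) (x : M) (u v z : TangentSpace 𝓘(ℝ, E) x) :
    curv nabla x u v z + curv nabla x v z u + curv nabla x z u v = 0 := by
  have hx := mem_chartDomain_self (E := E) x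
  simp only [curv_apply_apply]
  rw [connDeriv_symm hnabla x u z v, connDeriv_symm hnabla x v z u, connDeriv_symm hnabla x z v u,
    conn_symm hnabla hx v z, conn_symm hnabla hx u z, conn_symm hnabla hx u v]
  abel

theorem secondCovVec_extend (hnabla : IsLeviCivita nabla) (x : M)
    (u v z : TangentSpace 𝓘(ℝ, E) x) :
    secondCovVec nabla (FiberBundle.extend E z) x u v = connDeriv nabla x u v z +
      conn nabla x x u (conn nabla x x v z) - conn nabla x x (conn nabla x x u v) z := by
  have hx := mem_chartDomain_self (E := E) x
  have h1 := (hnabla.smooth _ (isOpen_chartDomain x)).contMDiff (σ := FiberBundle.extend E z)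
    (contMDiffOn_extend x z)
  have h2 := ((ContMDiffOn.clm_bundle_apply h1 (contMDiffOn_extend x v)).contMDiffAt
    (chartDomain_mem_nhds hx)).mdifferentiableAt (by simp)
  have h3 := transportInv_nabla nabla hx h2 u
  have heq : (fun y => transportInv x y
      (nabla (FiberBundle.extend E z) y (FiberBundle.extend E v y))) =ᶠ[nhds x]
      fun y => conn nabla x y v z := by
    filter_upwards [chartDomain_mem_nhds hx] with y hy
    rw [← transportInv_nabla_extend nabla hy, transport_apply x y v hy]
  rw [transportInv_self, transport_self, mvfderiv_congr heq, mvfderiv_conn_apply hnabla,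
    transportInv_self, ← transport_apply x x v hx, transport_self, nabla_extend_self] at h3
  rw [secondCovVec, h3, nabla_extend_self, nabla_extend_self]

theorem secondCovVec_sub_secondCovVec (hnabla : IsLeviCivita nabla) (x : M)
    (u v z : TangentSpace 𝓘(ℝ, E) x) :
    secondCovVec nabla (FiberBundle.extend E z) x v u -
      secondCovVec nabla (FiberBundle.extend E z) x u v = curv nabla x u v z := by
  rw [secondCovVec_extend hnabla, secondCovVec_extend hnabla, curv_apply_apply,
    conn_symm hnabla (mem_chartDomain_self (E := E) x) v u]
  abel

set_option maxHeartbeats 1000000 in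
theorem mvfderiv_localCov (hnabla : IsLeviCivita nabla) {p q : ℕ}
    {η : ∀ x : M, DoubleForms (TangentSpace 𝓘(ℝ, E) x)} (hη : IsSmoothDoubleForm p q η) (x : M)
    (u v : TangentSpace 𝓘(ℝ, E) x) :
    mvfderiv 𝓘(ℝ, E) (localCov nabla η x) x u v =
      mvfderiv 𝓘(ℝ, E) (coordDeriv x v (localForm η x)) x u -
        (dfDer (connDeriv nabla x u v) (η x) +
          dfDer (conn nabla x x v) (mvfderiv 𝓘(ℝ, E) (localForm η x) x u)) := by
  have hx := mem_chartDomain_self (E := E) x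
  have hT := mdifferentiableAt_localCov hnabla hη x
  have h1 := ((contMDiffOn_coordDeriv (hη.contMDiffOn_localForm x) v).contMDiffAt
    (chartDomain_mem_nhds hx)).mdifferentiableAt (by simp)
  have h2 := mdifferentiableAt_mvfderiv_dfDer_conn hnabla (hη.mdifferentiableAt_localForm hx) v
  have heq : (fun y => localCov nabla η x y v) =ᶠ[nhds x] (coordDeriv x v (localForm η x) -
      fun y => dfDer (conn nabla x y v) (localForm η x y)) := by
    filter_upwards [chartDomain_mem_nhds hx] with y hy
    exact localCov_eq nabla hη hy v
  have h3 := h2.2 u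
  rw [localForm_self] at h3
  rw [← mvfderiv_linearMap_apply hT, mvfderiv_congr heq, mvfderiv_sub h1 h2.1]
  exact congrArg (mvfderiv 𝓘(ℝ, E) (coordDeriv x v (localForm η x)) x u - ·) h3

/-- The cancellation behind the Ricci identity: `D` stands for second derivatives, `C` for the
differentiated connection, `B` for mixed first-order terms, `R` for products of two connection
matrices and `Q` for the `∇_{∇_u v}` terms; primes exchange `u` and `v`. -/
theorem sub_eq_neg_of_eq_sub_sub {W : Type*} [AddCommGroup W]
    {X X' T T' D D' C C' B B' P P' R R' Q Q' K : W} (hX : X = T - P - Q) (hX' : X' = T' - P' - Q')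
    (hT : T = D - (C + B')) (hT' : T' = D' - (C' + B)) (hP : P = B - R) (hP' : P' = B' - R')
    (hD : D = D') (hQ : Q = Q') (hK : K = C' - C + (R - R')) : X' - X = -K := by
  subst hX hX' hT hT' hP hP' hD hQ hK
  abel

theorem dfDer_sub_add_commutator {V : Type*} [NormedAddCommGroup V] [InnerProductSpace ℝ V]
    [FiniteDimensional ℝ V] (C D A B : Module.End ℝ V) (θ : DoubleForms V) :
    dfDer (C - D + (B * A - A * B)) θ = dfDer C θ - dfDer D θ +
      (dfDer A (dfDer B θ) - dfDer B (dfDer A θ)) := by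
  rw [dfDer_commutator, map_add, map_sub, LinearMap.add_apply, LinearMap.sub_apply]

/-- The Ricci identity. Second derivatives commute, first-order terms cancel, and vanishing torsion
removes the `∇_{∇_u v}` terms; what survives is the derivation given by the curvature of the
connection matrix. -/
theorem secondCov_sub_secondCov (hnabla : IsLeviCivita nabla) {p q : ℕ}
    {η : ∀ x : M, DoubleForms (TangentSpace 𝓘(ℝ, E) x)} (hη : IsSmoothDoubleForm p q η) (x : M)
    (u v : TangentSpace 𝓘(ℝ, E) x) :
    secondCov nabla η x v u - secondCov nabla η x u v = -dfDer (curv nabla x u v) (η x) := by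
  have hx := mem_chartDomain_self (E := E) x
  have hloc := hη.mdifferentiableAt_localForm hx
  have hcov (u v : TangentSpace 𝓘(ℝ, E) x) : dfDer (conn nabla x x u) (cov nabla η x v) =
      dfDer (conn nabla x x u) (mvfderiv 𝓘(ℝ, E) (localForm η x) x v) -
        dfDer (conn nabla x x u) (dfDer (conn nabla x x v) (η x)) :=
    (congrArg _ (cov_eq nabla hloc v)).trans (map_sub (dfDer (conn nabla x x u)) _ _)
  have hcurv : dfDer (curv nabla x u v) (η x) = _ :=
    dfDer_sub_add_commutator (connDeriv nabla x v u) (connDeriv nabla x u v) (conn nabla x x u)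
      (conn nabla x x v) (η x)
  exact sub_eq_neg_of_eq_sub_sub (secondCov_eq hnabla hη x u v) (secondCov_eq hnabla hη x v u)
    (mvfderiv_localCov hnabla hη x u v) (mvfderiv_localCov hnabla hη x v u) (hcov u v) (hcov v u)
    (coordDeriv_comm (hη.contMDiffOn_localForm x) u v)
    (congrArg (cov nabla η x) (conn_symm hnabla hx u v)) hcurv

variable [IsContMDiffRiemannianBundle 𝓘(ℝ, E) ∞ E (fun x : M => TangentSpace 𝓘(ℝ, E) x)]

/-- Compatibility with the metric, used twice, computes the second derivatives of `g(z, w)` for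
constant-coefficient `z` and `w`. Their symmetry in `u` and `v` is the claim, the terms with one
connection matrix on each argument cancelling. -/
theorem inner_curv_swap (hnabla : IsLeviCivita nabla) (x : M) (u v z w : TangentSpace 𝓘(ℝ, E) x) :
    (inner ℝ (curv nabla x u v z) w : ℝ) = -inner ℝ (curv nabla x u v w) z := by
  have hx := mem_chartDomain_self (E := E) x
  let g : M → TangentSpace 𝓘(ℝ, E) x →ₗ[ℝ] TangentSpace 𝓘(ℝ, E) x →ₗ[ℝ] ℝ := fun y =>
    (innerₗ _).compl₁₂ (transport x y) (transport x y)
  have hg : MDifferentiableAt 𝓘(ℝ, E) 𝓘(ℝ, TangentSpace 𝓘(ℝ, E) x →ₗ[ℝ]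
      TangentSpace 𝓘(ℝ, E) x →ₗ[ℝ] ℝ) g x :=
    mdifferentiableAt_linearMap fun a => mdifferentiableAt_linearMap fun b =>
      ((contMDiffOn_inner_transport x a b).contMDiffAt (chartDomain_mem_nhds hx)).mdifferentiableAt
        (by simp)
  have hgx (a b : TangentSpace 𝓘(ℝ, E) x) : g x a b = inner ℝ a b := by
    change inner ℝ (transport x x a) (transport x x b) = _
    rw [transport_self, transport_self]
  have hg' (u a b : TangentSpace 𝓘(ℝ, E) x) : mvfderiv 𝓘(ℝ, E) g x u a b =
      inner ℝ (conn nabla x x u a) b + inner ℝ a (conn nabla x x u b) := by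
    have h := coordDeriv_inner hnabla hx u a b
    simp only [coordDeriv, transport_self] at h
    rw [← h, ← mvfderiv_linearMap_apply hg,
      ← mvfderiv_linearMap_apply (mdifferentiableAt_linearMap_apply hg a)]
    rfl
  have hc (v a : TangentSpace 𝓘(ℝ, E) x) := mdifferentiableAt_linearMap_apply
    (mdifferentiableAt_linearMap_apply (mdifferentiableAt_conn hnabla hx) v) a
  have hterm (u v a b : TangentSpace 𝓘(ℝ, E) x) :
      MDifferentiableAt 𝓘(ℝ, E) 𝓘(ℝ, ℝ) (fun y => g y (conn nabla x y v a) b) x ∧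
      mvfderiv 𝓘(ℝ, E) (fun y => g y (conn nabla x y v a) b) x u =
        inner ℝ (conn nabla x x u (conn nabla x x v a)) b +
          inner ℝ (conn nabla x x v a) (conn nabla x x u b) +
            inner ℝ (connDeriv nabla x u v a) b := by
    have h := mdifferentiableAt_mvfderiv_apply hg (hc v a)
    refine ⟨mdifferentiableAt_linearMap_apply h.1 b, ?_⟩
    rw [mvfderiv_linearMap_apply h.1, h.2, LinearMap.add_apply, hg', hgx,
      mvfderiv_conn_apply hnabla]
  have key (u v : TangentSpace 𝓘(ℝ, E) x) :
      mvfderiv 𝓘(ℝ, E) (coordDeriv x v fun y => inner ℝ (transport x y z) (transport x y w)) x u =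
      (inner ℝ (conn nabla x x u (conn nabla x x v z)) w +
          inner ℝ (conn nabla x x v z) (conn nabla x x u w) +
            inner ℝ (connDeriv nabla x u v z) w) +
        (inner ℝ (conn nabla x x u (conn nabla x x v w)) z +
          inner ℝ (conn nabla x x v w) (conn nabla x x u z) +
            inner ℝ (connDeriv nabla x u v w) z) := by
    have heq : (coordDeriv x v fun y => (inner ℝ (transport x y z) (transport x y w) : ℝ))
        =ᶠ[nhds x] ((fun y => g y (conn nabla x y v z) w) + fun y => g y (conn nabla x y v w) z) := by
      filter_upwards [chartDomain_mem_nhds hx] with y hy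
      rw [coordDeriv_inner hnabla hy, real_inner_comm (transport x y (conn nabla x y v w))]
      rfl
    rw [mvfderiv_congr heq, mvfderiv_add (hterm u v z w).1 (hterm u v w z).1, ← (hterm u v z w).2,
      ← (hterm u v w z).2]
    rfl
  have hcomm := coordDeriv_comm (contMDiffOn_inner_transport x z w) u v
  rw [key, key] at hcomm
  simp only [curv_apply_apply, inner_add_left, inner_sub_left]
  rw [real_inner_comm (conn nabla x x v z) (conn nabla x x u w),
    real_inner_comm (conn nabla x x u z) (conn nabla x x v w)] at hcomm
  linarith

end Curvature

/-! ### The Weitzenböck formula on the manifold. -/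

section Weitzenboeck

variable {E : Type*} [NormedAddCommGroup E] [NormedSpace ℝ E] [FiniteDimensional ℝ E]
  {M : Type*} [TopologicalSpace M] [ChartedSpace E M] [IsManifold 𝓘(ℝ, E) ∞ M]
  [RiemannianBundle (fun x : M => TangentSpace 𝓘(ℝ, E) x)]
  {nabla : CovariantDerivative 𝓘(ℝ, E) E (TangentSpace 𝓘(ℝ, E) : M → Type _)}

theorem riemann_eq (hnabla : IsLeviCivita nabla) (x : M) :
    riemann nabla x = doubleFormOfTensor fun u v z w => inner ℝ (curv nabla x u v z) w := by
  simp only [riemann, secondCovVec_sub_secondCovVec hnabla]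

theorem weit_eq (hnabla : IsLeviCivita nabla) {p q : ℕ}
    {η : ∀ x : M, DoubleForms (TangentSpace 𝓘(ℝ, E) x)} (hη : IsSmoothDoubleForm p q η) (x : M)
    (e : OrthonormalBasis (Fin (Module.finrank ℝ (TangentSpace 𝓘(ℝ, E) x))) ℝ
      (TangentSpace 𝓘(ℝ, E) x)) :
    weit nabla η x e =
      -∑ i, ∑ j, insertLeft (e i) (flatLeft (e j) * dfDer (curv nabla x (e i) (e j)) (η x)) := by
  rw [weit, ← Finset.sum_neg_distrib]
  refine Finset.sum_congr rfl fun i _ => ?_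
  rw [← Finset.sum_neg_distrib]
  refine Finset.sum_congr rfl fun j _ => ?_
  rw [secondCov_sub_secondCov hnabla hη, mul_neg, map_neg]

/-- A double trace: the basis is changed in one summation index at a time, with the other vector
held fixed. -/
theorem sum_insertLeft_flatLeft_mul_onb_eq {V ι κ : Type*} [Fintype ι] [Fintype κ]
    [NormedAddCommGroup V] [InnerProductSpace ℝ V] (b : OrthonormalBasis ι ℝ V)
    (e : OrthonormalBasis κ ℝ V) (C : V →ₗ[ℝ] V →ₗ[ℝ] DoubleForms V) :
    ∑ i, ∑ j, insertLeft (b i) (flatLeft (b j) * C (b i) (b j)) =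
      ∑ i, ∑ j, insertLeft (e i) (flatLeft (e j) * C (e i) (e j)) := by
  let fl : V →ₗ[ℝ] DoubleForms V :=
    (TensorProduct.mk ℝ (Forms V) (Forms V)).flip 1 ∘ₗ ExteriorAlgebra.ι ℝ ∘ₗ innerₗ V
  let β (w w' : V) : V →ₗ[ℝ] V →ₗ[ℝ] DoubleForms V :=
    ((LinearMap.mul ℝ (DoubleForms V)).compl₁₂ fl (C w)).compr₂ (insertLeft w')
  have h1 (w : V) : ∑ j, insertLeft w (flatLeft (b j) * C w (b j)) =
      ∑ j, insertLeft w (flatLeft (e j) * C w (e j)) := sum_bilin_onb_eq b e (β w w)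
  let γ (w : V) : V →ₗ[ℝ] V →ₗ[ℝ] DoubleForms V :=
    (insertLeftₗ V).compl₂ (LinearMap.mulLeft ℝ (flatLeft w) ∘ₗ C.flip w)
  have h2 (w : V) : ∑ i, insertLeft (b i) (flatLeft w * C (b i) w) =
      ∑ i, insertLeft (e i) (flatLeft w * C (e i) w) := sum_bilin_onb_eq b e (γ w)
  simp only [h1]
  rw [Finset.sum_comm]
  simp only [h2]
  exact Finset.sum_comm

theorem weit_onb_eq (hnabla : IsLeviCivita nabla) {p q : ℕ}
    {η : ∀ x : M, DoubleForms (TangentSpace 𝓘(ℝ, E) x)} (hη : IsSmoothDoubleForm p q η) (x : M)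
    (e : OrthonormalBasis (Fin (Module.finrank ℝ (TangentSpace 𝓘(ℝ, E) x))) ℝ
      (TangentSpace 𝓘(ℝ, E) x)) :
    weit nabla η x e = weit nabla η x (onb (TangentSpace 𝓘(ℝ, E) x)) := by
  rw [weit_eq hnabla hη, weit_eq hnabla hη]
  exact congrArg Neg.neg (sum_insertLeft_flatLeft_mul_onb_eq e _
    ((curv nabla x).compr₂ (dfDer.flip (η x))))

variable [IsContMDiffRiemannianBundle 𝓘(ℝ, E) ∞ E (fun x : M => TangentSpace 𝓘(ℝ, E) x)]

theorem hodgeLaplacian_eq (hnabla : IsLeviCivita nabla) {p q : ℕ}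
    {η : ∀ x : M, DoubleForms (TangentSpace 𝓘(ℝ, E) x)} (hη : IsSmoothDoubleForm p q η) (x : M) :
    hodgeLaplacian nabla η x =
      connectionLaplacian nabla η x + weit nabla η x (onb (TangentSpace 𝓘(ℝ, E) x)) := by
  set b := onb (TangentSpace 𝓘(ℝ, E) x)
  -- Anticommuting insertion and multiplication turns the term from `Dδ` into the order in which it
  -- occurs in the curvature term; the diagonal remainder is the trace of the second covariant
  -- derivative.
  have hdiag : ∑ i, ∑ j, insertLeft (b i) (flatLeft (b j) * secondCov nabla η x (b j) (b i)) =
      ∑ i, secondCov nabla η x (b i) (b i) -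
        ∑ i, ∑ j, flatLeft (b j) * insertLeft (b i) (secondCov nabla η x (b j) (b i)) := by
    rw [← Finset.sum_sub_distrib]
    refine Finset.sum_congr rfl fun i _ => ?_
    simp only [insertLeft_flatLeft_mul, Finset.sum_sub_distrib,
      orthonormal_iff_ite.1 b.orthonormal, ite_smul, one_smul, zero_smul, Finset.sum_ite_eq',
      Finset.mem_univ, if_true]
  have h1 : extD nabla (div nabla η) x =
      -∑ i, ∑ j, flatLeft (b j) * insertLeft (b i) (secondCov nabla η x (b j) (b i)) := by
    rw [extD, Finset.sum_comm]
    simp only [cov_div hnabla hη, mul_neg, Finset.mul_sum, Finset.sum_neg_distrib]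
    rfl
  have h2 : div nabla (extD nabla η) x =
      -∑ i, ∑ j, insertLeft (b i) (flatLeft (b j) * secondCov nabla η x (b i) (b j)) := by
    rw [div]
    simp only [cov_extD hnabla hη, map_sum]
    rfl
  have h3 : weit nabla η x b =
      ∑ i, ∑ j, insertLeft (b i) (flatLeft (b j) * secondCov nabla η x (b j) (b i)) -
        ∑ i, ∑ j, insertLeft (b i) (flatLeft (b j) * secondCov nabla η x (b i) (b j)) := by
    simp only [weit, mul_sub, map_sub, Finset.sum_sub_distrib]
  have h4 : connectionLaplacian nabla η x = -∑ i, secondCov nabla η x (b i) (b i) := rfl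
  rw [hodgeLaplacian, h1, h2, h3, h4, hdiag]
  abel

theorem weit_onb (hnabla : IsLeviCivita nabla) {p q : ℕ}
    {η : ∀ x : M, DoubleForms (TangentSpace 𝓘(ℝ, E) x)} (hη : IsSmoothDoubleForm p q η) (x : M) :
    weit nabla η x (onb (TangentSpace 𝓘(ℝ, E) x)) =
      comp (η x) (metricPow (TangentSpace 𝓘(ℝ, E) x) ((p : ℤ) - 1) * ricci nabla x -
          (2 : ℝ) • (metricPow (TangentSpace 𝓘(ℝ, E) x) ((p : ℤ) - 2) * riemann nabla x)) -
        (1 / 4 : ℝ) • sharpProduct (riemann nabla x) (η x) := by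
  have h := weitzenboeck_curvature_identity (V := TangentSpace 𝓘(ℝ, E) x)
    (fun u v => curv nabla x u v) (fun u v => curv_swap nabla x u v)
    (fun u v z w => inner_curv_swap hnabla x u v z w)
    (fun u v z => curv_bianchi hnabla x u v z) (hη.bidegree x)
  rw [ricci, riemann_eq hnabla x]
  exact (weit_eq hnabla hη x _).trans h

end Weitzenboeck

end DForm

end

theorem mainTheorem7 {E : Type*} [NormedAddCommGroup E] [NormedSpace ℝ E] [FiniteDimensional ℝ E]
    {M : Type*} [TopologicalSpace M] [T2Space M] [ChartedSpace E M] [IsManifold 𝓘(ℝ, E) ∞ M]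
    [RiemannianBundle (fun x : M => TangentSpace 𝓘(ℝ, E) x)]
    [IsContMDiffRiemannianBundle 𝓘(ℝ, E) ∞ E (fun x : M => TangentSpace 𝓘(ℝ, E) x)]
    (nabla : CovariantDerivative 𝓘(ℝ, E) E (TangentSpace 𝓘(ℝ, E) : M → Type _))
    (hnabla : DForm.IsLeviCivita nabla) (p q : ℕ)
    (η : ∀ x : M, DForm.DoubleForms (TangentSpace 𝓘(ℝ, E) x))
    (hη : DForm.IsSmoothDoubleForm p q η) (x : M)
    (e : OrthonormalBasis (Fin (Module.finrank ℝ (TangentSpace 𝓘(ℝ, E) x))) ℝ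
      (TangentSpace 𝓘(ℝ, E) x)) :
    DForm.hodgeLaplacian nabla η x =
        DForm.connectionLaplacian nabla η x + DForm.weit nabla η x e ∧
      DForm.weit nabla η x e =
        DForm.comp (η x)
            (DForm.metricPow (TangentSpace 𝓘(ℝ, E) x) ((p : ℤ) - 1) * DForm.ricci nabla x
              - (2 : ℝ) • (DForm.metricPow (TangentSpace 𝓘(ℝ, E) x) ((p : ℤ) - 2) *
                  DForm.riemann nabla x))
          - (1 / 4 : ℝ) • DForm.sharpProduct (DForm.riemann nabla x) (η x) := by
  refine ⟨?_, ?_⟩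
  · rw [DForm.weit_onb_eq hnabla hη x e]
    exact DForm.hodgeLaplacian_eq hnabla hη x
  · rw [DForm.weit_onb_eq hnabla hη x e]
    exact DForm.weit_onb hnabla hη x
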